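/- Let $\tau\in\mathfrak H$, $q=e^{2\pi i\tau}$, $q^{x}=e^{2\pi i x\tau}$ for $x\in\mathbf Q$, and let $[\delta]$ denote the function $\tau\mapsto\eta(\delta\tau)$, where $\eta=q^{1/24}\prod_{n\ge1}(1-q^n)$. Put $$\mathscr B_4=\mathscr B_2=\frac{[1]^4}{[2]^2},\quad \mathscr C_4=2^{3/2}\frac{[2]^4}{[1]^2},\quad \mathscr B_3=\frac{[1]^3}{[3]},\quad \mathscr C_3=3\,\frac{[3]^3}{[1]},\quad \mathscr C_2=2^2\,\frac{[4]^4}{[2]^2}.$$ For $\chi\colon\mathbf Z/N\mathbf Z\to\mathbf C$, listed as $\chi(0),\dots,\chi(N-1)$, put $\sigma_k(n;\chi)=\sum_{d\mid n}\chi(d)\,d^k$ and $\sigma^{\mathrm c}_k(n;\chi)=\sum_{d\mid n}\chi(n/d)\,d^k$. (1) The following expansions hold on $\mathfrak H$, all series (over $n\ge1$) being convergent: \begin{align*} \mathscr B_4&=1-4\sum\sigma_0(n;0,1,-2,-1,0,1,2,-1)\,q^n,\\ \mathscr C_4&=2^{3/2}\sum\sigma_0(n;0,1,-1,-1,0,1,1,-1)\,q^{n/4},\\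 \mathscr B_4^2&=1-8\sum\sigma_1(n;0,1,-2,1)\,q^n,\\ \mathscr C_4^2&=4\sum\sigma_1(n;0,2,-1,2)\,q^{n/2},\\ \mathscr B_3&=1-3\sum\sigma_0(n;0,1,-1,-3,1,-1,3,1,-1)\,q^n,\\ \mathscr C_3&=3\sum\sigma_0(n;0,1,-1,-1,1,-1,1,1,-1)\,q^{n/3},\\ \mathscr B_2&=1-4\sum\sigma_0(n;0,1,-2,-1,0,1,2,-1)\,q^n,\\ \mathscr C_2&=4\sum\sigma_0(n;0,1,-1,-1,0,1,1,-1)\,q^{n/2},\\ \mathscr B_2^3&=1+2\sum\sigma_2(n;0,2,-1,-2,0,2,1,-2)\,q^n-16\sum\sigma^{\mathrm c}_2(n;0,1,-8,-1,0,1,8,-1)\,q^n,\\ \mathscr C_2^3&=\sum\sigma_2(n;0,-4,1,4,0,-4,-1,4)\,q^{n/2}+4\sum\sigma^{\mathrm c}_2(n;0,1,-4,-1,0,1,4,-1)\,q^{n/2}. \end{align*} (2) Each of these ten functions is a modular form (holomorphic on $\mathfrak H$ and bounded at all cusps), of weight $1,1,2,2$ on $\Gamma_0(2)$, of weight $1,1$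 on $\Gamma_0(3)$, and of weight $1,1,3,3$ on $\Gamma_0(4)$, respectively, with a $\mathbf C^\times$-valued multiplier system $\hat\chi(a,b,c,d)$ that is not of the form $\chi(d)$ for any Dirichlet character $\chi$ modulo the level ($2$, $3$, resp. $4$). (3) Let $M_k(\Gamma_0(N),\chi)$ be the space of modular forms of weight $k$ on $\Gamma_0(N)$ with multiplier system $\chi(d)$, and let $\chi_{-3},\chi_{-4}$ be the nontrivial Dirichlet characters mod $3$ and mod $4$. Then $\mathscr B_3(q),\mathscr C_3(q^3)\in M_1(\Gamma_0(9),\chi_{-3})$; $\mathscr B_2(q),\mathscr C_2(q^2)\in M_1(\Gamma_0(8),\chi_{-4})$; and $\mathscr B_2^3(q),\mathscr C_2^3(q^2)\in M_3(\Gamma_0(8),\chi_{-4})$. (4) For primitive Dirichlet characters $\psi,\phi$ let $\hat E_k(\psi,\phi)=\sum_{n\ge1}\bigl[\sum_{d\mid n}\psi(n/d)\phi(d)d^{k-1}\bigr]q^n$, and let $E_k^{\psi,\phi}$ equal $1+\frac{2}{L(1-k,\phi)}\hat E_k(\psi,\phi)$ if $\psi$ is the trivial character $\mathbf 1$ of period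 $1$, and $2\hat E_k(\psi,\phi)$ otherwise. Then \begin{align*} \mathscr B_3(q)&=-\tfrac12E_1^{\mathbf 1,\chi_{-3}}(q)+\tfrac32E_1^{\mathbf 1,\chi_{-3}}(q^3),\qquad \mathscr C_3(q^3)=\tfrac12E_1^{\mathbf 1,\chi_{-3}}(q)-\tfrac12E_1^{\mathbf 1,\chi_{-3}}(q^3),\\ \mathscr B_2(q)&=-E_1^{\mathbf 1,\chi_{-4}}(q)+2E_1^{\mathbf 1,\chi_{-4}}(q^2),\qquad \mathscr C_2(q^2)=E_1^{\mathbf 1,\chi_{-4}}(q)-E_1^{\mathbf 1,\chi_{-4}}(q^2),\\ \mathscr B_2^3(q)&=-E_3^{\mathbf 1,\chi_{-4}}(q)+2E_3^{\mathbf 1,\chi_{-4}}(q^2)-8E_3^{\chi_{-4},\mathbf 1}(q)+64E_3^{\chi_{-4},\mathbf 1}(q^2),\\ \mathscr C_2^3(q^2)&=E_3^{\mathbf 1,\chi_{-4}}(q)-E_3^{\mathbf 1,\chi_{-4}}(q^2)+2E_3^{\chi_{-4},\mathbf 1}(q)-8E_3^{\chi_{-4},\mathbf 1}(q^2). \end{align*}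 -/

import Mathlib

open UpperHalfPlane
open scoped MatrixGroups ModularForm Manifold

noncomputable section

/-- The function `[δ] : τ ↦ η(δτ)`, where `η = q^(1/24) ∏_{n ≥ 1} (1 - q^n)` is the
Dedekind eta function. -/
def etaAt (δ : ℕ) (τ : ℍ) : ℂ := ModularForm.eta ((δ : ℂ) * (τ : ℂ))

/-- `ℬ₄ = [1]⁴ / [2]²`. -/
def B4 (τ : ℍ) : ℂ := etaAt 1 τ ^ 4 / etaAt 2 τ ^ 2

/-- `𝒞₄ = 2^(3/2) [2]⁴ / [1]²`. -/
def C4 (τ : ℍ) : ℂ := (((2 : ℝ) ^ (3 / 2 : ℝ) : ℝ) : ℂ) * etaAt 2 τ ^ 4 / etaAt 1 τ ^ 2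

/-- `ℬ₃ = [1]³ / [3]`. -/
def B3 (τ : ℍ) : ℂ := etaAt 1 τ ^ 3 / etaAt 3 τ

/-- `𝒞₃ = 3 [3]³ / [1]`. -/
def C3 (τ : ℍ) : ℂ := 3 * etaAt 3 τ ^ 3 / etaAt 1 τ

/-- `ℬ₂ = [1]⁴ / [2]²`. -/
def B2 (τ : ℍ) : ℂ := etaAt 1 τ ^ 4 / etaAt 2 τ ^ 2

/-- `𝒞₂ = 2² [4]⁴ / [2]²`. -/
def C2 (τ : ℍ) : ℂ := 2 ^ 2 * etaAt 4 τ ^ 4 / etaAt 2 τ ^ 2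

/-- `q^x = exp(2πi x τ)` for a rational exponent `x`. -/
def qpow (x : ℚ) (τ : ℍ) : ℂ := Complex.exp (2 * Real.pi * Complex.I * (x : ℂ) * (τ : ℂ))

/-- The weighted divisor function `σ_k(n; χ) = ∑_{d ∣ n} χ(d mod N) d^k`, the weight being listed
as `χ(0), …, χ(N-1)`. -/
def sigmaW {N : ℕ} [NeZero N] (k n : ℕ) (χ : Fin N → ℂ) : ℂ :=
  ∑ d ∈ n.divisors, χ (Fin.ofNat N d) * (d : ℂ) ^ k

/-- The conjugate weighted divisor function `σᶜ_k(n; χ) = ∑_{d ∣ n} χ((n/d) mod N) d^k`. -/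
def sigmaC {N : ℕ} [NeZero N] (k n : ℕ) (χ : Fin N → ℂ) : ℂ :=
  ∑ d ∈ n.divisors, χ (Fin.ofNat N (n / d)) * (d : ℂ) ^ k

/-- `f` is a modular form of weight `k` on `Γ` with multiplier `v`: it is holomorphic on `ℍ`,
`f((aτ+b)/(cτ+d)) = v(γ) (cτ+d)^k f(τ)` for `γ = (a b; c d)` in `Γ`, and it is bounded at all the
cusps. -/
structure IsModularForm (Γ : Subgroup SL(2, ℤ)) (k : ℕ) (v : SL(2, ℤ) → ℂ) (f : ℍ → ℂ) :
    Prop where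
  holo : MDiff f
  transform : ∀ γ ∈ Γ, ∀ τ : ℍ,
    f (γ • τ) = v γ * (((γ.1 1 0 : ℤ) : ℂ) * (τ : ℂ) + ((γ.1 1 1 : ℤ) : ℂ)) ^ k * f τ
  bounded : ∀ A : SL(2, ℤ), IsBoundedAtImInfty (f ∣[(k : ℤ)] A)

/-- The space `M_k(Γ₀(N), χ)` of modular forms with the multiplier `χ(d)`. -/
def MemM (k N : ℕ) (χ : DirichletCharacter ℂ N) (f : ℍ → ℂ) : Prop :=
  IsModularForm (CongruenceSubgroup.Gamma0 N) k (fun γ => χ ((γ.1 1 1 : ℤ) : ZMod N)) f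

/-- `f` is a modular form of weight `k` on `Γ₀(N)` with a `ℂˣ`-valued multiplier system that is not
of Dirichlet-character type, i.e. not `γ = (a b; c d) ↦ χ(d)` for a Dirichlet character
`χ` mod `N`. -/
def HasNonDirichletMultiplier (N k : ℕ) (f : ℍ → ℂ) : Prop :=
  ∃ v : SL(2, ℤ) → ℂˣ,
    IsModularForm (CongruenceSubgroup.Gamma0 N) k (fun γ => (v γ : ℂ)) f ∧
    ∀ χ : DirichletCharacter ℂ N, ∃ γ ∈ CongruenceSubgroup.Gamma0 N,
      (v γ : ℂ) ≠ χ ((γ.1 1 1 : ℤ) : ZMod N)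

/-- The point `ℓτ`, so that `f (scale ℓ τ)` is `f(q^ℓ)`. -/
def scale (l : ℕ+) (τ : ℍ) : ℍ :=
  ⟨((l : ℕ) : ℂ) * (τ : ℂ), by
    have h : (0 : ℝ) < ((l : ℕ) : ℝ) := by exact_mod_cast l.pos
    have := mul_pos h τ.im_pos
    simpa using this⟩

/-- The Dirichlet character mod `3` with `1 ↦ 1`, `2 ↦ -1`. -/
def chi3 : DirichletCharacter ℂ 3 :=
  (quadraticChar (ZMod 3)).ringHomComp (Int.castRingHom ℂ)

/-- The Dirichlet character mod `4` with `1 ↦ 1`, `3 ↦ -1`. -/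
def chi4 : DirichletCharacter ℂ 4 :=
  ZMod.χ₄.ringHomComp (Int.castRingHom ℂ)

/-- `χ₋₃` as a character mod `9`. -/
def chi3mod9 : DirichletCharacter ℂ 9 :=
  DirichletCharacter.changeLevel (by norm_num : 3 ∣ 9) chi3

/-- `χ₋₄` as a character mod `8`. -/
def chi4mod8 : DirichletCharacter ℂ 8 :=
  DirichletCharacter.changeLevel (by norm_num : 4 ∣ 8) chi4

/-- `Ê_k(ψ, φ) = ∑_{n ≥ 1} (∑_{d ∣ n} ψ(n/d) φ(d) d^(k-1)) q^n`, for `k ≥ 1`. -/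
def EisHat {u v : ℕ} (k : ℕ) (ψ : DirichletCharacter ℂ u) (φ : DirichletCharacter ℂ v)
    (τ : ℍ) : ℂ :=
  ∑' n : ℕ+, (∑ d ∈ (n : ℕ).divisors,
    ψ (((n : ℕ) / d : ℕ) : ZMod u) * φ (d : ZMod v) * (d : ℂ) ^ (k - 1)) * qpow (n : ℕ) τ

/-- The Eisenstein series `E_k^{ψ,φ}` of primitive characters `ψ` (mod `u`) and `φ` (mod `v`).
Thus `ψ` is the trivial character if and only if `u = 1`. -/
def Eis {u v : ℕ} [NeZero v] (k : ℕ) (ψ : DirichletCharacter ℂ u) (φ : DirichletCharacter ℂ v)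
    (τ : ℍ) : ℂ :=
  if u = 1 then 1 + 2 / DirichletCharacter.LFunction φ (1 - (k : ℂ)) * EisHat k ψ φ τ
  else 2 * EisHat k ψ φ τ

/-- The trivial character of period `1`. -/
def triv : DirichletCharacter ℂ 1 := 1

end

/-!
The eta quotients are products of theta functions at torsion points, and everything rests on
Kronecker's formula (`kroneckerSeries_mul_thetaProd`), which writes `E² θ(xy) / (θ(x) θ(y))`, with
`E = ∏ (1 - q^n)`, as a double Lambert series in `x`, `y` and `q`. It is proved by a Liouville
argument: the difference of the two sides is holomorphic and quasiperiodic under `x ↦ q x` with a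
multiplier that admits only the zero function.

Specialising `x` and `y` to roots of unity of order `4` and `2` gives `ϕ(-q)²`, where
`ϕ(q) = ∑ q^{n²}`, as a Lambert series with the character `χ₋₄`; the order `3` gives `ℬ₃` with the
character `χ₋₃`. Specialising to `x = y = t^N` in the base `t^{N²}` gives a sum over the residue
classes `±1` modulo `N`, and with `N = 4` and `N = 3` the forms `𝒞₂`, `𝒞₄` and `𝒞₃`. The first
logarithmic derivative of the formula in `x` gives the weight two expansions, the second one
expresses the two Eisenstein series of weight three with character `χ₋₄` as cubic forms in `ϕ(q)²`
and `ϕ(-q)²`. All the `q`-expansions follow from these by linear algebra, since the periodic weights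
are combinations of a character and its dilate.

The normalised Eisenstein series involve the values `L(0, χ₋₃) = 1/3`, `L(0, χ₋₄) = 1/2` and
`L(-2, χ₋₄) = -1/2`. The first two come from the functional equation and the partial fraction
expansion of the cotangent, the third from a Bernoulli polynomial.

For the modular behaviour, `Γ₀(N)` with `2 ≤ N ≤ 4` is generated by `T`, `(1 0; N 1)` and `-1`
(`mem_closure_of_mem_Gamma0`), and `(1 0; N 1)` is conjugate to `T^{-N}` under `S`. The
transformation of `η` under `T` and `S` therefore determines the multiplier of an eta quotient
on generators (`isWeightOneForm_etaQuot`), and this already shows that it is not a function `χ(d)`.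
Boundedness at the cusps reduces to the cusps `∞` and `0` for prime level, and to a substitution
`τ ↦ 2τ` for level `4`. Finally the multiplier is identified in closed form as a Dirichlet character
times a root of unity (`IsWeightOneForm.isModularForm_of_exponent`), and the root of unity becomes
trivial on `Γ₀(9)` and `Γ₀(8)`, or after the substitutions `τ ↦ 3τ` and `τ ↦ 2τ`.
-/

/-! ### Infinite products -/

/-- The infinite `q`-Pochhammer symbol `(x; q)_∞ = ∏_{n ≥ 0} (1 - x q^n)`. -/
noncomputable def qPoch (q x : ℂ) : ℂ := ∏' n : ℕ, (1 - x * q ^ n)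

/-- The theta product `(x; q)_∞ (q / x; q)_∞`, as a function of `x ≠ 0`. -/
noncomputable def thetaProd (q x : ℂ) : ℂ := qPoch q x * qPoch q (q / x)

/-- Euler's product `∏_{n ≥ 1} (1 - q^n)`. -/
noncomputable def eulerProd (q : ℂ) : ℂ := qPoch q q

section Poch

variable {q : ℂ}

lemma summable_norm_mul_pow (hq : ‖q‖ < 1) (x : ℂ) : Summable fun n : ℕ ↦ ‖x * q ^ n‖ := by
  simpa using (summable_geometric_of_lt_one (norm_nonneg _) hq).mul_left ‖x‖

lemma multipliable_qPoch (hq : ‖q‖ < 1) (x : ℂ) : Multipliable fun n : ℕ ↦ 1 - x * q ^ n := by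
  simpa [sub_eq_add_neg] using multipliable_one_add_of_summable (f := fun n : ℕ ↦ -(x * q ^ n))
    (by simpa using summable_norm_mul_pow hq x)

lemma qPoch_succ (hq : ‖q‖ < 1) (x : ℂ) : qPoch q x = (1 - x) * qPoch q (x * q) := by
  have h := (multipliable_qPoch hq (x * q))
  rw [qPoch, tprod_eq_zero_mul' (by simpa [pow_succ', mul_assoc] using h)]
  simp [qPoch, pow_succ', mul_assoc]

lemma qPoch_ne_zero (hq : ‖q‖ < 1) {x : ℂ} (hx : ∀ n : ℕ, x * q ^ n ≠ 1) : qPoch q x ≠ 0 := by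
  have := tprod_one_add_ne_zero_of_summable (f := fun n : ℕ ↦ -(x * q ^ n))
    (fun n h ↦ hx n (by linear_combination -h)) (by simpa using summable_norm_mul_pow hq x)
  simpa [qPoch, sub_eq_add_neg] using this

lemma qPoch_ne_zero_of_norm_lt (hq : ‖q‖ < 1) {x : ℂ} (hx : ‖x‖ < 1) : qPoch q x ≠ 0 := by
  refine qPoch_ne_zero hq fun n h ↦ ?_
  have h1 : ‖x‖ * ‖q‖ ^ n = 1 := by simpa using congrArg norm h
  have h2 : ‖q‖ ^ n ≤ 1 := pow_le_one₀ (norm_nonneg _) hq.le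
  nlinarith [norm_nonneg x, pow_nonneg (norm_nonneg q) n]

lemma eulerProd_ne_zero (hq : ‖q‖ < 1) : eulerProd q ≠ 0 := qPoch_ne_zero_of_norm_lt hq hq

lemma multipliableLocallyUniformlyOn_qPoch (hq : ‖q‖ < 1) (R : ℝ) :
    MultipliableLocallyUniformlyOn (fun (n : ℕ) x ↦ 1 - x * q ^ n) (Metric.ball (0 : ℂ) R) := by
  simp_rw [sub_eq_add_neg]
  refine Summable.multipliableLocallyUniformlyOn_nat_one_add (u := fun n ↦ R * ‖q‖ ^ n)
    Metric.isOpen_ball ((summable_geometric_of_lt_one (norm_nonneg _) hq).mul_left R)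
    (.of_forall fun n x hx ↦ ?_) (fun n ↦ by fun_prop)
  rw [norm_neg, norm_mul, norm_pow]
  gcongr
  simpa using (mem_ball_zero_iff.mp hx).le

lemma differentiable_qPoch (hq : ‖q‖ < 1) : Differentiable ℂ (qPoch q) := by
  intro x
  have h : DifferentiableOn ℂ (qPoch q) (Metric.ball (0 : ℂ) (‖x‖ + 1)) :=
    (multipliableLocallyUniformlyOn_qPoch hq _).hasProdLocallyUniformlyOn.differentiableOn
      (.of_forall fun _ ↦ by simpa [Finset.prod_fn] using
        DifferentiableOn.finsetProd (fun _ _ ↦ by fun_prop)) Metric.isOpen_ball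
  exact h.differentiableAt (Metric.isOpen_ball.mem_nhds (by simp))

lemma hasDerivAt_qPoch (hq : ‖q‖ < 1) {x : ℂ} (hx : ∀ n : ℕ, x * q ^ n ≠ 1) :
    HasDerivAt (qPoch q) (-qPoch q x * ∑' n : ℕ, q ^ n / (1 - x * q ^ n)) x := by
  have hne (n : ℕ) : 1 - x * q ^ n ≠ 0 := sub_ne_zero.mpr (hx n).symm
  have hld (n : ℕ) : logDeriv (fun x : ℂ ↦ 1 - x * q ^ n) x = -(q ^ n / (1 - x * q ^ n)) := by
    have : HasDerivAt (fun x : ℂ ↦ 1 - x * q ^ n) (-(q ^ n)) x := by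
      simpa using ((hasDerivAt_id x).mul_const (q ^ n)).const_sub 1
    rw [logDeriv_apply, this.deriv, neg_div]
  have hs : Summable fun n : ℕ ↦ q ^ n / (1 - x * q ^ n) := by
    simp only [div_eq_mul_one_div (q ^ _)]
    apply Summable.mul_tendsto_const (c := 1 / (1 - x * 0))
      (by simpa using summable_geometric_of_lt_one (norm_nonneg _) hq)
    rw [Nat.cofinite_eq_atTop]
    exact tendsto_const_nhds.div
      (((tendsto_pow_atTop_nhds_zero_of_norm_lt_one hq).const_mul x).const_sub 1) (by simp)
  have hq0 := qPoch_ne_zero hq hx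
  have := logDeriv_tprod_eq_tsum (Metric.isOpen_ball (x := (0 : ℂ)) (ε := ‖x‖ + 1))
    (x := x) (by simp) hne (fun n ↦ by fun_prop) (by simpa [hld] using hs.neg)
    (multipliableLocallyUniformlyOn_qPoch hq _) hq0
  have h2 := (differentiable_qPoch hq x).hasDerivAt
  refine h2.congr_deriv ?_
  have h3 : logDeriv (qPoch q) x = -∑' n : ℕ, q ^ n / (1 - x * q ^ n) := by
    rw [show qPoch q = fun x ↦ ∏' n : ℕ, (1 - x * q ^ n) from rfl, this, ← tsum_neg]
    exact tsum_congr hld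
  rw [logDeriv_apply, div_eq_iff hq0] at h3
  rw [h3]; ring

/-- Splitting the exponents into residue classes modulo `N`. -/
lemma qPoch_eq_prod_pow (hq : ‖q‖ < 1) (N : ℕ) [NeZero N] (x : ℂ) :
    qPoch q x = ∏ j : Fin N, qPoch (q ^ N) (x * q ^ (j : ℕ)) := by
  have hqN : ‖q ^ N‖ < 1 := by
    rw [norm_pow]; exact pow_lt_one₀ (norm_nonneg _) hq (NeZero.ne N)
  have h1 : qPoch q x = ∏' p : ℕ × Fin N, (1 - x * q ^ (p.2 + N * p.1 : ℕ)) := by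
    rw [qPoch, ← (Nat.divModEquiv N).symm.tprod_eq]
    refine tprod_congr fun p ↦ ?_
    simp [Nat.divModEquiv, add_comm, mul_comm]
  have h2 : Multipliable fun p : ℕ × Fin N ↦ (1 - x * q ^ (p.2 + N * p.1 : ℕ)) := by
    have := (Nat.divModEquiv N).symm.multipliable_iff.mpr (multipliable_qPoch hq x)
    refine this.congr fun p ↦ ?_
    simp [Nat.divModEquiv, add_comm, mul_comm]
  rw [h1, h2.tprod_prod' (fun _ ↦ (hasProd_fintype _).multipliable)]
  simp only [tprod_fintype, qPoch]
  rw [Multipliable.tprod_finsetProd]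
  · simp only [pow_add, pow_mul, mul_assoc]
  · intro j _
    simpa only [pow_add, pow_mul, mul_assoc] using multipliable_qPoch hqN (x * q ^ (j : ℕ))

lemma qPoch_mul_qPoch_neg (hq : ‖q‖ < 1) (x : ℂ) :
    qPoch q x * qPoch q (-x) = qPoch (q ^ 2) (x ^ 2) := by
  rw [qPoch, qPoch, ← (multipliable_qPoch hq x).tprod_mul (multipliable_qPoch hq _), qPoch]
  exact tprod_congr fun n ↦ by ring

lemma qPoch_mul_cube_roots (hq : ‖q‖ < 1) (x : ℂ) {ω : ℂ} (hω : ω ^ 2 + ω + 1 = 0) :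
    qPoch q x * qPoch q (ω * x) * qPoch q (ω ^ 2 * x) = qPoch (q ^ 3) (x ^ 3) := by
  rw [qPoch, qPoch, qPoch, ← (multipliable_qPoch hq x).tprod_mul (multipliable_qPoch hq _),
    ← ((multipliable_qPoch hq x).mul (multipliable_qPoch hq _)).tprod_mul
      (multipliable_qPoch hq _), qPoch]
  refine tprod_congr fun n ↦ ?_
  set s := x * q ^ n with hs
  have h3 : ω ^ 3 = 1 := by linear_combination (ω - 1) * hω
  rw [show ω * x * q ^ n = ω * s by rw [hs]; ring, show ω ^ 2 * x * q ^ n = ω ^ 2 * s by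
    rw [hs]; ring, show x ^ 3 * (q ^ 3) ^ n = s ^ 3 by rw [hs]; ring]
  linear_combination (-s + s ^ 2 * ω) * hω - s ^ 3 * h3

lemma eulerProd_split_two (hq : ‖q‖ < 1) : eulerProd q = qPoch (q ^ 2) q * eulerProd (q ^ 2) := by
  rw [eulerProd, qPoch_eq_prod_pow hq 2, eulerProd]
  simp [Fin.prod_univ_two, pow_two]

lemma eulerProd_split_three (hq : ‖q‖ < 1) :
    eulerProd q = qPoch (q ^ 3) q * qPoch (q ^ 3) (q ^ 2) * eulerProd (q ^ 3) := by
  rw [eulerProd, qPoch_eq_prod_pow hq 3, eulerProd]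
  rw [Fin.prod_univ_three, show q * q ^ ((0 : Fin 3) : ℕ) = q by simp,
    show q * q ^ ((1 : Fin 3) : ℕ) = q ^ 2 by simp [pow_two],
    show q * q ^ ((2 : Fin 3) : ℕ) = q ^ 3 by simp [pow_succ']]

lemma norm_pow_lt_one {q : ℂ} (hq : ‖q‖ < 1) {n : ℕ} (hn : n ≠ 0) : ‖q ^ n‖ < 1 := by
  rw [norm_pow]; exact pow_lt_one₀ (norm_nonneg _) hq hn

/-- With `E` the Euler product, `E(q) E(-q) E(q⁴) = E(q²)³`. -/
lemma eulerProd_mul_eulerProd_neg (hq : ‖q‖ < 1) :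
    eulerProd q * eulerProd (-q) * eulerProd (q ^ 4) = eulerProd (q ^ 2) ^ 3 := by
  have hq2 := norm_pow_lt_one hq two_ne_zero
  have h1 := eulerProd_split_two hq
  have h2 := eulerProd_split_two (q := -q) (by simpa using hq)
  have h3 := eulerProd_split_two hq2
  have h4 := qPoch_mul_qPoch_neg hq2 q
  rw [neg_sq] at h2
  rw [← pow_mul] at h3 h4
  norm_num at h3 h4
  rw [h1, h2]
  calc _ = (qPoch (q ^ 2) q * qPoch (q ^ 2) (-q)) * eulerProd (q ^ 4) * eulerProd (q ^ 2) ^ 2 := by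
        ring
    _ = _ := by rw [h4, ← h3]; ring

lemma thetaProd_mul_q (hq : ‖q‖ < 1) (hq0 : q ≠ 0) {x : ℂ} (hx : x ≠ 0) :
    thetaProd q (q * x) = -x⁻¹ * thetaProd q x := by
  rw [thetaProd, thetaProd, qPoch_succ hq x, show q / (q * x) = x⁻¹ by field_simp,
    qPoch_succ hq x⁻¹, show x⁻¹ * q = q / x by field_simp, mul_comm x q]
  field_simp
  ring

/-- `thetaProd q x / (1 - x)`, written without the singularity. -/
lemma thetaProd_eq (hq : ‖q‖ < 1) (x : ℂ) :
    thetaProd q x = (1 - x) * (qPoch q (x * q) * qPoch q (q / x)) := by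
  rw [thetaProd, qPoch_succ hq x, mul_assoc]

end Poch

/-! ### Kronecker's series -/

section Kronecker

variable {q y : ℂ}

lemma exists_zpow_mul_mem_annulus (hq0 : q ≠ 0) (hq : ‖q‖ < 1) {x : ℂ} (hx : x ≠ 0) :
    ∃ n : ℤ, ‖q‖ < ‖q ^ n * x‖ ∧ ‖q ^ n * x‖ ≤ 1 := by
  have hq' : 0 < ‖q‖ := norm_pos_iff.mpr hq0
  obtain ⟨n, h1, h2⟩ := exists_mem_Ioc_zpow (norm_pos_iff.mpr hx) ((one_lt_inv₀ hq').mpr hq)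
  refine ⟨n + 1, ?_, ?_⟩
  · rw [norm_mul, norm_zpow, zpow_add_one₀ hq'.ne']
    rw [inv_zpow, inv_lt_comm₀ (zpow_pos hq' n) (norm_pos_iff.mpr hx)] at h1
    rw [inv_lt_iff_one_lt_mul₀ (norm_pos_iff.mpr hx)] at h1
    nlinarith
  · rw [norm_mul, norm_zpow]
    rw [inv_zpow] at h2
    calc ‖q‖ ^ (n + 1) * ‖x‖ ≤ ‖q‖ ^ (n + 1) * (‖q‖ ^ (n + 1))⁻¹ := by gcongr
      _ = 1 := mul_inv_cancel₀ (zpow_pos hq' _).ne'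

/-- A holomorphic function on `ℂ ∖ {0}` with `F(qx) = y⁻¹ F(x)` vanishes when
`|q| < |y| < |q|⁻¹` and `y ≠ 1`: multiplied by a suitable real power of `x` it lifts along `exp`
to a bounded entire function. -/
lemma eq_zero_of_quasiperiodic (hq0 : q ≠ 0) (hq : ‖q‖ < 1) (hy1 : ‖q‖ < ‖y‖)
    (hy2 : ‖y‖ * ‖q‖ < 1) (hy : y ≠ 1) {F : ℂ → ℂ} (hF : ∀ x, x ≠ 0 → DifferentiableAt ℂ F x)
    (hqp : ∀ x, x ≠ 0 → F (q * x) = y⁻¹ * F x) {x : ℂ} (hx : x ≠ 0) : F x = 0 := by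
  have hq' : 0 < ‖q‖ := norm_pos_iff.mpr hq0
  have hy' : 0 < ‖y‖ := hq'.trans hy1
  have hy0 : y ≠ 0 := norm_pos_iff.mp hy'
  have hlq : Real.log ‖q‖ < 0 := Real.log_neg hq' hq
  -- With this exponent `‖F x‖ ‖x‖ ^ κ` is invariant under `x ↦ q x`, hence bounded; the annulus
  -- condition on `y` says that `|κ| < 1`.
  set κ : ℝ := Real.log ‖y‖ / Real.log ‖q‖ with hκ
  have hκl : κ * Real.log ‖q‖ = Real.log ‖y‖ := div_mul_cancel₀ _ hlq.ne
  have hκ1 : κ < 1 := by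
    have := Real.log_lt_log hq' hy1
    rw [← hκl] at this
    nlinarith
  have hκ2 : -1 < κ := by
    have := Real.log_lt_log (by positivity) hy2
    rw [Real.log_one, Real.log_mul hy'.ne' hq'.ne', ← hκl] at this
    nlinarith
  have hqκ : ‖q‖ ^ κ = ‖y‖ := by
    rw [Real.rpow_def_of_pos hq', mul_comm, hκl, Real.exp_log hy']
  set N : ℂ → ℝ := fun x ↦ ‖F x‖ * ‖x‖ ^ κ with hN
  have hNq (x : ℂ) (hx : x ≠ 0) : N (q * x) = N x := by
    simp only [hN]
    rw [hqp x hx, norm_mul, norm_mul, Real.mul_rpow hq'.le (norm_nonneg _), hqκ, norm_inv]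
    field_simp
  have hNz (n : ℤ) (x : ℂ) (hx : x ≠ 0) : N (q ^ n * x) = N x := by
    induction n with
    | zero => simp
    | succ n ih =>
      rw [zpow_add_one₀ hq0, mul_comm _ q, mul_assoc, hNq _ (mul_ne_zero (zpow_ne_zero _ hq0) hx),
        ih]
    | pred n ih =>
      rw [← ih, ← hNq _ (mul_ne_zero (zpow_ne_zero _ hq0) hx), ← mul_assoc, mul_comm q,
        ← zpow_add_one₀ hq0]
      norm_num
  have hK : IsCompact (Metric.closedBall (0 : ℂ) 1 \ Metric.ball 0 ‖q‖) :=
    (isCompact_closedBall _ _).diff Metric.isOpen_ball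
  have hNc : ContinuousOn N (Metric.closedBall (0 : ℂ) 1 \ Metric.ball 0 ‖q‖) := by
    intro x hx
    have hx0 : x ≠ 0 := by
      rintro rfl
      simp [hq0] at hx
    exact ((hF x hx0).continuousAt.norm.mul (continuousAt_id.norm.rpow_const
      (Or.inl (norm_ne_zero_iff.mpr hx0)))).continuousWithinAt
  obtain ⟨B, hB⟩ := hK.exists_bound_of_continuousOn hNc
  have hNB (x : ℂ) (hx : x ≠ 0) : N x ≤ B := by
    obtain ⟨n, h1, h2⟩ := exists_zpow_mul_mem_annulus hq0 hq hx
    rw [← hNz n x hx]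
    exact (le_abs_self _).trans (hB _ ⟨mem_closedBall_zero_iff.mpr h2,
      fun h ↦ (mem_ball_zero_iff.mp h).not_gt h1⟩)
  set H : ℂ → ℂ := fun w ↦ F (Complex.exp w) * Complex.exp (κ * w) with hH
  have hHd : Differentiable ℂ H := fun w ↦
    ((hF _ (Complex.exp_ne_zero w)).comp w Complex.differentiableAt_exp).mul (by fun_prop)
  have hHN (w : ℂ) : ‖H w‖ = N (Complex.exp w) := by
    simp only [hH, hN, norm_mul, Complex.norm_exp]
    rw [← Real.exp_mul]
    simp [mul_comm]
  have hHc (w : ℂ) : H w = H 0 := hHd.apply_eq_apply_of_bounded (isBounded_iff_forall_norm_le.mpr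
    ⟨B, by rintro _ ⟨w, rfl⟩; rw [hHN]; exact hNB _ (Complex.exp_ne_zero w)⟩) w 0
  by_cases h0 : F 1 = 0
  · have := hHc (Complex.log x)
    simpa [hH, Complex.exp_log hx, h0] using this
  · exfalso
    -- `H` is constant, so comparing `0` with `2πi` forces `κ` to be an integer, hence `κ = 0`, and
    -- comparing `0` with `log q` then forces `y = 1`.
    have h2 := hHc (2 * Real.pi * Complex.I)
    simp only [hH, Complex.exp_two_pi_mul_I, Complex.exp_zero, mul_zero, mul_one] at h2
    have h3 : Complex.exp (κ * (2 * Real.pi * Complex.I)) = 1 :=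
      mul_left_cancel₀ h0 (by rw [h2, mul_one])
    obtain ⟨n, hn⟩ := Complex.exp_eq_one_iff.mp h3
    have h4 : (κ : ℂ) = n := mul_right_cancel₀ Complex.two_pi_I_ne_zero hn
    have h5 : κ = n := by exact_mod_cast h4
    have h6 : n = 0 := by
      have ha : (-1 : ℤ) < n := by exact_mod_cast h5 ▸ hκ2
      have hb : n < (1 : ℤ) := by exact_mod_cast h5 ▸ hκ1
      omega
    have h7 := hHc (Complex.log q)
    simp only [hH, h4, h6, Complex.exp_log hq0] at h7
    have h8 := hqp 1 one_ne_zero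
    simp only [Int.cast_zero, zero_mul, Complex.exp_zero, mul_one] at h7 h8
    rw [h7] at h8
    have h9 : y⁻¹ = 1 := mul_right_cancel₀ h0 (by rw [← h8, one_mul])
    exact hy (inv_eq_one.mp h9)

/-- The version of `eq_zero_of_quasiperiodic` for a function on the annulus `|q| < |x| < |q|⁻¹`: the
quasiperiodicity extends it to `ℂ ∖ {0}`. -/
lemma eq_zero_of_quasiperiodic_annulus (hq0 : q ≠ 0) (hq : ‖q‖ < 1) (hy1 : ‖q‖ < ‖y‖)
    (hy2 : ‖y‖ * ‖q‖ < 1) (hy : y ≠ 1) {g : ℂ → ℂ}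
    (hg : ∀ x, ‖q‖ < ‖x‖ → ‖x‖ * ‖q‖ < 1 → DifferentiableAt ℂ g x)
    (hqp : ∀ x, 1 < ‖x‖ → ‖x‖ * ‖q‖ < 1 → g (q * x) = y⁻¹ * g x) {x : ℂ}
    (hx1 : ‖q‖ < ‖x‖) (hx2 : ‖x‖ * ‖q‖ < 1) : g x = 0 := by
  have hq' : 0 < ‖q‖ := norm_pos_iff.mpr hq0
  have hy0 : y ≠ 0 := norm_pos_iff.mp (hq'.trans hy1)
  -- The value `y ^ n * g (q ^ n * x)` does not depend on `n`.
  have key (x : ℂ) (n : ℤ) (k : ℕ) (h1 : ‖q ^ n * x‖ * ‖q‖ < 1)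
      (h2 : ‖q‖ < ‖q ^ (n + k) * x‖) :
      y ^ n * g (q ^ n * x) = y ^ (n + k) * g (q ^ (n + k) * x) := by
    have hnorm : ‖q ^ (n + k) * x‖ = ‖q‖ ^ k * ‖q ^ n * x‖ := by
      rw [zpow_add₀ hq0, zpow_natCast, mul_comm (q ^ n), mul_assoc, norm_mul, norm_pow]
    rw [hnorm] at h2
    match k with
    | 0 => simp
    | 1 =>
      have h3 : 1 < ‖q ^ n * x‖ := by nlinarith
      rw [Nat.cast_one, zpow_add_one₀ hq0, mul_comm (q ^ n) q, mul_assoc, hqp _ h3 h1,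
        zpow_add_one₀ hy0]
      field_simp
    | k + 2 =>
      exfalso
      have h3 : ‖q‖ ^ k ≤ 1 := pow_le_one₀ hq'.le hq.le
      have h4 : ‖q‖ ^ (k + 2) * ‖q ^ n * x‖ = ‖q‖ * (‖q‖ ^ k * (‖q ^ n * x‖ * ‖q‖)) := by ring
      have h5 : ‖q‖ ^ k * (‖q ^ n * x‖ * ‖q‖) < 1 := by
        have := norm_nonneg (q ^ n * x)
        have h6 : ‖q‖ ^ k * (‖q ^ n * x‖ * ‖q‖) ≤ 1 * (‖q ^ n * x‖ * ‖q‖) := by gcongr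
        linarith
      rw [h4] at h2
      nlinarith
  have key' (x : ℂ) (n m : ℤ) (h1 : ‖q‖ < ‖q ^ n * x‖) (h2 : ‖q ^ n * x‖ * ‖q‖ < 1)
      (h3 : ‖q‖ < ‖q ^ m * x‖) (h4 : ‖q ^ m * x‖ * ‖q‖ < 1) :
      y ^ n * g (q ^ n * x) = y ^ m * g (q ^ m * x) := by
    rcases le_total n m with h | h
    · obtain ⟨k, rfl⟩ := Int.le.dest h
      exact key x n k h2 h3
    · obtain ⟨k, rfl⟩ := Int.le.dest h
      exact (key x m k h4 h1).symm
  have hex (x : ℂ) (hx : x ≠ 0) : ∃ n : ℤ, ‖q‖ < ‖q ^ n * x‖ ∧ ‖q ^ n * x‖ * ‖q‖ < 1 := by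
    obtain ⟨n, h1, h2⟩ := exists_zpow_mul_mem_annulus hq0 hq hx
    exact ⟨n, h1, by nlinarith⟩
  choose! ν hν using hex
  set F : ℂ → ℂ := fun x ↦ y ^ ν x * g (q ^ ν x * x) with hF
  have hFeq (x : ℂ) (hx : x ≠ 0) (n : ℤ) (h1 : ‖q‖ < ‖q ^ n * x‖) (h2 : ‖q ^ n * x‖ * ‖q‖ < 1) :
      F x = y ^ n * g (q ^ n * x) := key' x _ _ (hν x hx).1 (hν x hx).2 h1 h2
  have hx0 : x ≠ 0 := norm_pos_iff.mp (hq'.trans hx1)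
  have hzero : F x = 0 := by
    refine eq_zero_of_quasiperiodic hq0 hq hy1 hy2 hy (fun x hx ↦ ?_) (fun x hx ↦ ?_) hx0
    · obtain ⟨h1, h2⟩ := hν x hx
      set n := ν x
      have hd : DifferentiableAt ℂ (fun z ↦ y ^ n * g (q ^ n * z)) x :=
        ((hg _ h1 h2).comp x (by fun_prop)).const_mul _
      refine hd.congr_of_eventuallyEq ?_
      have hc : Continuous fun z : ℂ ↦ ‖q ^ n * z‖ := by fun_prop
      filter_upwards [hc.continuousAt.eventually (lt_mem_nhds h1),
        (hc.mul continuous_const).continuousAt.eventually (gt_mem_nhds h2),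
        isOpen_ne.mem_nhds hx] with z hz1 hz2 hz0
      exact hFeq z hz0 n hz1 hz2
    · have hqx := mul_ne_zero hq0 hx
      obtain ⟨h1, h2⟩ := hν (q * x) hqx
      set n := ν (q * x)
      have he : q ^ n * (q * x) = q ^ (n + 1) * x := by rw [zpow_add_one₀ hq0, mul_assoc]
      rw [hFeq _ hqx n h1 h2, hFeq x hx (n + 1) (he ▸ h1) (he ▸ h2), he, zpow_add_one₀ hy0]
      field_simp
  have := hFeq x hx0 0 (by simpa) (by simpa)
  simpa [hzero] using this.symm

/-- One half of Kronecker's series: `∑_{n ≥ 1} y^n x q^n / (1 - x q^n)`. -/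
noncomputable def lambertHalf (q y x : ℂ) : ℂ :=
  ∑' n : ℕ, y ^ (n + 1) * (x * q ^ (n + 1)) / (1 - x * q ^ (n + 1))

/-- Kronecker's series
`1/(1-x) + y/(1-y) + ∑_{n ≥ 1} (y^n x q^n / (1 - x q^n) - y⁻ⁿ x⁻¹ q^n / (1 - x⁻¹ q^n))`. -/
noncomputable def kroneckerSeries (q y x : ℂ) : ℂ :=
  1 / (1 - x) + y / (1 - y) + lambertHalf q y x - lambertHalf q y⁻¹ x⁻¹

lemma summable_lambertHalf (hq : ‖q‖ < 1) (hy : ‖y‖ * ‖q‖ < 1) (x : ℂ) :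
    Summable fun n : ℕ ↦ y ^ (n + 1) * (x * q ^ (n + 1)) / (1 - x * q ^ (n + 1)) := by
  simp only [div_eq_mul_one_div (_ * _)]
  apply Summable.mul_tendsto_const (c := 1 / (1 - x * 0))
  · have h : Summable fun n : ℕ ↦ ‖x‖ * (‖y‖ * ‖q‖) ^ (n + 1) :=
      ((summable_nat_add_iff 1).mpr (summable_geometric_of_lt_one (by positivity) hy)).mul_left _
    refine h.congr fun n ↦ ?_
    simp only [norm_mul, norm_pow]
    ring
  · rw [Nat.cofinite_eq_atTop]
    exact tendsto_const_nhds.div ((((tendsto_pow_atTop_nhds_zero_of_norm_lt_one hq).comp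
      (Filter.tendsto_add_atTop_nat 1)).const_mul x).const_sub 1) (by simp)

lemma lambertHalf_mul_q (hq : ‖q‖ < 1) (hy0 : y ≠ 0) (hy : ‖y‖ * ‖q‖ < 1) (x : ℂ) :
    lambertHalf q y (q * x) = y⁻¹ * (lambertHalf q y x - y * (x * q) / (1 - x * q)) := by
  rw [lambertHalf, lambertHalf, (summable_lambertHalf hq hy x).tsum_eq_zero_add]
  simp only [zero_add, pow_one, add_sub_cancel_left]
  rw [← tsum_mul_left]
  refine tsum_congr fun n ↦ ?_
  rw [show q * x * q ^ (n + 1) = x * q ^ (n + 1 + 1) by ring, pow_succ y (n + 1)]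
  field_simp

lemma differentiableAt_lambertHalf (hq0 : q ≠ 0) (hq : ‖q‖ < 1) (hy : ‖y‖ * ‖q‖ < 1) {x : ℂ}
    (hx : ‖x‖ * ‖q‖ < 1) : DifferentiableAt ℂ (lambertHalf q y) x := by
  have hq' : 0 < ‖q‖ := norm_pos_iff.mpr hq0
  obtain ⟨R, hR1, hR2⟩ := exists_between ((lt_div_iff₀ hq').mpr hx)
  rw [lt_div_iff₀ hq'] at hR2
  have hR0 : 0 ≤ R := (norm_nonneg x).trans hR1.le
  have hlow (n : ℕ) (z : ℂ) (hz : z ∈ Metric.ball (0 : ℂ) R) :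
      1 - R * ‖q‖ ≤ ‖1 - z * q ^ (n + 1)‖ := by
    have h1 : ‖z * q ^ (n + 1)‖ ≤ R * ‖q‖ := by
      rw [norm_mul, norm_pow]
      have h2 : ‖q‖ ^ (n + 1) ≤ ‖q‖ := pow_le_of_le_one hq'.le hq.le (by omega)
      have h3 := (mem_ball_zero_iff.mp hz).le
      gcongr
    have := norm_sub_norm_le 1 (z * q ^ (n + 1))
    rw [norm_one] at this
    linarith
  have hpos : 0 < 1 - R * ‖q‖ := by linarith
  have : DifferentiableOn ℂ (lambertHalf q y) (Metric.ball 0 R) := by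
    refine Complex.differentiableOn_tsum_of_summable_norm
      (u := fun n ↦ R / (1 - R * ‖q‖) * (‖y‖ * ‖q‖) ^ (n + 1))
      (((summable_nat_add_iff 1).mpr (summable_geometric_of_lt_one (by positivity) hy)).mul_left _)
      (fun n ↦ ?_) Metric.isOpen_ball (fun n z hz ↦ ?_)
    · refine DifferentiableOn.div (by fun_prop) (by fun_prop) fun z hz ↦ ?_
      exact norm_pos_iff.mp (hpos.trans_le (hlow n z hz))
    · rw [norm_div, norm_mul, norm_mul, norm_pow, norm_pow]
      calc _ ≤ ‖y‖ ^ (n + 1) * (R * ‖q‖ ^ (n + 1)) / (1 - R * ‖q‖) := by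
            have := (mem_ball_zero_iff.mp hz).le
            gcongr
            exact hlow n z hz
        _ = _ := by ring
  exact this.differentiableAt (Metric.isOpen_ball.mem_nhds (mem_ball_zero_iff.mpr hR1))

lemma qPoch_mul_ne_zero_of_annulus (hq : ‖q‖ < 1) {x : ℂ} (hx1 : ‖q‖ < ‖x‖)
    (hx2 : ‖x‖ * ‖q‖ < 1) : qPoch q (x * q) * qPoch q (q / x) ≠ 0 := by
  have hx : 0 < ‖x‖ := (norm_nonneg q).trans_lt hx1
  exact mul_ne_zero (qPoch_ne_zero_of_norm_lt hq (by rwa [norm_mul]))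
    (qPoch_ne_zero_of_norm_lt hq (by rwa [norm_div, div_lt_one hx]))

lemma thetaProd_ne_zero (hq : ‖q‖ < 1) {x : ℂ} (hx1 : ‖q‖ < ‖x‖)
    (hx2 : ‖x‖ * ‖q‖ < 1) (hx : x ≠ 1) : thetaProd q x ≠ 0 := by
  rw [thetaProd_eq hq]
  exact mul_ne_zero (sub_ne_zero.mpr hx.symm) (qPoch_mul_ne_zero_of_annulus hq hx1 hx2)

lemma differentiableAt_thetaProd (hq : ‖q‖ < 1) {x : ℂ} (hx : x ≠ 0) :
    DifferentiableAt ℂ (thetaProd q) x :=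
  (differentiable_qPoch hq x).mul ((differentiable_qPoch hq _).comp x (by fun_prop (disch := exact hx)))

/-- **Kronecker's formula**: the series is a quotient of theta products. Both sides have the same
behaviour under `x ↦ q x` and the same simple pole at `x = 1`, so their difference vanishes by
`eq_zero_of_quasiperiodic_annulus`. -/
theorem kroneckerSeries_mul_thetaProd (hq0 : q ≠ 0) (hq : ‖q‖ < 1) (hy1 : ‖q‖ < ‖y‖)
    (hy2 : ‖y‖ * ‖q‖ < 1) (hy : y ≠ 1) {x : ℂ} (hx1 : ‖q‖ < ‖x‖) (hx2 : ‖x‖ * ‖q‖ < 1)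
    (hx : x ≠ 1) :
    kroneckerSeries q y x * (thetaProd q x * thetaProd q y)
      = eulerProd q ^ 2 * thetaProd q (x * y) := by
  have hq' : 0 < ‖q‖ := norm_pos_iff.mpr hq0
  have hy0 : y ≠ 0 := norm_pos_iff.mp (hq'.trans hy1)
  have hyi : ‖y⁻¹‖ * ‖q‖ < 1 := by
    rw [norm_inv, ← div_eq_inv_mul, div_lt_one (hq'.trans hy1)]; exact hy1
  have hty := thetaProd_ne_zero hq hy1 hy2 hy
  set c := eulerProd q ^ 2 / thetaProd q y with hc
  set ρ : ℂ → ℂ := fun x ↦ qPoch q (x * q) * qPoch q (q / x) with hρ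
  -- Both sides have principal part `1 / (1 - x)`; since `u 1 = 0`, the difference quotient of `u`
  -- at `1` is the theta quotient minus `1 / (1 - x)`, with the singularity removed.
  set u : ℂ → ℂ := fun x ↦ 1 - c * thetaProd q (x * y) / ρ x with hu
  set A : Set ℂ := {x | ‖q‖ < ‖x‖ ∧ ‖x‖ * ‖q‖ < 1} with hA
  have hAo : IsOpen A := (isOpen_lt continuous_const continuous_norm).inter
    (isOpen_lt (continuous_norm.mul continuous_const) continuous_const)
  have hA1 : (1 : ℂ) ∈ A := by simp [hA, hq]
  have hAne (x : ℂ) (hx : x ∈ A) : x ≠ 0 := norm_pos_iff.mp (hq'.trans hx.1)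
  have hρne (x : ℂ) (hx : x ∈ A) : ρ x ≠ 0 := qPoch_mul_ne_zero_of_annulus hq hx.1 hx.2
  have hud : DifferentiableOn ℂ u A := by
    intro x hx
    have hx0 := hAne x hx
    have h1 : DifferentiableAt ℂ (fun x ↦ thetaProd q (x * y)) x :=
      (differentiableAt_thetaProd hq (mul_ne_zero hx0 hy0)).comp x (f := fun x ↦ x * y) (by fun_prop)
    have h2 : DifferentiableAt ℂ (fun x ↦ qPoch q (x * q)) x :=
      (differentiable_qPoch hq _).comp x (by fun_prop)
    have h3 : DifferentiableAt ℂ (fun x ↦ qPoch q (q / x)) x :=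
      (differentiable_qPoch hq _).comp x (by fun_prop (disch := exact hx0))
    have h4 : DifferentiableAt ℂ ρ x := h2.mul h3
    exact (((h1.const_mul c).div h4 (hρne x hx)).const_sub 1).differentiableWithinAt
  have hu1 : u 1 = 0 := by
    have h1 : ρ 1 = eulerProd q ^ 2 := by simp [hρ, eulerProd, pow_two]
    have h2 := eulerProd_ne_zero hq
    simp only [hu, h1, one_mul, hc]
    field_simp
    simp
  set g : ℂ → ℂ := fun x ↦ y / (1 - y) + lambertHalf q y x - lambertHalf q y⁻¹ x⁻¹ - dslope u 1 x
    with hg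
  -- Away from `x = 1` the function `g` is the difference of the two sides of the formula.
  have hgx (x : ℂ) (hxA : x ∈ A) (hx : x ≠ 1) :
      g x = kroneckerSeries q y x - c * thetaProd q (x * y) / thetaProd q x := by
    have h1 : 1 - x ≠ 0 := sub_ne_zero.mpr hx.symm
    have h2 : x - 1 ≠ 0 := sub_ne_zero.mpr hx
    have h3 := hρne x hxA
    have h4 : thetaProd q x = (1 - x) * ρ x := thetaProd_eq hq x
    simp only [hg, kroneckerSeries]
    rw [dslope_of_ne _ hx, slope_def_field, hu1, h4]
    simp only [hu]
    have h5 : (1 - c * thetaProd q (x * y) / ρ x - 0) / (x - 1)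
        = - (1 / (1 - x)) + c * thetaProd q (x * y) / ((1 - x) * ρ x) := by
      rw [show x - 1 = -(1 - x) by ring]
      field_simp
      ring
    rw [h5]
    ring
  have hgd (x : ℂ) (h1 : ‖q‖ < ‖x‖) (h2 : ‖x‖ * ‖q‖ < 1) : DifferentiableAt ℂ g x := by
    have hxA : x ∈ A := ⟨h1, h2⟩
    have hx0 := hAne x hxA
    have hd1 : DifferentiableAt ℂ (dslope u 1) x :=
      ((Complex.differentiableOn_dslope (hAo.mem_nhds hA1)).mpr hud).differentiableAt
        (hAo.mem_nhds hxA)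
    have hd2 : DifferentiableAt ℂ (fun x ↦ lambertHalf q y⁻¹ x⁻¹) x := by
      refine (differentiableAt_lambertHalf hq0 hq hyi (x := x⁻¹) ?_).comp x
        (differentiableAt_inv hx0)
      rw [norm_inv, ← div_eq_inv_mul, div_lt_one (hq'.trans h1)]; exact h1
    exact (((differentiableAt_lambertHalf hq0 hq hy2 h2).const_add _).sub hd2).sub hd1
  have hgq (x : ℂ) (h1 : 1 < ‖x‖) (h2 : ‖x‖ * ‖q‖ < 1) : g (q * x) = y⁻¹ * g x := by
    have hx1 : x ≠ 1 := by rintro rfl; simp at h1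
    have hxA : x ∈ A := ⟨hq.trans h1, h2⟩
    have hqxn : ‖q * x‖ < 1 := by rwa [norm_mul, mul_comm]
    have hqx1 : q * x ≠ 1 := by rintro h; rw [h] at hqxn; simp at hqxn
    have hqxA : q * x ∈ A := ⟨by rw [norm_mul]; nlinarith, by nlinarith [norm_nonneg (q * x)]⟩
    have hx0 := hAne x hxA
    have h3 := lambertHalf_mul_q hq hy0 hy2 x
    have h4 := lambertHalf_mul_q hq (inv_ne_zero hy0) hyi (q * x)⁻¹
    rw [show q * (q * x)⁻¹ = x⁻¹ by field_simp, show (q * x)⁻¹ * q = x⁻¹ by field_simp] at h4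
    have h5 : 1 - x ≠ 0 := sub_ne_zero.mpr hx1.symm
    have h6 : x - 1 ≠ 0 := sub_ne_zero.mpr hx1
    have h7 : 1 - q * x ≠ 0 := sub_ne_zero.mpr hqx1.symm
    have h8 : 1 - y ≠ 0 := sub_ne_zero.mpr hy.symm
    have h9 : lambertHalf q y⁻¹ (q * x)⁻¹ = y⁻¹ * lambertHalf q y⁻¹ x⁻¹ + y⁻¹ * (1 / (x - 1)) := by
      rw [h4]
      have h10 : 1 - x⁻¹ = (x - 1) / x := by field_simp
      rw [h10]
      field_simp
      ring
    rw [hgx _ hqxA hqx1, hgx x hxA hx1, mul_assoc q x y,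
      thetaProd_mul_q hq hq0 hx0, thetaProd_mul_q hq hq0 (mul_ne_zero hx0 hy0),
      kroneckerSeries, kroneckerSeries, h3, h9]
    have h10 := thetaProd_ne_zero hq hxA.1 hxA.2 hx1
    have h11 : c * (-(x * y)⁻¹ * thetaProd q (x * y)) / (-x⁻¹ * thetaProd q x)
      = y⁻¹ * (c * thetaProd q (x * y) / thetaProd q x) := by field_simp
    have h12 : 1 - x * q ≠ 0 := by rwa [mul_comm x]
    rw [h11, show 1 / (x - 1) = - (1 / (1 - x)) by rw [← neg_sub, div_neg],
      show y⁻¹ * (lambertHalf q y x - y * (x * q) / (1 - x * q))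
        = y⁻¹ * lambertHalf q y x - (1 / (1 - q * x) - 1) by field_simp; ring,
      show y / (1 - y) = 1 / (1 - y) - 1 by field_simp; ring]
    have h13 : y⁻¹ * (1 / (1 - y) - 1) = 1 / (1 - y) := by field_simp; ring
    linear_combination -h13
  have hg0 := eq_zero_of_quasiperiodic_annulus hq0 hq hy1 hy2 hy hgd hgq hx1 hx2
  rw [hgx x ⟨hx1, hx2⟩ hx, sub_eq_zero] at hg0
  have htx := thetaProd_ne_zero hq hx1 hx2 hx
  rw [hg0, hc]
  field_simp

end Kronecker

/-! ### Kronecker's series as a double series, and its derivatives -/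

/-- The double Lambert series `∑_{m, n ≥ 1} m^j x^m y^n q^{mn}`. -/
noncomputable def doubleLambert (q : ℂ) (j : ℕ) (x y : ℂ) : ℂ :=
  ∑' p : ℕ+ × ℕ+, (p.1 : ℂ) ^ j * x ^ (p.1 : ℕ) * y ^ (p.2 : ℕ) * q ^ ((p.1 : ℕ) * p.2)

/-- The derivative `x d/dx` of `kroneckerSeries q y x`, for `|y| = 1`. -/
noncomputable def kroneckerDeriv (q y x : ℂ) : ℂ :=
  x / (1 - x) ^ 2 + doubleLambert q 1 x y + doubleLambert q 1 x⁻¹ y⁻¹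

/-- The second derivative `(x d/dx)²` of `kroneckerSeries q y x`, for `|y| = 1`. -/
noncomputable def kroneckerDeriv₂ (q y x : ℂ) : ℂ :=
  x * (1 + x) / (1 - x) ^ 3 + doubleLambert q 2 x y - doubleLambert q 2 x⁻¹ y⁻¹

/-- The logarithmic derivative `x d/dx` of `thetaProd q x`. -/
noncomputable def thetaLogDeriv (q x : ℂ) : ℂ :=
  -x / (1 - x) - doubleLambert q 0 x 1 + doubleLambert q 0 x⁻¹ 1

/-- The derivative `x d/dx` of `thetaLogDeriv q x`. -/
noncomputable def thetaLogDeriv₂ (q x : ℂ) : ℂ :=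
  -x / (1 - x) ^ 2 - doubleLambert q 1 x 1 - doubleLambert q 1 x⁻¹ 1

section Jets

variable {q x y : ℂ}

lemma summable_pow_mul_pow_mul_pow (hq : ‖q‖ < 1) (hx : ‖x‖ * ‖q‖ < 1) (hy : ‖y‖ * ‖q‖ < 1) :
    Summable fun p : ℕ+ × ℕ+ ↦ x ^ (p.1 : ℕ) * y ^ (p.2 : ℕ) * q ^ ((p.1 : ℕ) * p.2) := by
  have h1 : Summable fun p : ℕ × ℕ ↦ (‖x‖ * ‖q‖) ^ p.1 * (‖y‖ * ‖q‖) ^ p.2 :=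
    (summable_geometric_of_lt_one (by positivity) hx).mul_of_nonneg
      (summable_geometric_of_lt_one (by positivity) hy)
      (fun _ ↦ by positivity) (fun _ ↦ by positivity)
  rw [← (Equiv.pnatEquivNat.prodCongr Equiv.pnatEquivNat).symm.summable_iff]
  refine Summable.of_norm_bounded (h1.mul_left (‖x‖ * ‖y‖ * ‖q‖)) fun p ↦ ?_
  obtain ⟨m, n⟩ := p
  simp only [Function.comp_apply, Equiv.prodCongr_symm, Equiv.prodCongr_apply, Prod.map,
    Equiv.pnatEquivNat_symm_apply, Nat.succPNat_coe, Nat.succ_eq_add_one, norm_mul, norm_pow]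
  calc ‖x‖ ^ (m + 1) * ‖y‖ ^ (n + 1) * ‖q‖ ^ ((m + 1) * (n + 1))
      = ‖x‖ * ‖y‖ * ‖q‖ * ((‖x‖ * ‖q‖) ^ m * (‖y‖ * ‖q‖) ^ n) * ‖q‖ ^ (m * n) := by
        rw [show (m + 1) * (n + 1) = m * n + m + n + 1 by ring]
        simp only [pow_add, mul_pow]
        ring
    _ ≤ ‖x‖ * ‖y‖ * ‖q‖ * ((‖x‖ * ‖q‖) ^ m * (‖y‖ * ‖q‖) ^ n) * 1 := by
        gcongr
        exact pow_le_one₀ (norm_nonneg _) hq.le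
    _ = _ := by ring

lemma lambertHalf_eq_doubleLambert (hq : ‖q‖ < 1) (hx : ‖x‖ * ‖q‖ < 1) (hy : ‖y‖ * ‖q‖ < 1) :
    lambertHalf q y x = doubleLambert q 0 x y := by
  have h := (Equiv.prodComm ℕ+ ℕ+).summable_iff.mpr (summable_pow_mul_pow_mul_pow hq hx hy)
  have h2 : doubleLambert q 0 x y
      = ∑' (n : ℕ+) (m : ℕ+), x ^ (m : ℕ) * y ^ (n : ℕ) * q ^ ((m : ℕ) * n) := by
    rw [doubleLambert, ← (Equiv.prodComm ℕ+ ℕ+).tsum_eq]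
    simpa using h.tsum_prod
  rw [h2, lambertHalf, tsum_pnat_eq_tsum_succ
    (f := fun n : ℕ ↦ ∑' m : ℕ+, x ^ (m : ℕ) * y ^ n * q ^ ((m : ℕ) * n))]
  refine tsum_congr fun n ↦ ?_
  rw [tsum_pnat_eq_tsum_succ (f := fun m : ℕ ↦ x ^ m * y ^ (n + 1) * q ^ (m * (n + 1)))]
  have hlt : ‖x * q ^ (n + 1)‖ < 1 := by
    rw [norm_mul, norm_pow]
    have : ‖q‖ ^ (n + 1) ≤ ‖q‖ := pow_le_of_le_one (norm_nonneg _) hq.le (by omega)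
    nlinarith [norm_nonneg x]
  rw [div_eq_mul_inv, ← tsum_geometric_of_norm_lt_one hlt, ← tsum_mul_left]
  refine tsum_congr fun m ↦ ?_
  rw [mul_pow, ← pow_mul, show (m + 1) * (n + 1) = (n + 1) * m + (n + 1) by ring, pow_add, pow_add x]
  ring

/-- A bound for the terms of `doubleLambert`, uniform for `|x| ≤ R`. -/
lemma norm_doubleLambert_term_le {R : ℝ} (hR1 : 1 ≤ R) (hx : ‖x‖ ≤ R) (hy : ‖y‖ ≤ 1) (j : ℕ)
    (p : ℕ+ × ℕ+) :
    ‖(p.1 : ℂ) ^ j * x ^ (p.1 : ℕ) * y ^ (p.2 : ℕ) * q ^ ((p.1 : ℕ) * p.2)‖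
      ≤ (p.1 : ℝ) ^ j * (R * ‖q‖) ^ ((p.2 : ℕ) * p.1) := by
  obtain ⟨m, n⟩ := p
  simp only [norm_mul, norm_pow, Complex.norm_natCast]
  calc (m : ℝ) ^ j * ‖x‖ ^ (m : ℕ) * ‖y‖ ^ (n : ℕ) * ‖q‖ ^ ((m : ℕ) * n)
      ≤ (m : ℝ) ^ j * R ^ (m : ℕ) * 1 * ‖q‖ ^ ((m : ℕ) * n) := by
        gcongr
        exact pow_le_one₀ (norm_nonneg _) hy
    _ ≤ (m : ℝ) ^ j * R ^ ((m : ℕ) * n) * 1 * ‖q‖ ^ ((m : ℕ) * n) := by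
        gcongr
        exact (Nat.le_mul_of_pos_right _ n.pos)
    _ = _ := by rw [mul_pow, mul_comm (n : ℕ)]; ring

lemma summable_pow_mul_pow_prod {r : ℝ} (hr0 : 0 ≤ r) (hr : r < 1) (j : ℕ) :
    Summable fun p : ℕ+ × ℕ+ ↦ (p.1 : ℝ) ^ j * r ^ ((p.2 : ℕ) * p.1) := by
  have := (summable_prod_mul_pow (𝕜 := ℝ) j (r := r) (by rwa [Real.norm_of_nonneg hr0]))
  exact (Equiv.prodComm ℕ+ ℕ+).summable_iff.mp this

lemma summable_doubleLambert (hq : ‖q‖ < 1) (hx : ‖x‖ * ‖q‖ < 1) (hy : ‖y‖ ≤ 1) (j : ℕ) :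
    Summable fun p : ℕ+ × ℕ+ ↦
      (p.1 : ℂ) ^ j * x ^ (p.1 : ℕ) * y ^ (p.2 : ℕ) * q ^ ((p.1 : ℕ) * p.2) := by
  refine Summable.of_norm_bounded (summable_pow_mul_pow_prod (r := max 1 ‖x‖ * ‖q‖)
    (by positivity) ?_ j)
    fun p ↦ norm_doubleLambert_term_le (le_max_left _ _) (le_max_right _ _) hy j p
  rcases max_cases 1 ‖x‖ with h | h <;> rw [h.1]
  · simpa
  · exact hx

lemma hasDerivAt_doubleLambert (hq : ‖q‖ < 1) (hy : ‖y‖ ≤ 1) (j : ℕ) {w : ℂ}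
    (hw : ‖Complex.exp w‖ * ‖q‖ < 1) :
    HasDerivAt (fun w ↦ doubleLambert q j (Complex.exp w) y)
      (doubleLambert q (j + 1) (Complex.exp w) y) w := by
  obtain ⟨R, hR1, hRw, hRq⟩ : ∃ R : ℝ, 1 ≤ R ∧ ‖Complex.exp w‖ < R ∧ R * ‖q‖ < 1 := by
    rcases (norm_nonneg q).eq_or_lt with h | h
    · exact ⟨max 1 (‖Complex.exp w‖ + 1), le_max_left _ _, by simp, by simp [← h]⟩
    · obtain ⟨R, h1, h2⟩ := exists_between (a₁ := max 1 ‖Complex.exp w‖) (a₂ := 1 / ‖q‖)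
        (max_lt ((lt_div_iff₀ h).mpr (by simpa)) ((lt_div_iff₀ h).mpr hw))
      exact ⟨R, (le_max_left _ _).trans h1.le, (le_max_right _ _).trans_lt h1,
        (lt_div_iff₀ h).mp h2⟩
  set U : Set ℂ := {w | ‖Complex.exp w‖ < R}
  have hU : IsOpen U := isOpen_lt (by fun_prop) continuous_const
  set f : ℕ → ℕ+ × ℕ+ → ℂ → ℂ := fun j p w ↦
    (p.1 : ℂ) ^ j * Complex.exp w ^ (p.1 : ℕ) * y ^ (p.2 : ℕ) * q ^ ((p.1 : ℕ) * p.2) with hf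
  have hfd (p : ℕ+ × ℕ+) (w : ℂ) : HasDerivAt (f j p) (f (j + 1) p w) w := by
    have h := ((((Complex.hasDerivAt_exp w).fun_pow (p.1 : ℕ)).const_mul ((p.1 : ℂ) ^ j)).mul_const
      (y ^ (p.2 : ℕ))).mul_const (q ^ ((p.1 : ℕ) * p.2))
    refine h.congr_deriv ?_
    have : Complex.exp w ^ (p.1 : ℕ) = Complex.exp w ^ ((p.1 : ℕ) - 1) * Complex.exp w := by
      rw [← pow_succ, Nat.sub_add_cancel p.1.pos]
    simp only [hf, this]
    ring
  have hb (p : ℕ+ × ℕ+) (w : ℂ) (hw : w ∈ U) :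
      ‖f j p w‖ ≤ (p.1 : ℝ) ^ j * (R * ‖q‖) ^ ((p.2 : ℕ) * p.1) :=
    norm_doubleLambert_term_le hR1 (le_of_lt hw) hy j p
  have hs := summable_pow_mul_pow_prod (r := R * ‖q‖) (by positivity) hRq j
  have hdo (p : ℕ+ × ℕ+) : DifferentiableOn ℂ (f j p) U :=
    fun w _ ↦ (hfd p w).differentiableAt.differentiableWithinAt
  have h1 := (Complex.differentiableOn_tsum_of_summable_norm hs hdo hU hb).differentiableAt
    (hU.mem_nhds hRw)
  have h2 := Complex.hasSum_deriv_of_summable_norm hs hdo hU hb hRw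
  refine h1.hasDerivAt.congr_deriv ?_
  rw [← h2.tsum_eq]
  exact tsum_congr fun p ↦ (hfd p w).deriv

lemma hasDerivAt_doubleLambert_inv (hq : ‖q‖ < 1) (hy : ‖y‖ ≤ 1) (j : ℕ) {w : ℂ}
    (hw : ‖q‖ < ‖Complex.exp w‖) :
    HasDerivAt (fun w ↦ doubleLambert q j (Complex.exp w)⁻¹ y)
      (-doubleLambert q (j + 1) (Complex.exp w)⁻¹ y) w := by
  simp only [← Complex.exp_neg]
  have h : ‖Complex.exp (-w)‖ * ‖q‖ < 1 := by
    rw [Complex.exp_neg, norm_inv, ← div_eq_inv_mul, div_lt_one ((norm_nonneg _).trans_lt hw)]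
    exact hw
  exact ((hasDerivAt_doubleLambert hq hy j h).scomp w (hasDerivAt_neg w)).congr_deriv (by simp)

lemma eventually_annulus_exp {w : ℂ} (h1 : ‖q‖ < ‖Complex.exp w‖)
    (h2 : ‖Complex.exp w‖ * ‖q‖ < 1) :
    ∀ᶠ z in nhds w, ‖q‖ < ‖Complex.exp z‖ ∧ ‖Complex.exp z‖ * ‖q‖ < 1 := by
  have hc : Continuous fun z : ℂ ↦ ‖Complex.exp z‖ := by fun_prop
  exact (hc.continuousAt.eventually (lt_mem_nhds h1)).and
    ((hc.mul_const ‖q‖).continuousAt.eventually (gt_mem_nhds h2))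

lemma norm_inv_mul_lt_one (hx1 : ‖q‖ < ‖x‖) : ‖x⁻¹‖ * ‖q‖ < 1 := by
  rw [norm_inv, ← div_eq_inv_mul, div_lt_one ((norm_nonneg _).trans_lt hx1)]
  exact hx1

lemma kroneckerSeries_eq (hq : ‖q‖ < 1) (hx1 : ‖q‖ < ‖x‖) (hx2 : ‖x‖ * ‖q‖ < 1)
    (hy1 : ‖q‖ < ‖y‖) (hy2 : ‖y‖ * ‖q‖ < 1) :
    kroneckerSeries q y x
      = 1 / (1 - x) + y / (1 - y) + doubleLambert q 0 x y - doubleLambert q 0 x⁻¹ y⁻¹ := by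
  rw [kroneckerSeries, lambertHalf_eq_doubleLambert hq hx2 hy2,
    lambertHalf_eq_doubleLambert hq (norm_inv_mul_lt_one hx1) (norm_inv_mul_lt_one hy1)]

/-- The operator `x d/dx` is realised as `d/dw` for `x = exp w`. -/
lemma hasDerivAt_thetaProd_exp (hq0 : q ≠ 0) (hq : ‖q‖ < 1) {w : ℂ}
    (h1 : ‖q‖ < ‖Complex.exp w‖) (h2 : ‖Complex.exp w‖ * ‖q‖ < 1) (hw : Complex.exp w ≠ 1) :
    HasDerivAt (fun w ↦ thetaProd q (Complex.exp w))
      (thetaProd q (Complex.exp w) * thetaLogDeriv q (Complex.exp w)) w := by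
  have hone : ‖(1 : ℂ)‖ * ‖q‖ < 1 := by simpa
  set x := Complex.exp w with hx
  have hx0 : x ≠ 0 := Complex.exp_ne_zero w
  have hn1 (n : ℕ) : x * q ^ n ≠ 1 := by
    cases n with
    | zero => simpa using hw
    | succ n =>
      intro h
      have h3 : ‖x‖ * ‖q‖ ^ (n + 1) = 1 := by simpa using congrArg norm h
      have : ‖q‖ ^ (n + 1) ≤ ‖q‖ := pow_le_of_le_one (norm_nonneg _) hq.le (by omega)
      nlinarith [norm_nonneg x]
  have hn2 (n : ℕ) : q / x * q ^ n ≠ 1 := by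
    intro h
    have h3 : ‖q‖ / ‖x‖ * ‖q‖ ^ n = 1 := by simpa using congrArg norm h
    have h4 : ‖q‖ / ‖x‖ < 1 := (div_lt_one ((norm_nonneg _).trans_lt h1)).mpr h1
    have : ‖q‖ ^ n ≤ 1 := pow_le_one₀ (norm_nonneg _) hq.le
    have h5 : 0 ≤ ‖q‖ / ‖x‖ := by positivity
    nlinarith [pow_nonneg (norm_nonneg q) n]
  have hd1 := (hasDerivAt_qPoch hq hn1).comp w (Complex.hasDerivAt_exp w)
  have hd2 : HasDerivAt (fun w ↦ q / Complex.exp w) (-(q / x)) w := by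
    have := (hasDerivAt_const w q).div (Complex.hasDerivAt_exp w) (Complex.exp_ne_zero w)
    refine this.congr_deriv ?_
    rw [← hx]
    field_simp
    ring
  have hd3 := (hasDerivAt_qPoch hq hn2).comp w hd2
  have hs1 : x * ∑' n : ℕ, q ^ n / (1 - x * q ^ n) = x / (1 - x) + doubleLambert q 0 x 1 := by
    have hsum : Summable fun n : ℕ ↦ x * (q ^ n / (1 - x * q ^ n)) := by
      rw [← summable_nat_add_iff 1]
      refine (summable_lambertHalf hq (y := 1) hone x).congr fun n ↦ ?_
      rw [one_pow, one_mul, mul_div_assoc]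
    rw [← tsum_mul_left, hsum.tsum_eq_zero_add, ← lambertHalf_eq_doubleLambert hq h2 hone,
      lambertHalf]
    simp [mul_div_assoc, ← div_eq_mul_inv]
  have hs2 : q / x * ∑' n : ℕ, q ^ n / (1 - q / x * q ^ n) = doubleLambert q 0 x⁻¹ 1 := by
    rw [← lambertHalf_eq_doubleLambert hq (norm_inv_mul_lt_one h1) hone, lambertHalf,
      ← tsum_mul_left]
    refine tsum_congr fun n ↦ ?_
    rw [show x⁻¹ * q ^ (n + 1) = q / x * q ^ n by rw [pow_succ]; ring, one_pow, one_mul,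
      mul_div_assoc]
  refine (hd1.mul hd3).congr_deriv ?_
  simp only [Function.comp_apply, ← hx, thetaProd, thetaLogDeriv]
  rw [← hs2, show -x / (1 - x) - doubleLambert q 0 x 1
    = -(x * ∑' n : ℕ, q ^ n / (1 - x * q ^ n)) by rw [hs1]; ring]
  ring

lemma hasDerivAt_kroneckerSeries_exp (hq : ‖q‖ < 1) (hy : ‖y‖ = 1) {w : ℂ}
    (h1 : ‖q‖ < ‖Complex.exp w‖) (h2 : ‖Complex.exp w‖ * ‖q‖ < 1) (hw : Complex.exp w ≠ 1) :
    HasDerivAt (fun w ↦ kroneckerSeries q y (Complex.exp w))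
      (kroneckerDeriv q y (Complex.exp w)) w := by
  have hw' : 1 - Complex.exp w ≠ 0 := sub_ne_zero.mpr hw.symm
  have hd : HasDerivAt (fun w ↦ 1 / (1 - Complex.exp w))
      (Complex.exp w / (1 - Complex.exp w) ^ 2) w := by
    simpa [one_div] using ((Complex.hasDerivAt_exp w).const_sub 1).fun_inv hw'
  have h := ((hd.add_const (y / (1 - y))).add (hasDerivAt_doubleLambert hq hy.le 0 h2)).sub
    (hasDerivAt_doubleLambert_inv hq (y := y⁻¹) (by simp [hy]) 0 h1)
  refine (h.congr_of_eventuallyEq ?_).congr_deriv (by simp [kroneckerDeriv])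
  filter_upwards [eventually_annulus_exp h1 h2] with z hz
  exact kroneckerSeries_eq hq hz.1 hz.2 (by rwa [hy]) (by simpa [hy] using hq)

lemma hasDerivAt_kroneckerDeriv_exp (hq : ‖q‖ < 1) (hy : ‖y‖ = 1) {w : ℂ}
    (h1 : ‖q‖ < ‖Complex.exp w‖) (h2 : ‖Complex.exp w‖ * ‖q‖ < 1) (hw : Complex.exp w ≠ 1) :
    HasDerivAt (fun w ↦ kroneckerDeriv q y (Complex.exp w))
      (kroneckerDeriv₂ q y (Complex.exp w)) w := by
  have hw' : 1 - Complex.exp w ≠ 0 := sub_ne_zero.mpr hw.symm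
  have hd : HasDerivAt (fun w ↦ Complex.exp w / (1 - Complex.exp w) ^ 2)
      (Complex.exp w * (1 + Complex.exp w) / (1 - Complex.exp w) ^ 3) w := by
    refine ((Complex.hasDerivAt_exp w).div
      (((Complex.hasDerivAt_exp w).const_sub 1).fun_pow 2) (pow_ne_zero 2 hw')).congr_deriv ?_
    field_simp
    ring
  have h := (hd.add (hasDerivAt_doubleLambert hq hy.le 1 h2)).add
    (hasDerivAt_doubleLambert_inv hq (y := y⁻¹) (by simp [hy]) 1 h1)
  exact h.congr_deriv (by simp [kroneckerDeriv₂, sub_eq_add_neg])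

lemma hasDerivAt_thetaLogDeriv_exp (hq : ‖q‖ < 1) {w : ℂ}
    (h1 : ‖q‖ < ‖Complex.exp w‖) (h2 : ‖Complex.exp w‖ * ‖q‖ < 1) (hw : Complex.exp w ≠ 1) :
    HasDerivAt (fun w ↦ thetaLogDeriv q (Complex.exp w))
      (thetaLogDeriv₂ q (Complex.exp w)) w := by
  have hw' : 1 - Complex.exp w ≠ 0 := sub_ne_zero.mpr hw.symm
  have hd : HasDerivAt (fun w ↦ -Complex.exp w / (1 - Complex.exp w))
      (-Complex.exp w / (1 - Complex.exp w) ^ 2) w := by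
    refine ((Complex.hasDerivAt_exp w).fun_neg.div
      ((Complex.hasDerivAt_exp w).const_sub 1) hw').congr_deriv ?_
    field_simp
    ring
  have h := (hd.sub (hasDerivAt_doubleLambert hq (y := 1) (by simp) 0 h2)).add
    (hasDerivAt_doubleLambert_inv hq (y := 1) (by simp) 0 h1)
  exact h.congr_deriv (by simp [thetaLogDeriv₂, sub_eq_add_neg])

/-- The logarithmic derivative of Kronecker's formula. -/
lemma kroneckerDeriv_eq (hq0 : q ≠ 0) (hq : ‖q‖ < 1) (hy : ‖y‖ = 1) (hy1 : y ≠ 1)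
    (h1 : ‖q‖ < ‖x‖) (h2 : ‖x‖ * ‖q‖ < 1) (hx : x ≠ 1) (hxy : x * y ≠ 1) :
    kroneckerDeriv q y x
      = kroneckerSeries q y x * (thetaLogDeriv q (x * y) - thetaLogDeriv q x) := by
  have hx0 : x ≠ 0 := norm_pos_iff.mp ((norm_nonneg _).trans_lt h1)
  have hy0 : y ≠ 0 := norm_pos_iff.mp (by simp [hy])
  have hyq1 : ‖q‖ < ‖y‖ := by rwa [hy]
  have hyq2 : ‖y‖ * ‖q‖ < 1 := by simpa [hy]
  obtain ⟨w, rfl⟩ : ∃ w, Complex.exp w = x := ⟨_, Complex.exp_log hx0⟩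
  obtain ⟨v, hv⟩ : ∃ v, Complex.exp v = y := ⟨_, Complex.exp_log hy0⟩
  have hxyn : ‖Complex.exp w * y‖ = ‖Complex.exp w‖ := by rw [norm_mul, hy, mul_one]
  have hd1 := ((hasDerivAt_kroneckerSeries_exp hq hy h1 h2 hx).mul
    ((hasDerivAt_thetaProd_exp hq0 hq h1 h2 hx).mul_const (thetaProd q y)))
  have hwv : Complex.exp (w + v) = Complex.exp w * y := by rw [Complex.exp_add, hv]
  have hd2 := ((hasDerivAt_thetaProd_exp hq0 hq (w := w + v) (by rwa [hwv, hxyn])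
    (by rwa [hwv, hxyn]) (by rwa [hwv])).comp_add_const w v).const_mul (eulerProd q ^ 2)
  have heq := hd2.congr_of_eventuallyEq (f₁ := fun w ↦ kroneckerSeries q y (Complex.exp w) *
      (thetaProd q (Complex.exp w) * thetaProd q y)) (by
    filter_upwards [eventually_annulus_exp h1 h2,
      Complex.continuous_exp.continuousAt.eventually_ne hx] with z hz hz1
    rw [kroneckerSeries_mul_thetaProd hq0 hq hyq1 hyq2 hy1 hz.1 hz.2 hz1, Complex.exp_add, hv])
  have hu := hd1.unique heq
  have hk := kroneckerSeries_mul_thetaProd hq0 hq hyq1 hyq2 hy1 h1 h2 hx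
  have ht1 := thetaProd_ne_zero hq h1 h2 hx
  have ht2 := thetaProd_ne_zero hq hyq1 hyq2 hy1
  rw [hwv] at hu
  refine mul_right_cancel₀ (mul_ne_zero ht1 ht2) ?_
  linear_combination hu - thetaLogDeriv q (Complex.exp w * y) * hk

/-- The second logarithmic derivative of Kronecker's formula. -/
lemma kroneckerDeriv₂_eq (hq0 : q ≠ 0) (hq : ‖q‖ < 1) (hy : ‖y‖ = 1) (hy1 : y ≠ 1)
    (h1 : ‖q‖ < ‖x‖) (h2 : ‖x‖ * ‖q‖ < 1) (hx : x ≠ 1) (hxy : x * y ≠ 1) :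
    kroneckerDeriv₂ q y x
      = kroneckerSeries q y x * ((thetaLogDeriv q (x * y) - thetaLogDeriv q x) ^ 2
        + thetaLogDeriv₂ q (x * y) - thetaLogDeriv₂ q x) := by
  have hx0 : x ≠ 0 := norm_pos_iff.mp ((norm_nonneg _).trans_lt h1)
  have hy0 : y ≠ 0 := norm_pos_iff.mp (by simp [hy])
  obtain ⟨w, rfl⟩ : ∃ w, Complex.exp w = x := ⟨_, Complex.exp_log hx0⟩
  obtain ⟨v, hv⟩ : ∃ v, Complex.exp v = y := ⟨_, Complex.exp_log hy0⟩
  have hxyn : ‖Complex.exp w * y‖ = ‖Complex.exp w‖ := by rw [norm_mul, hy, mul_one]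
  have hwv : Complex.exp (w + v) = Complex.exp w * y := by rw [Complex.exp_add, hv]
  have hd1 := hasDerivAt_kroneckerDeriv_exp hq hy h1 h2 hx
  have hd2 := (hasDerivAt_kroneckerSeries_exp hq hy h1 h2 hx).mul
    (((hasDerivAt_thetaLogDeriv_exp hq (w := w + v) (by rwa [hwv, hxyn])
    (by rwa [hwv, hxyn]) (by rwa [hwv])).comp_add_const w v).sub
      (hasDerivAt_thetaLogDeriv_exp hq h1 h2 hx))
  have heq := hd2.congr_of_eventuallyEq (f₁ := fun w ↦ kroneckerDeriv q y (Complex.exp w)) (by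
    filter_upwards [eventually_annulus_exp h1 h2,
      Complex.continuous_exp.continuousAt.eventually_ne hx,
      (Complex.continuous_exp.mul_const y).continuousAt.eventually_ne hxy] with z hz hz1 hz2
    rw [kroneckerDeriv_eq hq0 hq hy hy1 hz.1 hz.2 hz1 hz2, Pi.mul_apply, Pi.sub_apply,
      Complex.exp_add, hv])
  have hu := hd1.unique heq
  rw [hu, kroneckerDeriv_eq hq0 hq hy hy1 h1 h2 hx hxy, Pi.sub_apply, hwv]
  ring

end Jets

/-! ### Lambert sums over pairs -/

/-- `∑_{m, n ≥ 1} a(m, n) q^{mn}` converges to `S`. -/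
def HasLambertSum (q : ℂ) (a : ℕ → ℕ → ℂ) (S : ℂ) : Prop :=
  HasSum (fun p : ℕ+ × ℕ+ ↦ a p.1 p.2 * q ^ ((p.1 : ℕ) * p.2)) S

namespace HasLambertSum

variable {q : ℂ} {a b : ℕ → ℕ → ℂ} {S T : ℂ}

lemma add (ha : HasLambertSum q a S) (hb : HasLambertSum q b T) :
    HasLambertSum q (fun m n ↦ a m n + b m n) (S + T) := by
  simpa [HasLambertSum, add_mul] using HasSum.add ha hb

lemma sub (ha : HasLambertSum q a S) (hb : HasLambertSum q b T) :
    HasLambertSum q (fun m n ↦ a m n - b m n) (S - T) := by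
  simpa [HasLambertSum, sub_mul] using HasSum.sub ha hb

lemma const_mul (ha : HasLambertSum q a S) (c : ℂ) :
    HasLambertSum q (fun m n ↦ c * a m n) (c * S) := by
  simpa [HasLambertSum, mul_assoc] using HasSum.mul_left c ha

lemma congr (ha : HasLambertSum q a S) (h : ∀ m n, a m n = b m n) : HasLambertSum q b S := by
  rwa [show b = a from funext fun m ↦ funext fun n ↦ (h m n).symm]

lemma unique (ha : HasLambertSum q a S) (hb : HasLambertSum q a T) : S = T :=
  HasSum.unique ha hb

lemma swap (ha : HasLambertSum q a S) : HasLambertSum q (fun m n ↦ a n m) S := by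
  have := (Equiv.prodComm ℕ+ ℕ+).hasSum_iff.mpr ha
  refine this.congr_fun fun p ↦ ?_
  simp [mul_comm]

lemma neg_base (ha : HasLambertSum (-q) a S) :
    HasLambertSum q (fun m n ↦ (-1) ^ (m * n) * a m n) S := by
  refine HasSum.congr_fun ha fun p ↦ ?_
  rw [neg_pow]
  ring

lemma pow_mul_left_iff (k : ℕ+) (h : ∀ m n, ¬ (k : ℕ) ∣ m → a m n = 0) :
    HasLambertSum (q ^ (k : ℕ)) (fun m n ↦ a (k * m) n) S ↔ HasLambertSum q a S := by
  have hinj : Function.Injective fun p : ℕ+ × ℕ+ ↦ (k * p.1, p.2) := by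
    rintro ⟨m, n⟩ ⟨m', n'⟩ h
    simpa using h
  rw [HasLambertSum, HasLambertSum]
  refine Iff.trans (Eq.to_iff (congrArg (HasSum · S) (funext fun p ↦ ?_))) (hinj.hasSum_iff ?_)
  · simp [← pow_mul, mul_assoc]
  · rintro ⟨m, n⟩ hmn
    rw [h, zero_mul]
    rintro ⟨c, hc⟩
    have hc0 : 0 < c := Nat.pos_of_ne_zero fun h0 ↦ by simp [h0] at hc
    exact hmn ⟨(⟨c, hc0⟩, n), Prod.ext (PNat.eq hc.symm) rfl⟩

/-- Replacing `q` by `q^k` amounts to spreading the coefficients out over the multiples of `k`. -/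
lemma dilate (k : ℕ+) (ha : HasLambertSum (q ^ (k : ℕ)) a S) :
    HasLambertSum q (fun m n ↦ if (k : ℕ) ∣ m then a (m / k) n else 0) S := by
  refine (pow_mul_left_iff k fun m n h ↦ if_neg h).mp (ha.congr fun m n ↦ ?_)
  rw [if_pos (dvd_mul_right _ _), Nat.mul_div_cancel_left _ k.pos]

lemma dilate_right (k : ℕ+) (ha : HasLambertSum (q ^ (k : ℕ)) a S) :
    HasLambertSum q (fun m n ↦ if (k : ℕ) ∣ n then a m (n / k) else 0) S :=
  (ha.swap.dilate k).swap

/-- The `q`-expansion of a Lambert sum, with divisor sums as coefficients. -/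
lemma hasSum_divisors (ha : HasLambertSum q a S) :
    HasSum (fun n : ℕ+ ↦ (∑ d ∈ (n : ℕ).divisors, a d (n / d)) * q ^ (n : ℕ)) S := by
  have h := sigmaAntidiagonalEquivProd.hasSum_iff.mpr ha
  refine (h.sigma fun n ↦ hasSum_fintype _).congr_fun fun n ↦ ?_
  rw [← Nat.sum_divisorsAntidiagonal (f := fun d e ↦ a d e), Finset.sum_mul,
    ← Finset.sum_coe_sort]
  refine Finset.sum_congr rfl fun x _ ↦ ?_
  have hx := (Nat.mem_divisorsAntidiagonal.mp x.2).1
  simp only [Function.comp_apply, sigmaAntidiagonalEquivProd, Equiv.coe_fn_mk,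
    divisorsAntidiagonalFactors, PNat.mk_coe]
  rw [hx]

end HasLambertSum

lemma hasLambertSum_doubleLambert {q x y : ℂ} (hq : ‖q‖ < 1) (hx : ‖x‖ * ‖q‖ < 1) (hy : ‖y‖ ≤ 1)
    (j : ℕ) : HasLambertSum q (fun m n ↦ (m : ℂ) ^ j * x ^ m * y ^ n) (doubleLambert q j x y) :=
  (summable_doubleLambert hq hx hy j).hasSum

lemma hasLambertSum_doubleLambert_zero {q x y : ℂ} (hq : ‖q‖ < 1) (hx : ‖x‖ * ‖q‖ < 1)
    (hy : ‖y‖ * ‖q‖ < 1) : HasLambertSum q (fun m n ↦ x ^ m * y ^ n) (doubleLambert q 0 x y) := by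
  simpa [HasLambertSum, doubleLambert] using (summable_pow_mul_pow_mul_pow hq hx hy).hasSum

/-! ### Evaluation at roots of unity -/

/-- The values of the character `χ₋₄` on natural numbers, as complex numbers. -/
def sign4 (m : ℕ) : ℂ := if m % 4 = 1 then 1 else if m % 4 = 3 then -1 else 0

/-- The values of the character `χ₋₃` on natural numbers, as complex numbers. -/
def sign3 (m : ℕ) : ℂ := if m % 3 = 1 then 1 else if m % 3 = 2 then -1 else 0

/-- `∏ (1 - q^n)^4 / ∏ (1 - q^{2n})^2`. With the classical theta function `ϕ(q) = ∑_{n ∈ ℤ} q^{n²}`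
this is `ϕ(-q)²`; the product form is taken as the definition. -/
noncomputable def thetaSq (q : ℂ) : ℂ := eulerProd q ^ 4 / eulerProd (q ^ 2) ^ 2

lemma I_pow_sub (m : ℕ) : Complex.I ^ m - (-Complex.I) ^ m = 2 * Complex.I * sign4 m := by
  have h4 : (-Complex.I) ^ 4 = 1 := by rw [neg_pow, Complex.I_pow_four]; norm_num
  rw [← Nat.div_add_mod m 4, pow_add, pow_add, pow_mul, pow_mul, Complex.I_pow_four, h4, sign4,
    Nat.mul_add_mod, Nat.mod_mod]
  have : m % 4 < 4 := Nat.mod_lt _ (by norm_num)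
  interval_cases m % 4 <;> simp [pow_succ] <;> ring

lemma I_pow_add (m : ℕ) : Complex.I ^ m + (-Complex.I) ^ m
    = if 2 ∣ m then 2 * (-1) ^ (m / 2) else 0 := by
  rcases Nat.even_or_odd' m with ⟨k, rfl | rfl⟩
  · simp [pow_mul, Complex.I_sq]; ring
  · have : ¬ 2 ∣ 2 * k + 1 := by omega
    simp [this, pow_succ, pow_mul]

section Evaluation

variable {q : ℂ}

lemma thetaProd_I (hq : ‖q‖ < 1) : thetaProd q Complex.I = (1 - Complex.I) *
    (qPoch q (Complex.I * q) * qPoch q (-(Complex.I * q))) := by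
  rw [thetaProd_eq hq]
  congr 3
  rw [div_eq_iff Complex.I_ne_zero]
  linear_combination q * Complex.I_mul_I

lemma thetaProd_neg_I (hq : ‖q‖ < 1) : thetaProd q (-Complex.I) = (1 + Complex.I) *
    (qPoch q (Complex.I * q) * qPoch q (-(Complex.I * q))) := by
  rw [thetaProd_eq hq, mul_comm (qPoch q (-Complex.I * q))]
  congr 3
  · ring
  · rw [div_eq_iff (neg_ne_zero.mpr Complex.I_ne_zero)]
    linear_combination q * Complex.I_mul_I
  · ring

lemma thetaProd_neg_one (hq : ‖q‖ < 1) : thetaProd q (-1) = 2 * qPoch q (-q) ^ 2 := by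
  rw [thetaProd_eq hq, show q / -1 = -q by ring, show -1 * q = -q by ring]
  ring

lemma I_ne_one : Complex.I ≠ 1 := fun h ↦ by simpa using congrArg Complex.re h
lemma neg_I_ne_one : -Complex.I ≠ 1 := fun h ↦ by simpa using congrArg Complex.re h
lemma neg_one_ne_one_complex : (-1 : ℂ) ≠ 1 := by norm_num

lemma thetaSq_eq (hq : ‖q‖ < 1) : (eulerProd q / qPoch q (-q)) ^ 2 = thetaSq q := by
  have h := qPoch_mul_qPoch_neg hq q
  have h1 := eulerProd_ne_zero hq
  have h2 := eulerProd_ne_zero (norm_pow_lt_one hq two_ne_zero)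
  have h3 : qPoch q (-q) ≠ 0 := qPoch_ne_zero_of_norm_lt hq (by simpa)
  rw [← eulerProd, ← eulerProd] at h
  rw [thetaSq, ← h]
  field_simp

lemma kroneckerSeries_I (hq0 : q ≠ 0) (hq : ‖q‖ < 1) :
    kroneckerSeries q (-1) Complex.I = Complex.I / 2 * thetaSq q := by
  have h := kroneckerSeries_mul_thetaProd hq0 hq (y := -1) (x := Complex.I) (by simpa) (by simpa)
    neg_one_ne_one_complex (by simpa) (by simpa) I_ne_one
  rw [mul_neg_one, thetaProd_I hq, thetaProd_neg_I hq, thetaProd_neg_one hq] at h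
  have h1 : qPoch q (Complex.I * q) ≠ 0 := qPoch_ne_zero_of_norm_lt hq (by simpa)
  have h2 : qPoch q (-(Complex.I * q)) ≠ 0 := qPoch_ne_zero_of_norm_lt hq (by simpa)
  have h3 : qPoch q (-q) ≠ 0 := qPoch_ne_zero_of_norm_lt hq (by simpa)
  have h4 : (1 - Complex.I) ≠ 0 := sub_ne_zero.mpr I_ne_one.symm
  rw [← thetaSq_eq hq]
  refine mul_right_cancel₀ (mul_ne_zero (mul_ne_zero h4 (mul_ne_zero h1 h2))
    (mul_ne_zero two_ne_zero (pow_ne_zero 2 h3))) (h.trans ?_)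
  field_simp
  linear_combination eulerProd q ^ 2 * Complex.I_mul_I

lemma kroneckerSeries_symm (x y : ℂ) (hq : ‖q‖ < 1) (hx1 : ‖q‖ < ‖x‖) (hx2 : ‖x‖ * ‖q‖ < 1)
    (hy1 : ‖q‖ < ‖y‖) (hy2 : ‖y‖ * ‖q‖ < 1) (hx : x ≠ 1) (hy : y ≠ 1) :
    kroneckerSeries q y x = kroneckerSeries q x y := by
  have hs {x y : ℂ} (hx : ‖x‖ * ‖q‖ < 1) (hy : ‖y‖ * ‖q‖ < 1) :
      doubleLambert q 0 x y = doubleLambert q 0 y x :=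
    (hasLambertSum_doubleLambert_zero hq hx hy).unique
      ((hasLambertSum_doubleLambert_zero hq hy hx).swap.congr fun m n ↦ mul_comm _ _)
  have h1 : 1 - x ≠ 0 := sub_ne_zero.mpr hx.symm
  have h2 : 1 - y ≠ 0 := sub_ne_zero.mpr hy.symm
  rw [kroneckerSeries_eq hq hx1 hx2 hy1 hy2, kroneckerSeries_eq hq hy1 hy2 hx1 hx2, hs hx2 hy2,
    hs (norm_inv_mul_lt_one hx1) (norm_inv_mul_lt_one hy1)]
  have : 1 / (1 - x) + y / (1 - y) = 1 / (1 - y) + x / (1 - x) := by field_simp; ring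
  rw [this]

/-- The sum of two squares formula: Kronecker's formula at `x = i`, `y = -1`. -/
lemma hasLambertSum_sign4_alternating (hq0 : q ≠ 0) (hq : ‖q‖ < 1) :
    HasLambertSum q (fun m n ↦ sign4 m * (-1) ^ n) ((thetaSq q - 1) / 4) := by
  have h := kroneckerSeries_eq hq (x := Complex.I) (y := -1) (by simpa) (by simpa) (by simpa)
    (by simpa)
  rw [kroneckerSeries_I hq0 hq, Complex.inv_I, show (-1 : ℂ)⁻¹ = -1 by norm_num] at h
  have h1 := (hasLambertSum_doubleLambert_zero hq (x := Complex.I) (y := -1) (by simpa)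
    (by simpa)).sub (hasLambertSum_doubleLambert_zero hq (x := -Complex.I) (y := -1) (by simpa)
    (by simpa))
  have h2 := (h1.const_mul (2 * Complex.I)⁻¹).congr (b := fun m n ↦ sign4 m * (-1) ^ n)
    fun m n ↦ by rw [← sub_mul, I_pow_sub]; field_simp [Complex.I_ne_zero]
  convert h2 using 1
  have h4 : (1 - Complex.I) ≠ 0 := sub_ne_zero.mpr I_ne_one.symm
  have h5 : 1 / (1 - Complex.I) + (-1) / (1 - (-1)) = Complex.I / 2 := by
    field_simp; ring_nf; rw [Complex.I_sq]; ring
  have h6 : doubleLambert q 0 Complex.I (-1) - doubleLambert q 0 (-Complex.I) (-1)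
      = Complex.I / 2 * (thetaSq q - 1) := by
    rw [h5] at h; linear_combination -h
  rw [h6]
  field_simp [Complex.I_ne_zero]
  ring

lemma hasLambertSum_sign4 (hq0 : q ≠ 0) (hq : ‖q‖ < 1) :
    HasLambertSum q (fun m _ ↦ sign4 m) ((thetaSq (-q) - 1) / 4) := by
  refine (hasLambertSum_sign4_alternating (q := -q) (by simpa) (by simpa)).neg_base.congr
    fun m n ↦ ?_
  rcases Nat.even_or_odd m with h | h
  · have : sign4 m = 0 := by
      have := Nat.even_iff.mp h
      rw [sign4, if_neg (by omega), if_neg (by omega)]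
    simp [this]
  · rw [pow_mul, h.neg_one_pow, mul_left_comm, ← mul_pow]
    simp

/-- `ϕ(-q)² = 2 ϕ(q²)² - ϕ(q)²`. By the two squares formula both sides are `1 - 4 S(q) + 8 S(q²)`,
where `S(q) = ∑ χ₋₄(m) q^{mn}`. -/
lemma thetaSq_eq_combination (hq0 : q ≠ 0) (hq : ‖q‖ < 1) :
    thetaSq q = 2 * thetaSq (-q ^ 2) - thetaSq (-q) := by
  have h1 := hasLambertSum_sign4_alternating hq0 hq
  have h2 := hasLambertSum_sign4 hq0 hq
  have h3 := (hasLambertSum_sign4 (pow_ne_zero 2 hq0) (norm_pow_lt_one hq two_ne_zero)).dilate_right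
    (q := q) 2
  have := h1.unique (((h3.const_mul 2).sub h2).congr fun m n ↦ ?_)
  · linear_combination 4 * this
  · rcases Nat.even_or_odd n with h | h
    · simp [h.neg_one_pow, h.two_dvd]; ring
    · have : ¬ 2 ∣ n := fun hd ↦ by simpa using h.not_two_dvd_nat hd
      simp [h.neg_one_pow, this]

end Evaluation

/-! ### Four and six squares -/

section Squares

variable {q : ℂ}

lemma neg_one_inv_complex : (-1 : ℂ)⁻¹ = -1 := by norm_num

/-- `ϕ(-q²)⁴ = ϕ(q)² ϕ(-q)²`. -/
lemma thetaSq_pow_two_sq (hq : ‖q‖ < 1) : thetaSq (q ^ 2) ^ 2 = thetaSq q * thetaSq (-q) := by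
  have h := eulerProd_mul_eulerProd_neg hq
  have h2 := eulerProd_ne_zero (norm_pow_lt_one hq two_ne_zero)
  have h4 := eulerProd_ne_zero (norm_pow_lt_one hq four_ne_zero)
  simp only [thetaSq, neg_sq, ← pow_mul]
  norm_num only
  field_simp
  calc eulerProd (q ^ 2) ^ 12 = (eulerProd (q ^ 2) ^ 3) ^ 4 := by ring
    _ = _ := by rw [← h]; ring

lemma doubleLambert_I_sub (hq0 : q ≠ 0) (hq : ‖q‖ < 1) :
    doubleLambert q 0 Complex.I 1 - doubleLambert q 0 (-Complex.I) 1
      = Complex.I / 2 * (thetaSq (-q) - 1) := by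
  have h := (hasLambertSum_doubleLambert_zero hq (x := Complex.I) (y := 1) (by simpa)
    (by simpa)).sub (hasLambertSum_doubleLambert_zero hq (x := -Complex.I) (y := 1) (by simpa)
    (by simpa))
  rw [h.unique (((hasLambertSum_sign4 hq0 hq).const_mul (2 * Complex.I)).congr fun m n ↦ ?_)]
  · ring
  · rw [one_pow, mul_one, mul_one, I_pow_sub]

lemma thetaLogDeriv_I (hq0 : q ≠ 0) (hq : ‖q‖ < 1) :
    thetaLogDeriv q Complex.I = (1 - Complex.I * thetaSq (-q)) / 2 := by
  have h4 : (1 - Complex.I) ≠ 0 := sub_ne_zero.mpr I_ne_one.symm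
  have h := doubleLambert_I_sub hq0 hq
  have h5 : -Complex.I / (1 - Complex.I) = (1 - Complex.I) / 2 := by
    field_simp; ring_nf; rw [Complex.I_sq]; ring
  rw [thetaLogDeriv, Complex.inv_I, h5]
  linear_combination -h

lemma thetaLogDeriv_neg_I (hq0 : q ≠ 0) (hq : ‖q‖ < 1) :
    thetaLogDeriv q (-Complex.I) = (1 + Complex.I * thetaSq (-q)) / 2 := by
  have h4 : (1 + Complex.I) ≠ 0 := by
    rw [← sub_neg_eq_add]; exact sub_ne_zero.mpr neg_I_ne_one.symm
  have h := doubleLambert_I_sub hq0 hq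
  have h5 : Complex.I / (1 + Complex.I) = (1 + Complex.I) / 2 := by
    field_simp; ring_nf; rw [Complex.I_sq]; ring
  rw [thetaLogDeriv, inv_neg, Complex.inv_I, neg_neg, sub_neg_eq_add, h5]
  linear_combination h

lemma thetaLogDeriv_neg_one : thetaLogDeriv q (-1) = 1 / 2 := by
  rw [thetaLogDeriv, neg_one_inv_complex]
  norm_num

lemma I_div_one_sub_sq : Complex.I / (1 - Complex.I) ^ 2 = -1 / 2 := by
  have h : (1 - Complex.I) ^ 2 = -2 * Complex.I := by linear_combination Complex.I_mul_I
  rw [h]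
  field_simp [Complex.I_ne_zero]

lemma neg_I_div_one_add_sq : -Complex.I / (1 + Complex.I) ^ 2 = -1 / 2 := by
  have h : (1 + Complex.I) ^ 2 = 2 * Complex.I := by linear_combination Complex.I_mul_I
  rw [h]
  field_simp [Complex.I_ne_zero]

lemma thetaLogDeriv₂_neg_I : thetaLogDeriv₂ q (-Complex.I) = thetaLogDeriv₂ q Complex.I := by
  simp only [thetaLogDeriv₂, inv_neg, Complex.inv_I, neg_neg, sub_neg_eq_add]
  rw [neg_div, I_div_one_sub_sq, ← neg_neg (Complex.I / (1 + Complex.I) ^ 2), ← neg_div,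
    neg_I_div_one_add_sq]
  ring

lemma kroneckerDeriv_I (hq0 : q ≠ 0) (hq : ‖q‖ < 1) :
    kroneckerDeriv q (-1) Complex.I = -(thetaSq q * thetaSq (-q)) / 2 := by
  rw [kroneckerDeriv_eq hq0 hq (by simp) neg_one_ne_one_complex (by simpa) (by simpa) I_ne_one
    (by simpa using neg_I_ne_one), kroneckerSeries_I hq0 hq, mul_neg_one, thetaLogDeriv_I hq0 hq,
    thetaLogDeriv_neg_I hq0 hq]
  linear_combination (thetaSq q * thetaSq (-q)) / 2 * Complex.I_mul_I

/-- The sum of four squares formula: the logarithmic derivative of Kronecker's formula at `x = i`,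
`y = -1`. -/
lemma hasLambertSum_four_squares (hq0 : q ≠ 0) (hq : ‖q‖ < 1) :
    HasLambertSum q (fun m n ↦ m * (-1) ^ (m + n)) ((1 - thetaSq q ^ 2) / 8) := by
  obtain ⟨r, rfl⟩ : ∃ r, r ^ 2 = q := ⟨q ^ (1 / 2 : ℂ), by rw [← Complex.cpow_nat_mul]; simp⟩
  have hr0 : r ≠ 0 := by rintro rfl; simp at hq0
  have hr : ‖r‖ < 1 := by
    rw [norm_pow] at hq
    exact (pow_lt_one_iff_of_nonneg (norm_nonneg _) two_ne_zero).mp hq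
  -- The factor `i ^ m + (-i) ^ m` kills odd `m`, so the series in `r` is a series in `q = r ^ 2`.
  rw [thetaSq_pow_two_sq hr]
  have h := kroneckerDeriv_I hr0 hr
  rw [kroneckerDeriv, I_div_one_sub_sq, Complex.inv_I, neg_one_inv_complex] at h
  have h1 := ((hasLambertSum_doubleLambert hr (x := Complex.I) (y := -1) (by simpa)
    (by simp) 1).add (hasLambertSum_doubleLambert hr (x := -Complex.I) (y := -1) (by simpa)
    (by simp) 1)).const_mul (1 / 4)
  rw [← HasLambertSum.pow_mul_left_iff 2] at h1
  · have h2 : (1 - thetaSq r * thetaSq (-r)) / 8 = 1 / 4 *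
        (doubleLambert r 1 Complex.I (-1) + doubleLambert r 1 (-Complex.I) (-1)) := by
      linear_combination -h / 4
    rw [h2]
    refine h1.congr fun m n ↦ ?_
    · have := I_pow_add (2 * m)
      rw [if_pos (dvd_mul_right 2 m), Nat.mul_div_cancel_left _ two_pos] at this
      simp only [PNat.val_ofNat]
      push_cast
      rw [pow_add]
      linear_combination (m : ℂ) / 2 * (-1) ^ n * this
  · intro m n hm
    have := I_pow_add m
    rw [if_neg (by simpa using hm)] at this
    linear_combination (m : ℂ) / 4 * (-1) ^ n * this

/-- The Lambert sum `∑ m q^{mn}`. -/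
lemma hasLambertSum_id (hq : ‖q‖ < 1) :
    HasLambertSum q (fun m _ ↦ (m : ℂ)) (doubleLambert q 1 1 1) :=
  (hasLambertSum_doubleLambert hq (x := 1) (y := 1) (by simpa) (by simp) 1).congr (by simp)

lemma hasLambertSum_id_even (hq : ‖q‖ < 1) :
    HasLambertSum q (fun m _ ↦ if 2 ∣ m then (m : ℂ) else 0) (2 * doubleLambert (q ^ 2) 1 1 1) := by
  refine (((hasLambertSum_id (norm_pow_lt_one hq two_ne_zero)).dilate (q := q) 2).const_mul 2).congr
    fun m n ↦ ?_
  by_cases h : 2 ∣ m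
  · obtain ⟨k, rfl⟩ := h
    simp
  · simp [h]

lemma hasLambertSum_id_four (hq : ‖q‖ < 1) :
    HasLambertSum q (fun m _ ↦ if 4 ∣ m then (m : ℂ) else 0) (4 * doubleLambert (q ^ 4) 1 1 1) := by
  refine (((hasLambertSum_id (norm_pow_lt_one hq four_ne_zero)).dilate (q := q) 4).const_mul
    4).congr fun m n ↦ ?_
  by_cases h : 4 ∣ m
  · obtain ⟨k, rfl⟩ := h
    simp
  · simp [h]

lemma hasLambertSum_id_right_even (hq : ‖q‖ < 1) :
    HasLambertSum q (fun m n ↦ if 2 ∣ n then (m : ℂ) else 0) (doubleLambert (q ^ 2) 1 1 1) :=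
  (hasLambertSum_id (norm_pow_lt_one hq two_ne_zero)).dilate_right (q := q) 2

lemma hasLambertSum_id_even_even (hq : ‖q‖ < 1) :
    HasLambertSum q (fun m n ↦ if 2 ∣ m ∧ 2 ∣ n then (m : ℂ) else 0)
      (2 * doubleLambert (q ^ 4) 1 1 1) := by
  have h := hasLambertSum_id_right_even (norm_pow_lt_one hq two_ne_zero)
  rw [← pow_mul] at h
  refine ((h.dilate (q := q) 2).const_mul 2).congr fun m n ↦ ?_
  by_cases h : 2 ∣ m
  · obtain ⟨k, rfl⟩ := h
    simp
  · simp [h]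

lemma neg_one_pow_eq_ite_two_dvd (m : ℕ) : (-1 : ℂ) ^ m = if 2 ∣ m then 1 else -1 := by
  split_ifs with h
  · exact (even_iff_two_dvd.mpr h).neg_one_pow
  · exact (Nat.not_even_iff_odd.mp (mt even_iff_two_dvd.mp h)).neg_one_pow

/-- `ϕ(-q)⁴` in terms of `∑ m q^{mn}` at `q`, `q²` and `q⁴`. -/
lemma thetaSq_sq_eq (hq0 : q ≠ 0) (hq : ‖q‖ < 1) :
    thetaSq q ^ 2 = 1 - 8 * (doubleLambert q 1 1 1 - 6 * doubleLambert (q ^ 2) 1 1 1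
      + 8 * doubleLambert (q ^ 4) 1 1 1) := by
  have h := ((((hasLambertSum_id hq).sub ((hasLambertSum_id_even hq).const_mul 2)).sub
    ((hasLambertSum_id_right_even hq).const_mul 2)).add
    ((hasLambertSum_id_even_even hq).const_mul 4)).congr (b := fun m n ↦ m * (-1) ^ (m + n))
    fun m n ↦ by
      by_cases hm : 2 ∣ m <;> by_cases hn : 2 ∣ n <;>
        simp [pow_add, neg_one_pow_eq_ite_two_dvd, hm, hn] <;> ring
  linear_combination 8 * h.unique (hasLambertSum_four_squares hq0 hq)

/-- `ϕ(q)⁴` in terms of `∑ m q^{mn}` at `q` and `q⁴`. -/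
lemma thetaSq_neg_sq_eq (hq0 : q ≠ 0) (hq : ‖q‖ < 1) :
    thetaSq (-q) ^ 2 = 1 + 8 * (doubleLambert q 1 1 1 - 4 * doubleLambert (q ^ 4) 1 1 1) := by
  have h := (((hasLambertSum_id_even_even hq).const_mul 2).sub (hasLambertSum_id hq)).congr
    (b := fun m n ↦ (-1) ^ (m * n) * (m * (-1) ^ (m + n)))
    fun m n ↦ by
      by_cases hm : 2 ∣ m <;> by_cases hn : 2 ∣ n <;>
        simp [pow_add, pow_mul, neg_one_pow_eq_ite_two_dvd, hm, hn]
      ring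
  linear_combination 8 * h.unique
    (hasLambertSum_four_squares (q := -q) (by simpa) (by simpa)).neg_base

lemma doubleLambert_neg_one_one (hq : ‖q‖ < 1) : doubleLambert q 1 (-1) 1
    = 4 * doubleLambert (q ^ 2) 1 1 1 - doubleLambert q 1 1 1 := by
  have h := (((hasLambertSum_id_even hq).const_mul 2).sub (hasLambertSum_id hq)).congr
    (b := fun m n ↦ (m : ℂ) ^ 1 * (-1) ^ m * 1 ^ n) fun m n ↦ by
      rcases Nat.even_or_odd m with hm | hm
      · simp [hm.neg_one_pow, ← even_iff_two_dvd, hm]; ring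
      · simp [hm.neg_one_pow, ← even_iff_two_dvd, hm]
  linear_combination (hasLambertSum_doubleLambert hq (x := -1) (y := 1) (by simpa)
    (by simp) 1).unique h

lemma doubleLambert_I_add (hq : ‖q‖ < 1) :
    doubleLambert q 1 Complex.I 1 + doubleLambert q 1 (-Complex.I) 1
      = 16 * doubleLambert (q ^ 4) 1 1 1 - 4 * doubleLambert (q ^ 2) 1 1 1 := by
  have h1 := (hasLambertSum_doubleLambert hq (x := Complex.I) (y := 1) (by simpa)
    (by simp) 1).add (hasLambertSum_doubleLambert hq (x := -Complex.I) (y := 1) (by simpa)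
    (by simp) 1)
  have h2 := ((hasLambertSum_id_four hq).const_mul 4).sub ((hasLambertSum_id_even hq).const_mul 2)
  rw [h1.unique (h2.congr fun m n ↦ ?_)]
  · ring
  · rw [one_pow, mul_one, mul_one, ← mul_add, I_pow_add]
    rcases Nat.even_or_odd' m with ⟨k, rfl | rfl⟩
    · rcases Nat.even_or_odd' k with ⟨l, rfl | rfl⟩
      · have : 4 ∣ 2 * (2 * l) := ⟨l, by ring⟩
        simp [this]; ring
      · have : ¬ 4 ∣ 2 * (2 * l + 1) := by omega
        simp [this, pow_succ]; ring
    · have h4 : ¬ 4 ∣ 2 * k + 1 := by omega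
      have h2 : ¬ 2 ∣ 2 * k + 1 := by omega
      simp [h2, h4]

/-- The weight three Eisenstein series `∑ χ₋₄(m) m² q^{mn}` as a cubic form in `ϕ(q)²` and `ϕ(-q)²`:
the second derivative of Kronecker's formula at `x = i`, `y = -1`. -/
lemma hasLambertSum_sq_sign4 (hq0 : q ≠ 0) (hq : ‖q‖ < 1) :
    HasLambertSum q (fun m _ ↦ sign4 m * (m : ℂ) ^ 2) ((1 - thetaSq (-q) * thetaSq q ^ 2) / 4) := by
  have key {q : ℂ} (hq0 : q ≠ 0) (hq : ‖q‖ < 1) : HasLambertSum q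
      (fun m n ↦ sign4 m * (m : ℂ) ^ 2 * (-1) ^ n) ((1 - thetaSq q * thetaSq (-q) ^ 2) / 4) := by
    have h := kroneckerDeriv₂_eq hq0 hq (y := -1) (by simp) neg_one_ne_one_complex
      (x := Complex.I) (by simpa) (by simpa) I_ne_one (by simpa using neg_I_ne_one)
    rw [kroneckerSeries_I hq0 hq, mul_neg_one, thetaLogDeriv_I hq0 hq, thetaLogDeriv_neg_I hq0 hq,
      thetaLogDeriv₂_neg_I, kroneckerDeriv₂, Complex.inv_I, neg_one_inv_complex] at h
    have h1 := ((hasLambertSum_doubleLambert hq (x := Complex.I) (y := -1) (by simpa)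
      (by simp) 2).sub (hasLambertSum_doubleLambert hq (x := -Complex.I) (y := -1) (by simpa)
      (by simp) 2)).const_mul (2 * Complex.I)⁻¹
    have h4 : (1 - Complex.I) ≠ 0 := sub_ne_zero.mpr I_ne_one.symm
    have h5 : Complex.I * (1 + Complex.I) / (1 - Complex.I) ^ 3 = -Complex.I / 2 := by
      have : (1 - Complex.I) ^ 3 = -2 * (1 + Complex.I) := by
        linear_combination (3 - Complex.I) * Complex.I_mul_I
      rw [this]
      have h6 : (1 + Complex.I) ≠ 0 := by
        rw [← sub_neg_eq_add]; exact sub_ne_zero.mpr neg_I_ne_one.symm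
      field_simp
    convert h1.congr (b := fun m n ↦ sign4 m * (m : ℂ) ^ 2 * (-1) ^ n) fun m n ↦ ?_ using 1
    · have hI := Complex.I_ne_zero
      have h6 : doubleLambert q 2 Complex.I (-1) - doubleLambert q 2 (-Complex.I) (-1)
          = Complex.I / 2 * (1 - thetaSq q * thetaSq (-q) ^ 2) := by
        rw [h5] at h
        linear_combination h + Complex.I / 2 * thetaSq q * thetaSq (-q) ^ 2 * Complex.I_mul_I
      rw [h6]
      field_simp
      ring
    · have := I_pow_sub m
      rw [inv_mul_eq_iff_eq_mul₀ (by simp)]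
      linear_combination (m : ℂ) ^ 2 * (-1) ^ n * this
  have h := (key (q := -q) (by simpa) (by simpa)).neg_base
  rw [neg_neg] at h
  refine h.congr fun m n ↦ ?_
  rcases Nat.even_or_odd m with h | h
  · have : sign4 m = 0 := by
      have := Nat.even_iff.mp h
      rw [sign4, if_neg (by omega), if_neg (by omega)]
    simp [this]
  · rw [pow_mul, h.neg_one_pow, mul_left_comm, ← mul_pow]
    simp

/-- The weight three Eisenstein series `∑ χ₋₄(n) m² q^{mn}` as a cubic form in `ϕ(q)²` and `ϕ(-q)²`:
the second derivative of Kronecker's formula at `x = -1`, `y = i`. -/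
lemma hasLambertSum_sq_sign4_right (hq0 : q ≠ 0) (hq : ‖q‖ < 1) :
    HasLambertSum q (fun m n ↦ sign4 n * (m : ℂ) ^ 2)
      (thetaSq (-q) * (thetaSq (-q) ^ 2 - thetaSq q ^ 2) / 16) := by
  have key {q : ℂ} (hq0 : q ≠ 0) (hq : ‖q‖ < 1) : HasLambertSum q
      (fun m n ↦ sign4 n * (m : ℂ) ^ 2 * (-1) ^ m)
      (thetaSq q * (thetaSq q ^ 2 - thetaSq (-q) ^ 2) / 16) := by
    have h := kroneckerDeriv₂_eq hq0 hq (y := Complex.I) (by simp) I_ne_one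
      (x := -1) (by simpa) (by simpa) neg_one_ne_one_complex (by simpa using neg_I_ne_one)
    rw [kroneckerSeries_symm _ _ hq (by simpa) (by simpa) (by simpa) (by simpa)
      neg_one_ne_one_complex I_ne_one, kroneckerSeries_I hq0 hq, neg_one_mul,
      thetaLogDeriv_neg_one, thetaLogDeriv_neg_I hq0 hq, thetaLogDeriv₂_neg_I, kroneckerDeriv₂,
      Complex.inv_I, neg_one_inv_complex, thetaLogDeriv₂, thetaLogDeriv₂, Complex.inv_I,
      neg_one_inv_complex, doubleLambert_neg_one_one hq, neg_div, I_div_one_sub_sq] at h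
    have h7 := doubleLambert_I_add hq
    have h8 := thetaSq_sq_eq hq0 hq
    have h1 := ((hasLambertSum_doubleLambert hq (x := -1) (y := Complex.I) (by simpa)
      (by simp) 2).sub (hasLambertSum_doubleLambert hq (x := -1) (y := -Complex.I) (by simpa)
      (by simp) 2)).const_mul (2 * Complex.I)⁻¹
    convert h1.congr (b := fun m n ↦ sign4 n * (m : ℂ) ^ 2 * (-1) ^ m) fun m n ↦ ?_ using 1
    · have hI := Complex.I_ne_zero
      have h6 : doubleLambert q 2 (-1) Complex.I - doubleLambert q 2 (-1) (-Complex.I)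
          = Complex.I / 8 * thetaSq q * (thetaSq q ^ 2 - thetaSq (-q) ^ 2) := by
        norm_num at h
        rw [h]
        linear_combination Complex.I / 8 * thetaSq q * (thetaSq (-q) ^ 2 * Complex.I_mul_I
          - 4 * h7 - h8)
      rw [h6]
      field_simp
      ring
    · have := I_pow_sub n
      rw [inv_mul_eq_iff_eq_mul₀ (by simp)]
      linear_combination (m : ℂ) ^ 2 * (-1) ^ m * this
  have h := (key (q := -q) (by simpa) (by simpa)).neg_base
  rw [neg_neg] at h
  refine h.congr fun m n ↦ ?_
  rcases Nat.even_or_odd n with h | h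
  · have : sign4 n = 0 := by
      have := Nat.even_iff.mp h
      rw [sign4, if_neg (by omega), if_neg (by omega)]
    simp [this]
  · rw [mul_comm m n, pow_mul, h.neg_one_pow, mul_left_comm, ← mul_pow]
    simp

end Squares

/-! ### Sums over a residue class -/

section Residue

variable {q t : ℂ}

/-- A double sum over `m, n ≡ r` modulo `N`, written as a Lambert sum over all pairs. -/
lemma hasLambertSum_of_residue (N : ℕ) {r : ℕ} (hr0 : 0 < r) (hrN : r < N) {S : ℂ}
    (h : HasSum (fun p : ℕ × ℕ ↦ t ^ ((N * p.1 + r) * (N * p.2 + r))) S) :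
    HasLambertSum t (fun m n ↦ if m % N = r ∧ n % N = r then 1 else 0) S := by
  have hN : 0 < N := by omega
  let g : ℕ × ℕ → ℕ+ × ℕ+ := fun p ↦ (⟨N * p.1 + r, by positivity⟩, ⟨N * p.2 + r, by positivity⟩)
  have hg : Function.Injective g := by
    rintro ⟨m, n⟩ ⟨m', n'⟩ h
    have h1 : N * m + r = N * m' + r := congrArg (fun p : ℕ+ × ℕ+ ↦ (p.1 : ℕ)) h
    have h2 : N * n + r = N * n' + r := congrArg (fun p : ℕ+ × ℕ+ ↦ (p.2 : ℕ)) h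
    exact Prod.ext (Nat.eq_of_mul_eq_mul_left hN (Nat.add_right_cancel h1))
      (Nat.eq_of_mul_eq_mul_left hN (Nat.add_right_cancel h2))
  rw [HasLambertSum, ← hg.hasSum_iff]
  · refine h.congr_fun fun p ↦ ?_
    simp [g, Nat.mod_eq_of_lt hrN]
  · rintro ⟨m, n⟩ hmn
    rw [if_neg, zero_mul]
    rintro ⟨h1, h2⟩
    refine hmn ⟨((m : ℕ) / N, (n : ℕ) / N), ?_⟩
    have h3 := Nat.div_add_mod (m : ℕ) N
    have h4 := Nat.div_add_mod (n : ℕ) N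
    rw [h1] at h3
    rw [h2] at h4
    exact Prod.ext (PNat.eq h3) (PNat.eq h4)

/-- The half of Kronecker's series at `y = x` with nonnegative exponents, as a double sum over all
`m, n ≥ 0`. -/
lemma hasSum_pow_residue_one (hq : ‖q‖ < 1) {x : ℂ} (hx : ‖x‖ < 1) :
    HasSum (fun p : ℕ × ℕ ↦ x ^ (p.1 + p.2) * q ^ (p.1 * p.2))
      (1 / (1 - x) + x / (1 - x) + lambertHalf q x x) := by
  have hs : Summable fun p : ℕ × ℕ ↦ x ^ (p.1 + p.2) * q ^ (p.1 * p.2) := by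
    have h1 : Summable fun p : ℕ × ℕ ↦ ‖x‖ ^ p.1 * ‖x‖ ^ p.2 :=
      (summable_geometric_of_lt_one (by positivity) hx).mul_of_nonneg
        (summable_geometric_of_lt_one (by positivity) hx)
        (fun _ ↦ by positivity) (fun _ ↦ by positivity)
    refine Summable.of_norm_bounded h1 fun p ↦ ?_
    rw [norm_mul, norm_pow, norm_pow, pow_add]
    exact mul_le_of_le_one_right (by positivity) (pow_le_one₀ (norm_nonneg _) hq.le)
  have hxq (m : ℕ) : ‖x * q ^ m‖ < 1 := by
    rw [norm_mul, norm_pow]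
    have : ‖q‖ ^ m ≤ 1 := pow_le_one₀ (norm_nonneg _) hq.le
    nlinarith [norm_nonneg x]
  have hrow (m : ℕ) : ∑' n : ℕ, x ^ (m + n) * q ^ (m * n) = x ^ m / (1 - x * q ^ m) := by
    rw [div_eq_mul_inv, ← tsum_geometric_of_norm_lt_one (hxq m), ← tsum_mul_left]
    refine tsum_congr fun n ↦ ?_
    rw [mul_pow, pow_add, pow_mul]
    ring
  have hx1 : 1 - x ≠ 0 := sub_ne_zero.mpr (by rintro rfl; simp at hx)
  have hyq : ‖x‖ * ‖q‖ < 1 := by nlinarith [norm_nonneg x, norm_nonneg q]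
  have hrow' (m : ℕ) : x ^ (m + 1) / (1 - x * q ^ (m + 1))
      = x * x ^ m + x ^ (m + 1) * (x * q ^ (m + 1)) / (1 - x * q ^ (m + 1)) := by
    have : 1 - x * q ^ (m + 1) ≠ 0 :=
      sub_ne_zero.mpr fun h ↦ by simpa [← h] using hxq (m + 1)
    field_simp
    ring
  have hsr : Summable fun m : ℕ ↦ x ^ m / (1 - x * q ^ m) :=
    hs.prod.congr hrow
  have hval : ∑' p : ℕ × ℕ, x ^ (p.1 + p.2) * q ^ (p.1 * p.2)
      = 1 / (1 - x) + x / (1 - x) + lambertHalf q x x := by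
    rw [hs.tsum_prod, tsum_congr hrow, hsr.tsum_eq_zero_add, tsum_congr hrow',
      ((summable_geometric_of_norm_lt_one hx).mul_left x).tsum_add
        (summable_lambertHalf hq hyq x), tsum_mul_left, tsum_geometric_of_norm_lt_one hx,
      lambertHalf]
    simp only [pow_zero, mul_one]
    ring
  exact hval ▸ hs.hasSum

/-- Kronecker's series at `x = y = t^N`, in base `t^{N²}`, as a sum over the residue classes `±1`
modulo `N`: it reflects `(N m + 1) (N n + 1) = N² m n + N (m + n) + 1`. -/
lemma hasLambertSum_residue (ht0 : t ≠ 0) (ht : ‖t‖ < 1) {N : ℕ} (hN : 2 < N) :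
    HasLambertSum t (fun m n ↦ (if m % N = 1 ∧ n % N = 1 then 1 else 0)
        - (if m % N = N - 1 ∧ n % N = N - 1 then 1 else 0))
      (t * kroneckerSeries (t ^ (N ^ 2)) (t ^ N) (t ^ N)) := by
  have hN0 : N ≠ 0 := by omega
  have hQ := norm_pow_lt_one ht (pow_ne_zero 2 hN0)
  have hx := norm_pow_lt_one ht hN0
  have hx0 : t ^ N ≠ 0 := pow_ne_zero N ht0
  have hinv : ‖(t ^ N)⁻¹‖ * ‖t ^ (N ^ 2)‖ < 1 := by
    rw [← norm_mul, show N ^ 2 = N + (N ^ 2 - N) by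
      rw [Nat.add_sub_cancel']; nlinarith, pow_add, inv_mul_cancel_left₀ hx0]
    refine norm_pow_lt_one ht ?_
    have : N < N ^ 2 := by nlinarith
    omega
  have h1 := (hasSum_pow_residue_one hQ hx).mul_left t
  have h2 := ((summable_pow_mul_pow_mul_pow hQ hinv hinv).hasSum).mul_left t
  rw [← (Equiv.pnatEquivNat.prodCongr Equiv.pnatEquivNat).symm.hasSum_iff] at h2
  have h3 := hasLambertSum_of_residue (t := t) N (r := 1) one_pos (by omega)
    (h1.congr_fun fun p ↦ by
      rw [← pow_mul, ← pow_mul, ← pow_add, ← pow_succ']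
      congr 1
      ring)
  have h4 := hasLambertSum_of_residue (t := t) N (r := N - 1) (by omega) (by omega)
    (h2.congr_fun fun p ↦ by
      obtain ⟨m, n⟩ := p
      simp only [Function.comp_apply, Equiv.prodCongr_symm, Equiv.prodCongr_apply, Prod.map,
        Equiv.pnatEquivNat_symm_apply, Nat.succPNat_coe, Nat.succ_eq_add_one]
      obtain ⟨M, rfl⟩ : ∃ M, N = M + 1 := ⟨N - 1, by omega⟩
      have hexp : (M + 1) ^ 2 * ((m + 1) * (n + 1)) + 1 = (M + 1) * (m + 1) + (M + 1) * (n + 1)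
          + ((M + 1) * m + M) * ((M + 1) * n + M) := by ring
      have h5 : t ^ ((M + 1) ^ 2 * ((m + 1) * (n + 1)) + 1) = (t ^ (M + 1)) ^ (m + 1)
          * (t ^ (M + 1)) ^ (n + 1) * t ^ (((M + 1) * m + M) * ((M + 1) * n + M)) := by
        rw [hexp, pow_add, pow_add, pow_mul, pow_mul]
      rw [Nat.add_sub_cancel, ← pow_mul t, inv_pow, inv_pow]
      rw [pow_succ] at h5
      have h6 := pow_ne_zero (m + 1) hx0
      have h7 := pow_ne_zero (n + 1) hx0
      field_simp
      linear_combination -h5)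
  convert h3.sub h4 using 1
  rw [kroneckerSeries, lambertHalf_eq_doubleLambert hQ hinv hinv]
  simp only [doubleLambert, pow_zero, one_mul]
  ring

lemma kroneckerSeries_pow_three (hq0 : q ≠ 0) (hq : ‖q‖ < 1) :
    kroneckerSeries (q ^ 3) q q = eulerProd (q ^ 3) ^ 3 / eulerProd q := by
  have hQ := norm_pow_lt_one hq three_ne_zero
  have hlt : ‖q ^ 3‖ < ‖q‖ := by
    have := norm_pos_iff.mpr hq0
    rw [norm_pow]; nlinarith [pow_lt_one₀ (norm_nonneg q) hq two_ne_zero]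
  have h2 : ‖q‖ * ‖q ^ 3‖ < 1 := by nlinarith [norm_nonneg q]
  have hq1 : q ≠ 1 := by rintro rfl; simp at hq
  have h := kroneckerSeries_mul_thetaProd (pow_ne_zero 3 hq0) hQ hlt h2 hq1 hlt h2 hq1
  have ha : qPoch (q ^ 3) q ≠ 0 := qPoch_ne_zero_of_norm_lt hQ hq
  have hb : qPoch (q ^ 3) (q ^ 2) ≠ 0 :=
    qPoch_ne_zero_of_norm_lt hQ (norm_pow_lt_one hq two_ne_zero)
  have hE := eulerProd_ne_zero hQ
  rw [thetaProd, thetaProd, show q ^ 3 / q = q ^ 2 by field_simp, show q * q = q ^ 2 by ring,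
    show q ^ 3 / q ^ 2 = q by field_simp] at h
  rw [eulerProd_split_three hq]
  field_simp
  refine mul_right_cancel₀ (mul_ne_zero ha hb) ?_
  linear_combination h

lemma kroneckerSeries_pow_four (hq0 : q ≠ 0) (hq : ‖q‖ < 1) :
    kroneckerSeries (q ^ 4) q q = eulerProd (q ^ 2) ^ 4 / eulerProd q ^ 2 := by
  have hQ := norm_pow_lt_one hq four_ne_zero
  have hq2 := norm_pow_lt_one hq two_ne_zero
  have hlt : ‖q ^ 4‖ < ‖q‖ := by
    have := norm_pos_iff.mpr hq0
    rw [norm_pow]; nlinarith [pow_lt_one₀ (norm_nonneg q) hq three_ne_zero]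
  have h2 : ‖q‖ * ‖q ^ 4‖ < 1 := by nlinarith [norm_nonneg q]
  have hq1 : q ≠ 1 := by rintro rfl; simp at hq
  have h := kroneckerSeries_mul_thetaProd (pow_ne_zero 4 hq0) hQ hlt h2 hq1 hlt h2 hq1
  have ha : qPoch (q ^ 4) q ≠ 0 := qPoch_ne_zero_of_norm_lt hQ hq
  have hb : qPoch (q ^ 4) (q ^ 2) ≠ 0 := qPoch_ne_zero_of_norm_lt hQ hq2
  have hc : qPoch (q ^ 4) (q ^ 3) ≠ 0 :=
    qPoch_ne_zero_of_norm_lt hQ (norm_pow_lt_one hq three_ne_zero)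
  have hE := eulerProd_ne_zero hQ
  have hs := qPoch_eq_prod_pow hq2 2 q
  rw [← pow_mul, Fin.prod_univ_two] at hs
  norm_num at hs
  rw [← pow_succ'] at hs
  have he := eulerProd_split_two hq2
  rw [← pow_mul] at he
  norm_num at he hs
  rw [thetaProd, thetaProd, show q ^ 4 / q = q ^ 3 by field_simp, show q * q = q ^ 2 by ring,
    show q ^ 4 / q ^ 2 = q ^ 2 by field_simp] at h
  rw [eulerProd_split_two hq, he, hs]
  field_simp
  linear_combination h

/-- `t ψ(t⁴)² = (ϕ(t)² - ϕ(-t)²) / 8` for `ψ(q) = ∑_{n ≥ 0} q^{n (n + 1) / 2}`. The identity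
`2 [m ≡ n ≡ 1] - 2 [m ≡ n ≡ 3] = χ(m) [n odd] + χ(n) [m odd]` for `χ = χ₋₄` reduces the left side
to sums over `m` and `n` separately. -/
lemma theta_psi_eq (ht0 : t ≠ 0) (ht : ‖t‖ < 1) :
    t * (eulerProd (t ^ 8) ^ 4 / eulerProd (t ^ 4) ^ 2) = (thetaSq (-t) - thetaSq t) / 8 := by
  have h := hasLambertSum_residue ht0 ht (N := 4) (by norm_num)
  have h1 := kroneckerSeries_pow_four (pow_ne_zero 4 ht0) (norm_pow_lt_one ht four_ne_zero)
  simp only [← pow_mul] at h1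
  norm_num only at h1 h
  rw [h1] at h
  have h2 := (hasLambertSum_sign4 ht0 ht).sub ((hasLambertSum_sign4 (pow_ne_zero 2 ht0)
    (norm_pow_lt_one ht two_ne_zero)).dilate_right (q := t) 2)
  rw [h.unique (((h2.add h2.swap).const_mul (1 / 2)).congr fun m n ↦ ?_)]
  · rw [thetaSq_eq_combination ht0 ht]
    ring
  · simp only [PNat.val_ofNat, sign4, Nat.dvd_iff_mod_eq_zero]
    have hm2 : m % 2 = m % 4 % 2 := by omega
    have hn2 : n % 2 = n % 4 % 2 := by omega
    rw [hm2, hn2]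
    have hm : m % 4 < 4 := Nat.mod_lt _ (by norm_num)
    have hn : n % 4 < 4 := Nat.mod_lt _ (by norm_num)
    generalize m % 4 = m' at hm ⊢
    generalize n % 4 = n' at hn ⊢
    interval_cases m' <;> interval_cases n' <;> norm_num

/-! ### Cubic theta functions -/

/-- The primitive cube root of unity `exp(2πi/3)`. -/
noncomputable def cubeRoot : ℂ := Complex.exp (2 * Real.pi * Complex.I / 3)

lemma cubeRoot_pow_three : cubeRoot ^ 3 = 1 := by
  rw [cubeRoot, ← Complex.exp_nat_mul]
  convert Complex.exp_two_pi_mul_I using 2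
  push_cast
  ring

lemma cubeRoot_ne_one : cubeRoot ≠ 1 := by
  have h := Complex.isPrimitiveRoot_exp 3 (by norm_num)
  intro h1
  exact h.ne_one (by norm_num) (by simpa [cubeRoot] using h1)

lemma cubeRoot_sq_add : cubeRoot ^ 2 + cubeRoot + 1 = 0 := by
  have h := cubeRoot_pow_three
  have h1 := sub_ne_zero.mpr cubeRoot_ne_one
  refine mul_left_cancel₀ h1 ?_
  linear_combination h

lemma norm_cubeRoot : ‖cubeRoot‖ = 1 := by
  have h : ‖cubeRoot‖ ^ 3 = 1 := by rw [← norm_pow, cubeRoot_pow_three, norm_one]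
  exact (pow_eq_one_iff_of_nonneg (norm_nonneg _) three_ne_zero).mp h

lemma cubeRoot_ne_zero : cubeRoot ≠ 0 := norm_pos_iff.mp (by simp [norm_cubeRoot])

lemma cubeRoot_inv : cubeRoot⁻¹ = cubeRoot ^ 2 := by
  exact inv_eq_of_mul_eq_one_right (by rw [← pow_succ', cubeRoot_pow_three])

lemma cubeRoot_pow_sub (m : ℕ) :
    cubeRoot ^ m - (cubeRoot ^ 2) ^ m = (cubeRoot - cubeRoot ^ 2) * sign3 m := by
  have h6 : (cubeRoot ^ 2) ^ 3 = 1 := by rw [← pow_mul, mul_comm, pow_mul, cubeRoot_pow_three, one_pow]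
  rw [← Nat.div_add_mod m 3, pow_add, pow_add, pow_mul, pow_mul, h6, cubeRoot_pow_three, sign3,
    Nat.mul_add_mod, Nat.mod_mod]
  have : m % 3 < 3 := Nat.mod_lt _ (by norm_num)
  interval_cases m % 3 <;> norm_num
  linear_combination cubeRoot * cubeRoot_pow_three

/-- The Lambert sum `∑ χ₋₃(m) q^{mn}`. -/
noncomputable def lambertSign3 (q : ℂ) : ℂ :=
  (cubeRoot - cubeRoot ^ 2)⁻¹ * (doubleLambert q 0 cubeRoot 1 - doubleLambert q 0 (cubeRoot ^ 2) 1)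

lemma cubeRoot_sub_sq_ne_zero : cubeRoot - cubeRoot ^ 2 ≠ 0 := by
  rw [show cubeRoot - cubeRoot ^ 2 = cubeRoot * (1 - cubeRoot) by ring]
  exact mul_ne_zero cubeRoot_ne_zero (sub_ne_zero.mpr cubeRoot_ne_one.symm)

lemma hasLambertSum_sign3 (hq : ‖q‖ < 1) :
    HasLambertSum q (fun m _ ↦ sign3 m) (lambertSign3 q) := by
  refine (((hasLambertSum_doubleLambert_zero hq (x := cubeRoot) (y := 1)
    (by simpa [norm_cubeRoot]) (by simpa)).sub (hasLambertSum_doubleLambert_zero hq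
    (x := cubeRoot ^ 2) (y := 1) (by simpa [norm_cubeRoot]) (by simpa))).const_mul
    (cubeRoot - cubeRoot ^ 2)⁻¹).congr fun m n ↦ ?_
  rw [one_pow, mul_one, mul_one, cubeRoot_pow_sub, inv_mul_cancel_left₀ cubeRoot_sub_sq_ne_zero]

/-- One third of the Borweins' cubic theta function `c(t³)`, as a difference of Lambert sums. -/
lemma cubic_c_eq (ht0 : t ≠ 0) (ht : ‖t‖ < 1) :
    t * (eulerProd (t ^ 9) ^ 3 / eulerProd (t ^ 3)) = lambertSign3 t - lambertSign3 (t ^ 3) := by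
  have h := hasLambertSum_residue ht0 ht (N := 3) (by norm_num)
  have h1 := kroneckerSeries_pow_three (pow_ne_zero 3 ht0) (norm_pow_lt_one ht three_ne_zero)
  simp only [← pow_mul] at h1
  norm_num only at h1 h
  rw [h1] at h
  have h2 := (hasLambertSum_sign3 ht).sub ((hasLambertSum_sign3
    (norm_pow_lt_one ht three_ne_zero)).dilate_right (q := t) 3)
  rw [h.unique (((h2.add h2.swap).const_mul (1 / 2)).congr fun m n ↦ ?_)]
  · ring
  · simp only [PNat.val_ofNat, sign3, Nat.dvd_iff_mod_eq_zero]
    have hm : m % 3 < 3 := Nat.mod_lt _ (by norm_num)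
    have hn : n % 3 < 3 := Nat.mod_lt _ (by norm_num)
    generalize m % 3 = m' at hm ⊢
    generalize n % 3 = n' at hn ⊢
    interval_cases m' <;> interval_cases n' <;> norm_num

lemma thetaProd_cubeRoot (hq : ‖q‖ < 1) : thetaProd q cubeRoot = (1 - cubeRoot) *
    (qPoch q (cubeRoot * q) * qPoch q (cubeRoot ^ 2 * q)) := by
  rw [thetaProd_eq hq, div_eq_mul_inv, cubeRoot_inv, mul_comm q]

lemma thetaProd_cubeRoot_sq (hq : ‖q‖ < 1) : thetaProd q (cubeRoot ^ 2) = (1 - cubeRoot ^ 2) *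
    (qPoch q (cubeRoot * q) * qPoch q (cubeRoot ^ 2 * q)) := by
  rw [thetaProd_eq hq, div_eq_mul_inv, ← cubeRoot_inv, inv_inv, mul_comm q,
    mul_comm (qPoch q (cubeRoot⁻¹ * q))]

/-- The Borweins' cubic theta function `b(q)`: Kronecker's formula at `x = y` a primitive cube root
of unity. -/
lemma cubic_b_eq (hq0 : q ≠ 0) (hq : ‖q‖ < 1) :
    eulerProd q ^ 3 / eulerProd (q ^ 3) = 1 - 3 * lambertSign3 q + 9 * lambertSign3 (q ^ 3) := by
  have hω := cubeRoot_sq_add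
  have hω3 := cubeRoot_pow_three
  have hω1 : 1 - cubeRoot ≠ 0 := sub_ne_zero.mpr cubeRoot_ne_one.symm
  have hn := norm_cubeRoot
  have hk := kroneckerSeries_mul_thetaProd hq0 hq (y := cubeRoot) (x := cubeRoot)
    (by simpa [hn]) (by simpa [hn]) cubeRoot_ne_one (by simpa [hn]) (by simpa [hn]) cubeRoot_ne_one
  rw [← pow_two cubeRoot, thetaProd_cubeRoot hq, thetaProd_cubeRoot_sq hq] at hk
  have ha : qPoch q (cubeRoot * q) ≠ 0 := qPoch_ne_zero_of_norm_lt hq (by simpa [hn])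
  have hb : qPoch q (cubeRoot ^ 2 * q) ≠ 0 := qPoch_ne_zero_of_norm_lt hq (by simpa [hn])
  have hE := eulerProd_ne_zero hq
  have hp := qPoch_mul_cube_roots hq q hω
  rw [← eulerProd, ← eulerProd] at hp
  have hk2 : kroneckerSeries q cubeRoot cubeRoot * (1 - cubeRoot)
      = (1 + cubeRoot) * (eulerProd q ^ 3 / eulerProd (q ^ 3)) := by
    rw [← hp]
    field_simp
    refine mul_right_cancel₀ (mul_ne_zero hω1 (mul_ne_zero ha hb)) ?_
    linear_combination hk
  have hks := kroneckerSeries_eq hq (x := cubeRoot) (y := cubeRoot) (by simpa [hn])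
    (by simpa [hn]) (by simpa [hn]) (by simpa [hn])
  rw [cubeRoot_inv] at hks
  have h1 := (hasLambertSum_doubleLambert_zero hq (x := cubeRoot) (y := cubeRoot)
    (by simpa [hn]) (by simpa [hn])).sub (hasLambertSum_doubleLambert_zero hq
    (x := cubeRoot ^ 2) (y := cubeRoot ^ 2) (by simpa [hn]) (by simpa [hn]))
  have h2 := hasLambertSum_sign3 hq
  have h3 := (hasLambertSum_sign3 (norm_pow_lt_one hq three_ne_zero)).dilate_right (q := q) 3
  -- `χ(m + n)` is expressed through `χ(m)` and `χ(n)`, for `χ = χ₋₃`.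
  have h4 := (((h3.add h3.swap).const_mul (3 / 2)).sub ((h2.add h2.swap).const_mul (1 / 2))).const_mul
    (cubeRoot - cubeRoot ^ 2)
  have h5 := h1.unique (h4.congr fun m n ↦ by
    rw [← pow_add, ← pow_add, cubeRoot_pow_sub]
    congr 1
    simp only [PNat.val_ofNat, sign3, Nat.dvd_iff_mod_eq_zero, Nat.add_mod m n]
    have hm : m % 3 < 3 := Nat.mod_lt _ (by norm_num)
    have hn : n % 3 < 3 := Nat.mod_lt _ (by norm_num)
    generalize m % 3 = m' at hm ⊢
    generalize n % 3 = n' at hn ⊢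
    interval_cases m' <;> interval_cases n' <;> norm_num)
  have h6 : kroneckerSeries q cubeRoot cubeRoot * (1 - cubeRoot) = (1 + cubeRoot)
      + (1 - cubeRoot) * ((cubeRoot - cubeRoot ^ 2) *
        (3 / 2 * (lambertSign3 (q ^ 3) + lambertSign3 (q ^ 3))
          - 1 / 2 * (lambertSign3 q + lambertSign3 q))) := by
    rw [hks, ← h5]
    field_simp
    ring
  have h7 : (1 - cubeRoot) * (cubeRoot - cubeRoot ^ 2) = 3 * (1 + cubeRoot) := by
    linear_combination (cubeRoot - 3) * hω
  have h8 : 1 + cubeRoot ≠ 0 := by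
    rw [show 1 + cubeRoot = -cubeRoot ^ 2 by linear_combination hω]
    exact neg_ne_zero.mpr (pow_ne_zero 2 cubeRoot_ne_zero)
  refine mul_left_cancel₀ h8 ?_
  linear_combination h6 - hk2 + (3 * lambertSign3 (q ^ 3) - lambertSign3 q) * h7

end Residue

/-! ### The eta quotients as power series -/

section Expansions

lemma qpow_ne_zero (x : ℚ) (τ : ℍ) : qpow x τ ≠ 0 := Complex.exp_ne_zero _

lemma qpow_nat_mul (n : ℕ) (x : ℚ) (τ : ℍ) : qpow (n * x) τ = qpow x τ ^ n := by
  rw [qpow, qpow, ← Complex.exp_nat_mul]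
  push_cast
  ring_nf

lemma norm_qpow_lt_one {x : ℚ} (hx : 0 < x) (τ : ℍ) : ‖qpow x τ‖ < 1 := by
  rw [qpow, Complex.norm_exp, Real.exp_lt_one_iff]
  have h : (2 * Real.pi * Complex.I * (x : ℂ) * (τ : ℂ)).re = -(2 * Real.pi * x * τ.im) := by
    simp [Complex.mul_re, Complex.mul_im]
  rw [h]
  have := τ.im_pos
  have : (0 : ℝ) < x := by exact_mod_cast hx
  have := Real.pi_pos
  simp only [Left.neg_neg_iff]
  positivity

lemma qpow_scale (x : ℚ) (l : ℕ+) (τ : ℍ) : qpow x (scale l τ) = qpow x τ ^ (l : ℕ) := by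
  rw [← qpow_nat_mul, qpow, qpow]
  simp only [scale, UpperHalfPlane.coe_mk]
  push_cast
  ring_nf

lemma etaAt_eq (δ : ℕ) (τ : ℍ) :
    etaAt δ τ = qpow (1 / 24) τ ^ δ * eulerProd (qpow 1 τ ^ δ) := by
  rw [etaAt, ModularForm.eta, eulerProd, qPoch, ← qpow_nat_mul, ← qpow_nat_mul]
  congr 1
  · rw [Function.Periodic.qParam, qpow]
    push_cast
    ring_nf
  · refine tprod_congr fun n ↦ ?_
    rw [ModularForm.eta_q_eq_pow, pow_succ', qpow]
    push_cast
    ring_nf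

variable (τ : ℍ)

lemma qpow_one_eq_pow (n : ℕ) (hn : n ≠ 0) : qpow 1 τ = qpow (1 / n) τ ^ n := by
  rw [← qpow_nat_mul]
  congr 1
  field_simp

lemma B2_eq : B2 τ = thetaSq (qpow 1 τ) := by
  have h := qpow_ne_zero (1 / 24) τ
  rw [B2, etaAt_eq, etaAt_eq, thetaSq]
  field_simp

lemma B4_eq : B4 τ = thetaSq (qpow 1 τ) := B2_eq τ

lemma B3_eq : B3 τ = eulerProd (qpow 1 τ) ^ 3 / eulerProd (qpow 1 τ ^ 3) := by
  have h := qpow_ne_zero (1 / 24) τ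
  rw [B3, etaAt_eq, etaAt_eq]
  field_simp

lemma C4_eq : C4 τ = (((2 : ℝ) ^ (3 / 2 : ℝ) : ℝ) : ℂ) *
    ((thetaSq (-qpow (1 / 4) τ) - thetaSq (qpow (1 / 4) τ)) / 8) := by
  have h := qpow_ne_zero (1 / 24) τ
  have h6 : qpow (1 / 4) τ = qpow (1 / 24) τ ^ 6 := by rw [← qpow_nat_mul]; norm_num
  rw [← theta_psi_eq (qpow_ne_zero _ τ) (norm_qpow_lt_one (by norm_num) τ), C4, etaAt_eq, etaAt_eq,
    mul_div_assoc]
  congr 1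
  rw [show (8 : ℕ) = 4 * 2 by norm_num, pow_mul,
    show qpow (1 / 4) τ ^ 4 = qpow 1 τ from (qpow_one_eq_pow τ 4 (by norm_num)).symm, h6]
  field_simp

lemma C3_eq : C3 τ = 3 *
    (lambertSign3 (qpow (1 / 3) τ) - lambertSign3 (qpow (1 / 3) τ ^ 3)) := by
  have h := qpow_ne_zero (1 / 24) τ
  have h6 : qpow (1 / 3) τ = qpow (1 / 24) τ ^ 8 := by rw [← qpow_nat_mul]; norm_num
  rw [← cubic_c_eq (qpow_ne_zero _ τ) (norm_qpow_lt_one (by norm_num) τ), C3, etaAt_eq, etaAt_eq,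
    mul_div_assoc]
  congr 1
  rw [show (9 : ℕ) = 3 * 3 by norm_num, pow_mul,
    show qpow (1 / 3) τ ^ 3 = qpow 1 τ from (qpow_one_eq_pow τ 3 (by norm_num)).symm, h6]
  field_simp

lemma C2_eq : C2 τ =
    (thetaSq (-qpow (1 / 2) τ) - thetaSq (qpow (1 / 2) τ)) / 2 := by
  have h := qpow_ne_zero (1 / 24) τ
  have h6 : qpow (1 / 2) τ = qpow (1 / 24) τ ^ 12 := by rw [← qpow_nat_mul]; norm_num
  have h1 := theta_psi_eq (qpow_ne_zero _ τ) (norm_qpow_lt_one (x := 1 / 2) (by norm_num) τ)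
  rw [show (thetaSq (-qpow (1 / 2) τ) - thetaSq (qpow (1 / 2) τ)) / 2
    = 4 * ((thetaSq (-qpow (1 / 2) τ) - thetaSq (qpow (1 / 2) τ)) / 8) by ring, ← h1, C2, etaAt_eq,
    etaAt_eq, mul_div_assoc]
  have h2 : qpow (1 / 2) τ ^ 2 = qpow 1 τ := (qpow_one_eq_pow τ 2 (by norm_num)).symm
  rw [show qpow (1 / 2) τ ^ 8 = (qpow (1 / 2) τ ^ 2) ^ 4 by ring,
    show qpow (1 / 2) τ ^ 4 = (qpow (1 / 2) τ ^ 2) ^ 2 by ring, h2, h6]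
  field_simp
  ring

end Expansions

/-! ### Divisor sums with periodic weights -/

namespace HasLambertSum

variable {q : ℂ} {S : ℂ} {N : ℕ} [NeZero N] {χ : Fin N → ℂ} {τ : ℍ} {x : ℚ}

lemma hasSum_sigmaW (k : ℕ)
    (h : HasLambertSum (qpow x τ) (fun m _ ↦ χ (Fin.ofNat N m) * (m : ℂ) ^ k) S) :
    HasSum (fun n : ℕ+ ↦ sigmaW k n χ * qpow ((n : ℕ) * x) τ) S :=
  h.hasSum_divisors.congr_fun fun n ↦ by rw [qpow_nat_mul, sigmaW]

lemma hasSum_sigmaC (k : ℕ)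
    (h : HasLambertSum (qpow x τ) (fun m n ↦ χ (Fin.ofNat N n) * (m : ℂ) ^ k) S) :
    HasSum (fun n : ℕ+ ↦ sigmaC k n χ * qpow ((n : ℕ) * x) τ) S :=
  h.hasSum_divisors.congr_fun fun n ↦ by rw [qpow_nat_mul, sigmaC]

lemma hasSum_sigmaW_div (k : ℕ) {K : ℚ}
    (h : HasLambertSum (qpow (1 / K) τ) (fun m _ ↦ χ (Fin.ofNat N m) * (m : ℂ) ^ k) S) :
    HasSum (fun n : ℕ+ ↦ sigmaW k n χ * qpow ((n : ℕ) / K) τ) S :=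
  (h.hasSum_sigmaW k).congr_fun fun n ↦ by rw [mul_one_div]

lemma hasSum_sigmaC_div (k : ℕ) {K : ℚ}
    (h : HasLambertSum (qpow (1 / K) τ) (fun m n ↦ χ (Fin.ofNat N n) * (m : ℂ) ^ k) S) :
    HasSum (fun n : ℕ+ ↦ sigmaC k n χ * qpow ((n : ℕ) / K) τ) S :=
  (h.hasSum_sigmaC k).congr_fun fun n ↦ by rw [mul_one_div]

end HasLambertSum

section Weights

variable (m : ℕ)

lemma weight_eight (a c : ℂ) :
    (![0, a, -c, -a, 0, a, c, -a] : Fin 8 → ℂ) (Fin.ofNat 8 m)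
    = a * sign4 m - c * if 2 ∣ m then sign4 (m / 2) else 0 := by
  have h8 : m % 8 < 8 := Nat.mod_lt _ (by norm_num)
  rw [show Fin.ofNat 8 m = ⟨m % 8, h8⟩ from rfl]
  simp only [sign4, show m % 4 = m % 8 % 4 by omega, show (m / 2) % 4 = m % 8 / 2 by omega,
    show 2 ∣ m ↔ m % 8 % 2 = 0 by omega]
  generalize m % 8 = r at *
  interval_cases r <;> simp

lemma weight_nine (c : ℂ) :
    (![0, 1, -1, -c, 1, -1, c, 1, -1] : Fin 9 → ℂ) (Fin.ofNat 9 m)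
    = sign3 m - c * if 3 ∣ m then sign3 (m / 3) else 0 := by
  have h9 : m % 9 < 9 := Nat.mod_lt _ (by norm_num)
  rw [show Fin.ofNat 9 m = ⟨m % 9, h9⟩ from rfl]
  simp only [sign3, show m % 3 = m % 9 % 3 by omega, show (m / 3) % 3 = m % 9 / 3 by omega,
    show 3 ∣ m ↔ m % 9 % 3 = 0 by omega]
  generalize m % 9 = r at *
  interval_cases r <;> simp

lemma weight_four (c d : ℂ) :
    (![0, c, d, c] : Fin 4 → ℂ) (Fin.ofNat 4 m)
    = c - (c - d) * (if 2 ∣ m then 1 else 0) - d * if 4 ∣ m then 1 else 0 := by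
  have h4 : m % 4 < 4 := Nat.mod_lt _ (by norm_num)
  rw [show Fin.ofNat 4 m = ⟨m % 4, h4⟩ from rfl]
  simp only [show 2 ∣ m ↔ m % 4 % 2 = 0 by omega, show 4 ∣ m ↔ m % 4 = 0 by omega]
  generalize m % 4 = r at *
  interval_cases r <;> simp

end Weights

section Sums

variable {q : ℂ}

lemma hasLambertSum_weight_eight (c : ℂ) (hq0 : q ≠ 0) (hq : ‖q‖ < 1) :
    HasLambertSum q
      (fun m _ ↦ (![0, 1, -c, -1, 0, 1, c, -1] : Fin 8 → ℂ) (Fin.ofNat 8 m) * (m : ℂ) ^ 0)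
      ((thetaSq (-q) - 1) / 4 - c * ((thetaSq (-q ^ 2) - 1) / 4)) := by
  refine ((hasLambertSum_sign4 hq0 hq).sub (((hasLambertSum_sign4 (pow_ne_zero 2 hq0)
    (norm_pow_lt_one hq two_ne_zero)).dilate (q := q) 2).const_mul c)).congr fun m n ↦ ?_
  rw [weight_eight _ 1, one_mul, pow_zero, mul_one]
  rfl

lemma hasLambertSum_weight_nine (c : ℂ) (hq : ‖q‖ < 1) :
    HasLambertSum q
      (fun m _ ↦ (![0, 1, -1, -c, 1, -1, c, 1, -1] : Fin 9 → ℂ) (Fin.ofNat 9 m) * (m : ℂ) ^ 0)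
      (lambertSign3 q - c * lambertSign3 (q ^ 3)) := by
  refine ((hasLambertSum_sign3 hq).sub (((hasLambertSum_sign3
    (norm_pow_lt_one hq three_ne_zero)).dilate (q := q) 3).const_mul c)).congr fun m n ↦ ?_
  rw [weight_nine, pow_zero, mul_one]
  rfl

lemma hasLambertSum_weight_four (c d : ℂ) (hq : ‖q‖ < 1) :
    HasLambertSum q
      (fun m _ ↦ (![0, c, d, c] : Fin 4 → ℂ) (Fin.ofNat 4 m) * (m : ℂ) ^ 1)
      (c * doubleLambert q 1 1 1 - (c - d) * (2 * doubleLambert (q ^ 2) 1 1 1)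
        - d * (4 * doubleLambert (q ^ 4) 1 1 1)) := by
  refine ((((hasLambertSum_id hq).const_mul c).sub ((hasLambertSum_id_even hq).const_mul
    (c - d))).sub ((hasLambertSum_id_four hq).const_mul d)).congr fun m n ↦ ?_
  rw [weight_four]
  split_ifs <;> ring

lemma hasLambertSum_weight_eight_sq (a c : ℂ) (hq0 : q ≠ 0) (hq : ‖q‖ < 1) :
    HasLambertSum q
      (fun m _ ↦ (![0, a, -c, -a, 0, a, c, -a] : Fin 8 → ℂ) (Fin.ofNat 8 m) * (m : ℂ) ^ 2)
      (a * ((1 - thetaSq (-q) * thetaSq q ^ 2) / 4)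
        - 4 * c * ((1 - thetaSq (-q ^ 2) * thetaSq (q ^ 2) ^ 2) / 4)) := by
  refine (((hasLambertSum_sq_sign4 hq0 hq).const_mul a).sub (((hasLambertSum_sq_sign4
    (pow_ne_zero 2 hq0) (norm_pow_lt_one hq two_ne_zero)).dilate (q := q) 2).const_mul
    (4 * c))).congr fun m n ↦ ?_
  rw [weight_eight]
  by_cases h : 2 ∣ m
  · obtain ⟨j, rfl⟩ := h
    simp
    ring
  · simp [h]
    ring

lemma hasLambertSum_weight_eight_sq_right (c : ℂ) (hq0 : q ≠ 0) (hq : ‖q‖ < 1) :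
    HasLambertSum q
      (fun m n ↦ (![0, 1, -c, -1, 0, 1, c, -1] : Fin 8 → ℂ) (Fin.ofNat 8 n) * (m : ℂ) ^ 2)
      (thetaSq (-q) * (thetaSq (-q) ^ 2 - thetaSq q ^ 2) / 16
        - c * (thetaSq (-q ^ 2) * (thetaSq (-q ^ 2) ^ 2 - thetaSq (q ^ 2) ^ 2) / 16)) := by
  refine ((hasLambertSum_sq_sign4_right hq0 hq).sub (((hasLambertSum_sq_sign4_right
    (pow_ne_zero 2 hq0) (norm_pow_lt_one hq two_ne_zero)).dilate_right (q := q) 2).const_mul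
    c)).congr fun m n ↦ ?_
  rw [weight_eight _ 1, one_mul, show ((2 : ℕ+) : ℕ) = 2 from rfl]
  split_ifs <;> ring

/-- `ϕ(q²)² = (ϕ(q)² + ϕ(-q)²) / 2`. -/
lemma thetaSq_neg_sq (hq0 : q ≠ 0) (hq : ‖q‖ < 1) :
    thetaSq (-q ^ 2) = (thetaSq q + thetaSq (-q)) / 2 := by
  rw [thetaSq_eq_combination hq0 hq]
  ring

end Sums

/-- The `q`-expansions. In terms of `ϕ` and the Lambert sum `S₃` of `χ₋₃`, the form `ℬ₂ = ℬ₄` is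
`ϕ(-q)²`, the forms `𝒞₄`, `𝒞₂` are multiples of `t ψ(t⁴)²` at roots `t` of `q`, and `ℬ₃`, `𝒞₃` are
combinations of `S₃(t)` and `S₃(t³)` with `t = q` and `t³ = q`. A weight of period `4 · 2` or `3 · 3`
splits into the character and its dilate. -/
theorem qExpansions (τ : ℍ) :
      (∃ S : ℂ, HasSum (fun n : ℕ+ =>
          sigmaW 0 n ![0, 1, -2, -1, 0, 1, 2, -1] * qpow (n : ℕ) τ) S ∧
        B4 τ = 1 - 4 * S) ∧
      (∃ S : ℂ, HasSum (fun n : ℕ+ =>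
          sigmaW 0 n ![0, 1, -1, -1, 0, 1, 1, -1] * qpow ((n : ℕ) / 4) τ) S ∧
        C4 τ = (((2 : ℝ) ^ (3 / 2 : ℝ) : ℝ) : ℂ) * S) ∧
      (∃ S : ℂ, HasSum (fun n : ℕ+ =>
          sigmaW 1 n ![0, 1, -2, 1] * qpow (n : ℕ) τ) S ∧
        B4 τ ^ 2 = 1 - 8 * S) ∧
      (∃ S : ℂ, HasSum (fun n : ℕ+ =>
          sigmaW 1 n ![0, 2, -1, 2] * qpow ((n : ℕ) / 2) τ) S ∧
        C4 τ ^ 2 = 4 * S) ∧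
      (∃ S : ℂ, HasSum (fun n : ℕ+ =>
          sigmaW 0 n ![0, 1, -1, -3, 1, -1, 3, 1, -1] * qpow (n : ℕ) τ) S ∧
        B3 τ = 1 - 3 * S) ∧
      (∃ S : ℂ, HasSum (fun n : ℕ+ =>
          sigmaW 0 n ![0, 1, -1, -1, 1, -1, 1, 1, -1] * qpow ((n : ℕ) / 3) τ) S ∧
        C3 τ = 3 * S) ∧
      (∃ S : ℂ, HasSum (fun n : ℕ+ =>
          sigmaW 0 n ![0, 1, -2, -1, 0, 1, 2, -1] * qpow (n : ℕ) τ) S ∧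
        B2 τ = 1 - 4 * S) ∧
      (∃ S : ℂ, HasSum (fun n : ℕ+ =>
          sigmaW 0 n ![0, 1, -1, -1, 0, 1, 1, -1] * qpow ((n : ℕ) / 2) τ) S ∧
        C2 τ = 4 * S) ∧
      (∃ S T : ℂ,
        HasSum (fun n : ℕ+ =>
          sigmaW 2 n ![0, 2, -1, -2, 0, 2, 1, -2] * qpow (n : ℕ) τ) S ∧
        HasSum (fun n : ℕ+ =>
          sigmaC 2 n ![0, 1, -8, -1, 0, 1, 8, -1] * qpow (n : ℕ) τ) T ∧
        B2 τ ^ 3 = 1 + 2 * S - 16 * T) ∧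
      (∃ S T : ℂ,
        HasSum (fun n : ℕ+ =>
          sigmaW 2 n ![0, -4, 1, 4, 0, -4, -1, 4] * qpow ((n : ℕ) / 2) τ) S ∧
        HasSum (fun n : ℕ+ =>
          sigmaC 2 n ![0, 1, -4, -1, 0, 1, 4, -1] * qpow ((n : ℕ) / 2) τ) T ∧
        C2 τ ^ 3 = S + 4 * T) := by
  have hq0 := qpow_ne_zero 1 τ
  have hq := norm_qpow_lt_one one_pos τ
  have ht0 (x : ℚ) := qpow_ne_zero x τ
  have ht4 : ‖qpow (1 / 4) τ‖ < 1 := norm_qpow_lt_one (by norm_num) τ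
  have ht3 : ‖qpow (1 / 3) τ‖ < 1 := norm_qpow_lt_one (by norm_num) τ
  have ht2 : ‖qpow (1 / 2) τ‖ < 1 := norm_qpow_lt_one (by norm_num) τ
  have hB : ∃ S : ℂ, HasSum (fun n : ℕ+ =>
      sigmaW 0 n ![0, 1, -2, -1, 0, 1, 2, -1] * qpow (n : ℕ) τ) S ∧
        B2 τ = 1 - 4 * S := by
    refine ⟨_, by simpa using (hasLambertSum_weight_eight 2 hq0 hq).hasSum_sigmaW, ?_⟩
    rw [B2_eq]
    linear_combination thetaSq_eq_combination hq0 hq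
  have h22 : qpow (1 / 4) τ ^ 2 = qpow (1 / 2) τ := by rw [← qpow_nat_mul]; norm_num
  refine ⟨hB, ⟨_, (hasLambertSum_weight_eight 1 (ht0 _) ht4).hasSum_sigmaW_div 0, ?_⟩,
    ⟨_, by simpa using (hasLambertSum_weight_four 1 (-2) hq).hasSum_sigmaW, ?_⟩,
    ⟨_, (hasLambertSum_weight_four 2 (-1) ht2).hasSum_sigmaW_div 1, ?_⟩,
    ⟨_, by simpa using (hasLambertSum_weight_nine 3 hq).hasSum_sigmaW, ?_⟩,
    ⟨_, (hasLambertSum_weight_nine 1 ht3).hasSum_sigmaW_div 0, ?_⟩, hB,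
    ⟨_, (hasLambertSum_weight_eight 1 (ht0 _) ht2).hasSum_sigmaW_div 0, ?_⟩,
    ⟨_, _, by simpa using (hasLambertSum_weight_eight_sq 2 1 hq0 hq).hasSum_sigmaW,
      by simpa using (hasLambertSum_weight_eight_sq_right 8 hq0 hq).hasSum_sigmaC, ?_⟩,
    ⟨_, _, by simpa only [neg_neg] using
      (hasLambertSum_weight_eight_sq (-4) (-1) (ht0 _) ht2).hasSum_sigmaW_div 2,
      (hasLambertSum_weight_eight_sq_right 4 (ht0 _) ht2).hasSum_sigmaC_div 2, ?_⟩⟩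
  · rw [C4_eq]
    linear_combination (((2 : ℝ) ^ (3 / 2 : ℝ) : ℝ) : ℂ) / 4 *
      thetaSq_neg_sq (ht0 (1 / 4)) ht4
  · rw [B4_eq, thetaSq_sq_eq hq0 hq]
    ring
  · have hc : ((((2 : ℝ) ^ (3 / 2 : ℝ) : ℝ) : ℂ)) ^ 2 = 8 := by
      rw [← Complex.ofReal_pow, ← Real.rpow_natCast, ← Real.rpow_mul (by norm_num)]
      norm_num
    rw [C4_eq]
    have h1 := thetaSq_neg_sq (ht0 (1 / 4)) ht4
    have h2 := thetaSq_pow_two_sq ht4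
    rw [h22] at h1 h2
    have h3 := thetaSq_sq_eq (ht0 (1 / 2)) ht2
    have h4 := thetaSq_neg_sq_eq (ht0 (1 / 2)) ht2
    rw [h1] at h4
    linear_combination (thetaSq (-qpow (1 / 4) τ) - thetaSq (qpow (1 / 4) τ)) ^ 2 / 64 * hc
      + 1 / 2 * h4 - 1 / 2 * h3 + 1 / 2 * h2
  · rw [B3_eq, cubic_b_eq hq0 hq]
    ring
  · rw [C3_eq]
    ring
  · rw [C2_eq]
    linear_combination thetaSq_neg_sq (ht0 (1 / 2)) ht2
  · rw [B2_eq]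
    rw [thetaSq_neg_sq hq0 hq, thetaSq_pow_two_sq hq]
    ring
  · rw [C2_eq]
    rw [thetaSq_neg_sq (ht0 _) ht2, thetaSq_pow_two_sq ht2]
    ring

/-! ### Values of `L`-functions -/

section LValues

open Filter Topology

/-- The bound that dominates the paired terms of the odd Hurwitz zeta function as `s → 1⁺`. -/
lemma abs_rpow_sub_rpow_le {a s : ℝ} (ha0 : 0 < a) (ha : a ≤ 1 / 2) (hs1 : 1 ≤ s) (hs2 : s < 2)
    (n : ℕ) : |1 / ((n : ℝ) + a) ^ s - 1 / ((n : ℝ) + 1 - a) ^ s|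
      ≤ 4 / a ^ 2 * (1 / ((n : ℝ) + 1) ^ 2) := by
  have hn : (0 : ℝ) ≤ n := n.cast_nonneg
  set x : ℝ := n + a with hx
  set y : ℝ := n + 1 - a with hy
  have hx0 : 0 < x := by linarith
  have hxy : x ≤ y := by linarith
  have hy0 : 0 < y := by linarith
  -- `y^{-s} = x^{-s} (x/y)^s ≥ x^{-s} (x/y)^2`
  have h1 : 1 / x ^ s - 1 / y ^ s = 1 / x ^ s * (1 - (x / y) ^ s) := by
    rw [Real.div_rpow hx0.le hy0.le]
    have := (Real.rpow_pos_of_pos hx0 s).ne'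
    field_simp
  have hr0 : 0 < x / y := by positivity
  have hr1 : x / y ≤ 1 := (div_le_one hy0).mpr hxy
  have h2 : (x / y) ^ 2 ≤ (x / y) ^ s := by
    rw [← Real.rpow_natCast]
    exact Real.rpow_le_rpow_of_exponent_ge hr0 hr1 (by simpa using hs2.le)
  have h3 : (x / y) ^ s ≤ 1 := Real.rpow_le_one hr0.le hr1 (by linarith)
  have h4 : 1 - (x / y) ^ 2 ≤ 4 / (n + 1) := by
    have : 1 - (x / y) ^ 2 ≤ 2 / y := by
      rw [div_pow, ← sub_nonneg]
      have : 2 / y - (1 - x ^ 2 / y ^ 2) = (2 * y - (y - x) * (y + x)) / y ^ 2 := by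
        field_simp
        ring
      rw [this]
      apply div_nonneg _ (by positivity)
      nlinarith
    refine this.trans ?_
    rw [div_le_div_iff₀ hy0 (by positivity)]
    nlinarith
  have h5 : 1 / x ^ s ≤ 1 / a ^ 2 * (1 / (n + 1)) := by
    have : a ^ 2 * (n + 1) ≤ x ^ s := by
      calc a ^ 2 * (n + 1) ≤ a ^ s * (n + 1) ^ s := by
            gcongr
            · rw [← Real.rpow_natCast]
              exact Real.rpow_le_rpow_of_exponent_ge ha0 (by linarith) (by simpa using hs2.le)
            · conv_lhs => rw [← Real.rpow_one ((n : ℝ) + 1)]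
              exact Real.rpow_le_rpow_of_exponent_le (by linarith) hs1
        _ = (a * (n + 1)) ^ s := (Real.mul_rpow ha0.le (by positivity)).symm
        _ ≤ x ^ s := Real.rpow_le_rpow (by positivity) (by nlinarith) (by linarith)
    rw [one_div_mul_one_div]
    exact one_div_le_one_div_of_le (by positivity) this
  rw [h1, abs_of_nonneg (mul_nonneg (by positivity) (by linarith))]
  calc 1 / x ^ s * (1 - (x / y) ^ s)
      ≤ 1 / a ^ 2 * (1 / (n + 1)) * (4 / (n + 1)) :=
        mul_le_mul h5 (by linarith) (by linarith) (by positivity)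
    _ = 4 / a ^ 2 * (1 / ((n : ℝ) + 1) ^ 2) := by field_simp

lemma summable_cot_bound (a : ℝ) : Summable fun n : ℕ ↦ 4 / a ^ 2 * (1 / ((n : ℝ) + 1) ^ 2) := by
  refine Summable.mul_left _ ?_
  have := (summable_nat_add_iff 1).mpr (Real.summable_one_div_nat_pow.mpr (one_lt_two))
  simpa using this

/-- The partial fraction expansion of the cotangent, with positive denominators. -/
lemma hasSum_cot {a : ℝ} (ha0 : 0 < a) (ha : a ≤ 1 / 2)
    (hs : Summable fun n : ℕ ↦ (1 / ((n : ℂ) + a) - 1 / ((n : ℂ) + 1 - a))) :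
    HasSum (fun n : ℕ ↦ (1 / ((n : ℂ) + a) - 1 / ((n : ℂ) + 1 - a)))
      (Real.pi * Complex.cot (Real.pi * a)) := by
  have haZ : (a : ℂ) ∈ Complex.integerComplement := by
    rw [Complex.mem_integerComplement_iff]
    rintro ⟨m, hm⟩
    have hm' : (m : ℝ) = a := by exact_mod_cast hm
    have h1 : (0 : ℝ) < m := by linarith
    have h2 : (m : ℝ) < 1 := by linarith
    have h3 : (0 : ℤ) < m := by exact_mod_cast h1
    have h4 : m < (1 : ℤ) := by exact_mod_cast h2
    omega
  have hnz (n : ℕ) : (n : ℂ) + a ≠ 0 := by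
    rw [← Complex.ofReal_natCast, ← Complex.ofReal_add, Complex.ofReal_ne_zero]
    positivity
  have h := cot_series_rep' haZ
  have hsum := ((summable_cotTerm haZ).hasSum).tendsto_sum_nat
  have hS := hs.hasSum.tendsto_sum_nat
  have hpart (N : ℕ) : ∑ n ∈ Finset.range N, (1 / ((n : ℂ) + a) - 1 / ((n : ℂ) + 1 - a))
      = 1 / a - 1 / ((N : ℂ) + a)
        + ∑ n ∈ Finset.range N, (1 / ((a : ℂ) - (n + 1)) + 1 / ((a : ℂ) + (n + 1))) := by
    induction N with
    | zero => simp
    | succ N ih =>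
      rw [Finset.sum_range_succ, ih, Finset.sum_range_succ]
      have : (a : ℂ) - (N + 1) = -((N : ℂ) + 1 - a) := by ring
      rw [this]
      push_cast
      rw [show (a : ℂ) + (N + 1) = (N : ℂ) + 1 + a by ring, div_neg]
      ring
  have hlim : Tendsto (fun N : ℕ ↦ 1 / ((N : ℂ) + a)) atTop (𝓝 0) := by
    simp only [one_div]
    refine tendsto_inv₀_cobounded.comp ?_
    refine tendsto_norm_atTop_iff_cobounded.mp ?_
    have : (fun N : ℕ ↦ ‖(N : ℂ) + a‖) = fun N : ℕ ↦ (N : ℝ) + a := by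
      funext N
      rw [← Complex.ofReal_natCast, ← Complex.ofReal_add, Complex.norm_of_nonneg (by positivity)]
    rw [this]
    exact tendsto_atTop_add_const_right _ _ tendsto_natCast_atTop_atTop
  simp only [hpart] at hS
  have hS' := (((tendsto_const_nhds (x := 1 / (a : ℂ))).sub hlim).add hsum)
  rw [← h, sub_zero, add_sub_cancel] at hS'
  rw [← tendsto_nhds_unique hS hS']
  exact hs.hasSum

/-- The value at `s = 1` of the odd Hurwitz zeta function is a cotangent: the series
`∑ (1 / (n + a) ^ s - 1 / (n + 1 - a) ^ s)` is dominated for `1 ≤ s < 2` by a convergent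
series, so that the limit `s → 1⁺` can be taken termwise. -/
lemma hurwitzZetaOdd_apply_one {a : ℝ} (ha0 : 0 < a) (ha : a ≤ 1 / 2) :
    HurwitzZeta.hurwitzZetaOdd a 1 = Real.pi * Complex.cot (Real.pi * a) / 2 := by
  have key (s : ℝ) (hs1 : 1 ≤ s) (n : ℕ) :
      1 / ((n : ℂ) + a) ^ (s : ℂ) - 1 / ((n : ℂ) + 1 - a) ^ (s : ℂ)
        = ((1 / ((n : ℝ) + a) ^ s - 1 / ((n : ℝ) + 1 - a) ^ s : ℝ) : ℂ) := by
    have h1 : (0 : ℝ) ≤ n + a := by positivity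
    have h2 : (0 : ℝ) ≤ n + 1 - a := by
      have : (0 : ℝ) ≤ n := n.cast_nonneg
      linarith
    push_cast [Complex.ofReal_cpow h1, Complex.ofReal_cpow h2]
    rfl
  have hbound (s : ℝ) (hs1 : 1 ≤ s) (hs2 : s < 2) (n : ℕ) :
      ‖1 / ((n : ℂ) + a) ^ (s : ℂ) - 1 / ((n : ℂ) + 1 - a) ^ (s : ℂ)‖
        ≤ 4 / a ^ 2 * (1 / ((n : ℝ) + 1) ^ 2) := by
    rw [key s hs1, Complex.norm_real]
    exact abs_rpow_sub_rpow_le ha0 ha hs1 hs2 n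
  have hs : Summable fun n : ℕ ↦ (1 / ((n : ℂ) + a) - 1 / ((n : ℂ) + 1 - a)) :=
    (summable_cot_bound a).of_norm_bounded fun n ↦ by simpa using hbound 1 le_rfl one_lt_two n
  have hcot := hasSum_cot ha0 ha hs
  have hev : ∀ᶠ s : ℝ in 𝓝[>] 1, 1 < s ∧ s < 2 :=
    Ioo_mem_nhdsGT (one_lt_two)
  have hlim1 : Tendsto (fun s : ℝ ↦ ∑' n : ℕ,
      (1 / ((n : ℂ) + a) ^ (s : ℂ) - 1 / ((n : ℂ) + 1 - a) ^ (s : ℂ))) (𝓝[>] 1)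
      (𝓝 (∑' n : ℕ, (1 / ((n : ℂ) + a) - 1 / ((n : ℂ) + 1 - a)))) := by
    refine tendsto_tsum_of_dominated_convergence (summable_cot_bound a) (fun n ↦ ?_)
      (hev.mono fun s hs n ↦ hbound s hs.1.le hs.2 n)
    have hn1 : (n : ℂ) + a ≠ 0 := by
      rw [← Complex.ofReal_natCast, ← Complex.ofReal_add, Complex.ofReal_ne_zero]
      positivity
    have hn2 : (n : ℂ) + 1 - a ≠ 0 := by
      have : (0 : ℝ) ≤ n := n.cast_nonneg
      have h2 : (n : ℝ) + 1 - a ≠ 0 := by linarith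
      exact_mod_cast h2
    refine Tendsto.mono_left ?_ nhdsWithin_le_nhds
    have hc : ContinuousAt (fun s : ℝ ↦
        1 / ((n : ℂ) + a) ^ (s : ℂ) - 1 / ((n : ℂ) + 1 - a) ^ (s : ℂ)) 1 := by
      refine ContinuousAt.sub (continuousAt_const.div ?_ ?_) (continuousAt_const.div ?_ ?_)
      · exact Complex.continuous_ofReal.continuousAt.const_cpow (Or.inl hn1)
      · simpa using hn1
      · exact Complex.continuous_ofReal.continuousAt.const_cpow (Or.inl hn2)
      · simpa using hn2
    simpa [ContinuousAt] using hc
  have hlim2 : Tendsto (fun s : ℝ ↦ 2 * HurwitzZeta.hurwitzZetaOdd a s) (𝓝[>] 1)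
      (𝓝 (2 * HurwitzZeta.hurwitzZetaOdd a 1)) := by
    refine Tendsto.mono_left ?_ nhdsWithin_le_nhds
    have : Continuous fun s : ℝ ↦ 2 * HurwitzZeta.hurwitzZetaOdd a s :=
      continuous_const.mul
        ((HurwitzZeta.differentiable_hurwitzZetaOdd a).continuous.comp Complex.continuous_ofReal)
    simpa using this.tendsto 1
  have heq : (fun s : ℝ ↦ 2 * HurwitzZeta.hurwitzZetaOdd a s) =ᶠ[𝓝[>] 1] fun s : ℝ ↦ ∑' n : ℕ,
      (1 / ((n : ℂ) + a) ^ (s : ℂ) - 1 / ((n : ℂ) + 1 - a) ^ (s : ℂ)) := by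
    filter_upwards [hev] with s hs
    have h := HurwitzZeta.hasSum_nat_hurwitzZetaOdd_of_mem_Icc (a := a) ⟨ha0.le, by linarith⟩
      (s := (s : ℂ)) (by simpa using hs.1)
    rw [← h.tsum_eq, ← tsum_mul_left]
    refine tsum_congr fun n ↦ ?_
    ring
  have := tendsto_nhds_unique (hlim2.congr' heq) hlim1
  rw [hcot.tsum_eq] at this
  linear_combination this / 2

/-- For a function `Φ` on `ℤ/N` proportional to `n ↦ sin(2πn/N)`, the sine zeta function at `1/N`
is a multiple of the `L`-function of `Φ`. The Dirichlet series agree for `s > 1`, and the value at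
`s = 1` follows by continuity. -/
lemma sinZeta_eq_LFunction {N : ℕ} [NeZero N] (Φ : ZMod N → ℂ) (hΦ : ∑ j, Φ j = 0) {c : ℂ}
    (hc : ∀ n : ℕ, (Real.sin (2 * Real.pi * (1 / N : ℝ) * n) : ℂ) = c * Φ n) :
    HurwitzZeta.sinZeta ((1 / N : ℝ) : UnitAddCircle) 1 = c * ZMod.LFunction Φ 1 := by
  have h1 : Continuous fun s : ℝ ↦ HurwitzZeta.sinZeta ((1 / N : ℝ) : UnitAddCircle) s :=
    (HurwitzZeta.differentiableAt_sinZeta _).continuous.comp Complex.continuous_ofReal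
  have h2 : Continuous fun s : ℝ ↦ c * ZMod.LFunction Φ s :=
    continuous_const.mul
      ((ZMod.differentiable_LFunction_of_sum_zero hΦ).continuous.comp Complex.continuous_ofReal)
  have heq : (fun s : ℝ ↦ HurwitzZeta.sinZeta ((1 / N : ℝ) : UnitAddCircle) s)
      =ᶠ[𝓝[>] 1] fun s : ℝ ↦ c * ZMod.LFunction Φ s := by
    filter_upwards [self_mem_nhdsWithin] with s hs
    have hs1 : 1 < (s : ℂ).re := by simpa using hs
    have h := HurwitzZeta.LSeriesHasSum_sin (1 / N : ℝ) hs1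
    have h' := (ZMod.LSeriesSummable_of_one_lt_re Φ hs1).LSeriesHasSum.smul c
    rw [ZMod.LFunction_eq_LSeries Φ hs1]
    refine HasSum.unique h ((LSeriesHasSum_congr _ _ fun {n} _ ↦ ?_).mp h')
    simp only [Pi.smul_apply, smul_eq_mul, hc n]
  have := tendsto_nhds_unique (((h1.tendsto 1).mono_left nhdsWithin_le_nhds).congr' heq)
    ((h2.tendsto 1).mono_left nhdsWithin_le_nhds)
  simpa using this

/-- The functional equation of the odd Hurwitz zeta function, between `s = 1` and `s = 0`. -/
lemma hurwitzZetaOdd_apply_zero (a : UnitAddCircle) :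
    HurwitzZeta.hurwitzZetaOdd a 0 = HurwitzZeta.sinZeta a 1 / Real.pi := by
  have h := HurwitzZeta.hurwitzZetaOdd_one_sub a (s := 1) (fun n hn ↦ by
    have : ((1 + n : ℕ) : ℂ) = 0 := by push_cast; rw [hn]; ring
    exact absurd (Nat.cast_eq_zero.mp this) (by omega))
  rw [sub_self, Complex.Gamma_one, mul_one, mul_one, Complex.sin_pi_div_two, mul_one,
    Complex.cpow_neg_one] at h
  rw [h]
  have := Complex.ofReal_ne_zero.mpr Real.pi_ne_zero
  field_simp

lemma chi4_apply (j : ZMod 4) : chi4 j = (ZMod.χ₄ j : ℂ) := rfl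

lemma chi3_apply (j : ZMod 3) : chi3 j = ((quadraticChar (ZMod 3) j : ℤ) : ℂ) := rfl

lemma chi4_natCast (n : ℕ) : chi4 (n : ZMod 4) = sign4 n := by
  rw [chi4_apply, ZMod.χ₄_nat_eq_if_mod_four, sign4]
  have : n % 4 < 4 := Nat.mod_lt _ (by norm_num)
  have h2 : n % 2 = n % 4 % 2 := by omega
  rw [h2]
  generalize n % 4 = r at *
  interval_cases r <;> simp

lemma chi3_natCast (n : ℕ) : chi3 (n : ZMod 3) = sign3 n := by
  have : n % 3 < 3 := Nat.mod_lt _ (by norm_num)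
  have h : (n : ZMod 3) = ((n % 3 : ℕ) : ZMod 3) := by simp
  rw [chi3_apply, sign3, h]
  generalize n % 3 = r at *
  interval_cases r
  · simp
  · simp
  · have : quadraticChar (ZMod 3) ((2 : ℕ) : ZMod 3) = -1 := by decide
    rw [this]
    simp

lemma LFunction_chi4_eq (s : ℂ) : ZMod.LFunction chi4 s
    = 4 ^ (-s) * (2 * HurwitzZeta.hurwitzZetaOdd ((1 / (4 : ℕ) : ℝ) : UnitAddCircle) s) := by
  have hodd : Function.Odd (chi4 : ZMod 4 → ℂ) := by
    intro j
    have : ∀ j : ZMod 4, ZMod.χ₄ (-j) = -ZMod.χ₄ j := by decide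
    rw [chi4_apply, chi4_apply, this]
    simp
  have h1 := ZMod.toAddCircle_natCast (N := 4) 1
  have hsum : ∑ j : ZMod 4, chi4 j * HurwitzZeta.hurwitzZetaOdd (ZMod.toAddCircle j) s
      = 2 * HurwitzZeta.hurwitzZetaOdd (ZMod.toAddCircle (1 : ZMod 4)) s := by
    have h0 : ZMod.χ₄ 0 = 0 := by decide
    have h1 : ZMod.χ₄ 1 = 1 := by decide
    have h2 : ZMod.χ₄ 2 = 0 := by decide
    have h3 : ZMod.χ₄ (-1) = -1 := by decide
    have huniv : (Finset.univ : Finset (ZMod 4)) = {0, 1, 2, -1} := by decide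
    rw [huniv, Finset.sum_insert (by decide), Finset.sum_insert (by decide),
      Finset.sum_insert (by decide), Finset.sum_singleton]
    simp only [chi4_apply, h0, h1, h2, h3, map_neg, HurwitzZeta.hurwitzZetaOdd_neg]
    push_cast
    ring
  rw [ZMod.LFunction_def_odd hodd, hsum]
  rw [Nat.cast_one, Nat.cast_one] at h1
  rw [h1]
  norm_cast

lemma LFunction_chi3_eq (s : ℂ) : ZMod.LFunction chi3 s
    = 3 ^ (-s) * (2 * HurwitzZeta.hurwitzZetaOdd ((1 / (3 : ℕ) : ℝ) : UnitAddCircle) s) := by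
  have hodd : Function.Odd (chi3 : ZMod 3 → ℂ) := by
    intro j
    have : ∀ j : ZMod 3, quadraticChar (ZMod 3) (-j) = -quadraticChar (ZMod 3) j := by decide
    rw [chi3_apply, chi3_apply, this]
    simp
  have h1 := ZMod.toAddCircle_natCast (N := 3) 1
  have hsum : ∑ j : ZMod 3, chi3 j * HurwitzZeta.hurwitzZetaOdd (ZMod.toAddCircle j) s
      = 2 * HurwitzZeta.hurwitzZetaOdd (ZMod.toAddCircle (1 : ZMod 3)) s := by
    have h0 : quadraticChar (ZMod 3) 0 = 0 := by decide
    have h1 : quadraticChar (ZMod 3) 1 = 1 := by decide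
    have h3 : quadraticChar (ZMod 3) (-1) = -1 := by decide
    have huniv : (Finset.univ : Finset (ZMod 3)) = {0, 1, -1} := by decide
    rw [huniv, Finset.sum_insert (by decide), Finset.sum_insert (by decide),
      Finset.sum_singleton]
    simp only [chi3_apply, h0, h1, h3, map_neg, HurwitzZeta.hurwitzZetaOdd_neg]
    push_cast
    ring
  rw [ZMod.LFunction_def_odd hodd, hsum]
  rw [Nat.cast_one, Nat.cast_one] at h1
  rw [h1]
  norm_cast

lemma sum_chi4 : ∑ j, chi4 j = 0 := by
  have : ∑ j, ZMod.χ₄ j = 0 := by decide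
  simp only [chi4_apply]
  exact_mod_cast this

lemma sum_chi3 : ∑ j, chi3 j = 0 := by
  have : ∑ j, quadraticChar (ZMod 3) j = 0 := by decide
  simp only [chi3_apply]
  exact_mod_cast this

lemma sin_two_pi_div_four (n : ℕ) :
    (Real.sin (2 * Real.pi * (1 / (4 : ℕ) : ℝ) * n) : ℂ) = 1 * chi4 n := by
  have h : (2 * Real.pi * (1 / (4 : ℕ) : ℝ) * n)
      = (n % 4 : ℕ) * (Real.pi / 2) + (n / 4 : ℕ) * (2 * Real.pi) := by
    have : (n : ℝ) = 4 * (n / 4 : ℕ) + (n % 4 : ℕ) := by exact_mod_cast (Nat.div_add_mod n 4).symm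
    rw [this]
    push_cast
    ring
  rw [h, Real.sin_add_nat_mul_two_pi, chi4_natCast, sign4]
  have : n % 4 < 4 := Nat.mod_lt _ (by norm_num)
  generalize n % 4 = r at *
  interval_cases r
  · simp
  · simp
  · have : ((2 : ℕ) : ℝ) * (Real.pi / 2) = Real.pi := by push_cast; ring
    rw [this, Real.sin_pi]
    simp
  · have : ((3 : ℕ) : ℝ) * (Real.pi / 2) = Real.pi / 2 + Real.pi := by push_cast; ring
    rw [this, Real.sin_add_pi]
    simp

lemma sin_two_pi_div_three (n : ℕ) :
    (Real.sin (2 * Real.pi * (1 / (3 : ℕ) : ℝ) * n) : ℂ) = ((√3 / 2 : ℝ) : ℂ) * chi3 n := by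
  have h : (2 * Real.pi * (1 / (3 : ℕ) : ℝ) * n)
      = (n % 3 : ℕ) * (2 * Real.pi / 3) + (n / 3 : ℕ) * (2 * Real.pi) := by
    have : (n : ℝ) = 3 * (n / 3 : ℕ) + (n % 3 : ℕ) := by exact_mod_cast (Nat.div_add_mod n 3).symm
    rw [this]
    push_cast
    ring
  rw [h, Real.sin_add_nat_mul_two_pi, chi3_natCast, sign3]
  have : n % 3 < 3 := Nat.mod_lt _ (by norm_num)
  generalize n % 3 = r at *
  interval_cases r
  · simp
  · have : ((1 : ℕ) : ℝ) * (2 * Real.pi / 3) = Real.pi - Real.pi / 3 := by push_cast; ring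
    rw [this, Real.sin_pi_sub, Real.sin_pi_div_three]
    simp
  · have : ((2 : ℕ) : ℝ) * (2 * Real.pi / 3) = Real.pi / 3 + Real.pi := by push_cast; ring
    rw [this, Real.sin_add_pi, Real.sin_pi_div_three]
    simp

/-- The functional equation expresses the value at `0` by `L(1, χ₋₄)`, which is `cot (π / 4)` up to
elementary factors. -/
lemma LFunction_chi4_zero : DirichletCharacter.LFunction chi4 0 = 1 / 2 := by
  have hpi := Complex.ofReal_ne_zero.mpr Real.pi_ne_zero
  have h1 := hurwitzZetaOdd_apply_one (a := 1 / (4 : ℕ)) (by norm_num) (by norm_num)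
  have hcot : Complex.cot (Real.pi * ((1 / (4 : ℕ) : ℝ) : ℂ)) = 1 := by
    rw [← Complex.ofReal_mul, ← Complex.ofReal_cot,
      show Real.pi * (1 / (4 : ℕ)) = Real.pi / 4 by push_cast; ring, Real.cot_eq_cos_div_sin,
      Real.cos_pi_div_four, Real.sin_pi_div_four, div_self (by positivity), Complex.ofReal_one]
  have h2 := sinZeta_eq_LFunction (N := 4) chi4 sum_chi4 sin_two_pi_div_four
  rw [LFunction_chi4_eq, h1, hcot, Complex.cpow_neg_one] at h2
  rw [DirichletCharacter.LFunction, LFunction_chi4_eq, hurwitzZetaOdd_apply_zero, h2]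
  simp
  field_simp
  norm_num

/-- The functional equation expresses the value at `0` by `L(1, χ₋₃)`, which is `cot (π / 3)` up to
elementary factors. -/
lemma LFunction_chi3_zero : DirichletCharacter.LFunction chi3 0 = 1 / 3 := by
  have hpi := Complex.ofReal_ne_zero.mpr Real.pi_ne_zero
  have h1 := hurwitzZetaOdd_apply_one (a := 1 / (3 : ℕ)) (by norm_num) (by norm_num)
  have hcot : Complex.cot (Real.pi * ((1 / (3 : ℕ) : ℝ) : ℂ)) = ((1 / √3 : ℝ) : ℂ) := by
    rw [← Complex.ofReal_mul, ← Complex.ofReal_cot,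
      show Real.pi * (1 / (3 : ℕ)) = Real.pi / 3 by push_cast; ring, Real.cot_eq_cos_div_sin,
      Real.cos_pi_div_three, Real.sin_pi_div_three]
    congr 1
    field_simp
  have h2 := sinZeta_eq_LFunction (N := 3) chi3 sum_chi3 sin_two_pi_div_three
  rw [LFunction_chi3_eq, h1, hcot, Complex.cpow_neg_one] at h2
  have h3 : ((√3 : ℝ) : ℂ) ≠ 0 := Complex.ofReal_ne_zero.mpr (by positivity)
  rw [DirichletCharacter.LFunction, LFunction_chi3_eq, hurwitzZetaOdd_apply_zero, h2]
  push_cast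
  simp
  field_simp

/-- The value of the odd Hurwitz zeta function at `-2` is given by the Bernoulli polynomial `B₃` at
`1 / 4`. -/
lemma LFunction_chi4_neg_two : DirichletCharacter.LFunction chi4 (-2) = -1 / 2 := by
  have h := HurwitzZeta.hurwitzZetaOdd_neg_two_mul_nat (k := 1) one_ne_zero
    (x := 1 / (4 : ℕ)) ⟨by norm_num, by norm_num⟩
  have hb := congrArg (algebraMap ℚ ℂ) Polynomial.bernoulli_three_eval_one_quarter
  rw [← Polynomial.eval_map_apply] at hb
  rw [DirichletCharacter.LFunction, LFunction_chi4_eq]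
  have h4 : (4 : ℂ) ^ (-(-2 : ℂ)) = 16 := by
    rw [neg_neg, show (2 : ℂ) = ((2 : ℕ) : ℂ) by norm_num, Complex.cpow_natCast]
    norm_num
  rw [h4]
  have hx : ((1 / (4 : ℕ) : ℝ) : ℂ) = algebraMap ℚ ℂ (1 / 4) := by simp
  rw [show (-2 : ℂ) = -(2 * (1 : ℕ)) by norm_num, h, hx, hb]
  simp
  norm_num

/-! ### Eisenstein series -/

lemma triv_apply (x : ZMod 1) : triv x = 1 := by
  rw [Subsingleton.elim x 1, map_one]

lemma EisHat_eq {u v : ℕ} {k : ℕ} {ψ : DirichletCharacter ℂ u} {φ : DirichletCharacter ℂ v} {τ : ℍ}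
    {S : ℂ} (h : HasLambertSum (qpow 1 τ) (fun m n ↦ ψ n * φ m * (m : ℂ) ^ (k - 1)) S) :
    EisHat k ψ φ τ = S := by
  refine (h.hasSum_divisors.congr_fun fun n ↦ ?_).tsum_eq
  rw [← qpow_nat_mul, mul_one]

variable (τ : ℍ)

lemma Eis_one_chi3 : Eis 1 triv chi3 τ = 1 + 6 * lambertSign3 (qpow 1 τ) := by
  rw [Eis, if_pos rfl, EisHat_eq ((hasLambertSum_sign3 (norm_qpow_lt_one one_pos τ)).congr
    fun m n ↦ by rw [triv_apply, chi3_natCast]; simp), Nat.cast_one, sub_self, LFunction_chi3_zero]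
  norm_num

lemma Eis_one_chi4 : Eis 1 triv chi4 τ = thetaSq (-qpow 1 τ) := by
  rw [Eis, if_pos rfl, EisHat_eq ((hasLambertSum_sign4 (qpow_ne_zero 1 τ)
    (norm_qpow_lt_one one_pos τ)).congr
    fun m n ↦ by rw [triv_apply, chi4_natCast]; simp), Nat.cast_one, sub_self, LFunction_chi4_zero]
  ring

lemma Eis_three_chi4 : Eis 3 triv chi4 τ = thetaSq (-qpow 1 τ) * thetaSq (qpow 1 τ) ^ 2 := by
  rw [Eis, if_pos rfl, EisHat_eq ((hasLambertSum_sq_sign4 (qpow_ne_zero 1 τ)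
    (norm_qpow_lt_one one_pos τ)).congr
    fun m n ↦ by rw [triv_apply, chi4_natCast]; simp), show (1 : ℂ) - (3 : ℕ) = -2 by norm_num,
    LFunction_chi4_neg_two]
  ring

lemma Eis_three_chi4_triv : Eis 3 chi4 triv τ
    = thetaSq (-qpow 1 τ) * (thetaSq (-qpow 1 τ) ^ 2 - thetaSq (qpow 1 τ) ^ 2) / 8 := by
  rw [Eis, if_neg (by norm_num), EisHat_eq ((hasLambertSum_sq_sign4_right (qpow_ne_zero 1 τ)
    (norm_qpow_lt_one one_pos τ)).congr
    fun m n ↦ by rw [triv_apply, chi4_natCast]; simp)]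
  ring

/-- All Eisenstein series involved are polynomials in `ϕ(q)²`, `ϕ(-q)²`, or linear in `S₃(q)`; the
substitution `q ↦ q²` is expressed through `ϕ(q²)²` and `ϕ(-q²)⁴`. -/
theorem eisensteinRepresentations :
      B3 τ = -(1 / 2) * Eis 1 triv chi3 τ + 3 / 2 * Eis 1 triv chi3 (scale 3 τ) ∧
      C3 (scale 3 τ) = 1 / 2 * Eis 1 triv chi3 τ - 1 / 2 * Eis 1 triv chi3 (scale 3 τ) ∧
      B2 τ = -Eis 1 triv chi4 τ + 2 * Eis 1 triv chi4 (scale 2 τ) ∧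
      C2 (scale 2 τ) = Eis 1 triv chi4 τ - Eis 1 triv chi4 (scale 2 τ) ∧
      B2 τ ^ 3 = -Eis 3 triv chi4 τ + 2 * Eis 3 triv chi4 (scale 2 τ)
        - 8 * Eis 3 chi4 triv τ + 64 * Eis 3 chi4 triv (scale 2 τ) ∧
      C2 (scale 2 τ) ^ 3 = Eis 3 triv chi4 τ - Eis 3 triv chi4 (scale 2 τ)
        + 2 * Eis 3 chi4 triv τ - 8 * Eis 3 chi4 triv (scale 2 τ) := by
  have hq0 := qpow_ne_zero 1 τ
  have hq := norm_qpow_lt_one one_pos τ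
  have h3 : qpow 1 (scale 3 τ) = qpow 1 τ ^ 3 := qpow_scale 1 3 τ
  have h2 : qpow 1 (scale 2 τ) = qpow 1 τ ^ 2 := qpow_scale 1 2 τ
  have h3' : qpow (1 / 3) (scale 3 τ) = qpow 1 τ := by
    rw [qpow_scale]; exact (qpow_one_eq_pow τ 3 (by norm_num)).symm
  have h2' : qpow (1 / 2) (scale 2 τ) = qpow 1 τ := by
    rw [qpow_scale]; exact (qpow_one_eq_pow τ 2 (by norm_num)).symm
  simp only [Eis_one_chi3, Eis_one_chi4, Eis_three_chi4, Eis_three_chi4_triv, B3_eq, C3_eq, B2_eq,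
    C2_eq, h3, h2, h3', h2', cubic_b_eq hq0 hq, thetaSq_neg_sq hq0 hq, thetaSq_pow_two_sq hq]
  refine ⟨?_, ?_, ?_, ?_, ?_, ?_⟩ <;> ring

end LValues

/-! ### Transformation of eta quotients under `T` and `S` -/

section EtaQuotients

open Filter Topology ModularForm

/-- The twenty-fourth root of unity `exp(2πi/24)` by which `η` is multiplied under `z ↦ z + 1`. -/
noncomputable def zeta24 : ℂ := Complex.exp (2 * Real.pi * Complex.I / 24)

lemma zeta24_ne_zero : zeta24 ≠ 0 := Complex.exp_ne_zero _

lemma zeta24_pow_eight : zeta24 ^ 8 = cubeRoot := by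
  rw [zeta24, cubeRoot, ← Complex.exp_nat_mul]
  push_cast
  ring_nf

lemma zeta24_pow_six : zeta24 ^ 6 = Complex.I := by
  refine Eq.trans ?_ Complex.exp_pi_div_two_mul_I
  rw [zeta24, ← Complex.exp_nat_mul]
  congr 1
  push_cast
  ring

lemma eta_add_intCast (z : ℂ) (j : ℤ) : ModularForm.eta (z + j) = zeta24 ^ j * ModularForm.eta z := by
  have h1 : Function.Periodic.qParam 24 (z + j) = zeta24 ^ j * Function.Periodic.qParam 24 z := by
    rw [Function.Periodic.qParam, Function.Periodic.qParam, zeta24, ← Complex.exp_int_mul,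
      ← Complex.exp_add]
    push_cast
    ring_nf
  have h2 : Function.Periodic.qParam 1 (z + j) = Function.Periodic.qParam 1 z := by
    rw [Function.Periodic.qParam, Function.Periodic.qParam, Complex.exp_eq_exp_iff_exists_int]
    exact ⟨j, by push_cast; ring⟩
  simp only [ModularForm.eta, ModularForm.eta_q, h1, h2, mul_assoc]

/-- The eta quotient `η(aτ)^m / η(bτ)^n` with real positive scaling factors. -/
noncomputable def etaQuot (m n : ℕ) (a b : ℝ) (τ : ℍ) : ℂ :=
  ModularForm.eta (a * τ) ^ m / ModularForm.eta (b * τ) ^ n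

variable {m n : ℕ} {a b : ℝ}

lemma pos_mul_mem (ha : 0 < a) (τ : ℍ) : (a : ℂ) * τ ∈ upperHalfPlaneSet := by
  simpa [upperHalfPlaneSet] using mul_pos ha τ.im_pos

lemma etaQuot_ne_zero (ha : 0 < a) (hb : 0 < b) (τ : ℍ) : etaQuot m n a b τ ≠ 0 :=
  div_ne_zero (pow_ne_zero _ (eta_ne_zero (pos_mul_mem ha τ)))
    (pow_ne_zero _ (eta_ne_zero (pos_mul_mem hb τ)))

lemma mdifferentiable_etaQuot (m n : ℕ) (ha : 0 < a) (hb : 0 < b) :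
    MDiff (etaQuot m n a b) := by
  rw [UpperHalfPlane.mdifferentiable_iff]
  have h (r : ℝ) (hr : 0 < r) :
      DifferentiableOn ℂ (fun z : ℂ ↦ ModularForm.eta (r * z)) {z | 0 < z.im} := by
    intro z hz
    refine (DifferentiableAt.comp z (differentiableAt_eta_of_mem_upperHalfPlaneSet ?_)
      (by fun_prop)).differentiableWithinAt
    exact pos_mul_mem hr ⟨z, hz⟩
  refine (((h a ha).pow m).div ((h b hb).pow n) fun z hz ↦
    pow_ne_zero _ (eta_ne_zero (pos_mul_mem hb ⟨z, hz⟩))).congr fun z hz ↦ ?_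
  simp [etaQuot, ofComplex_apply_of_im_pos hz]

lemma slash_T_zpow_apply (f : ℍ → ℂ) (k j : ℤ) (τ : ℍ) :
    (f ∣[k] (ModularGroup.T ^ j)) τ = f ((j : ℝ) +ᵥ τ) := by
  rw [SL_slash_apply, modular_T_zpow_smul, ModularGroup.denom_apply]
  simp [ModularGroup.coe_T_zpow]

lemma slash_S_apply (f : ℍ → ℂ) (k : ℤ) (τ : ℍ) :
    (f ∣[k] ModularGroup.S) τ = f ⟨(-τ : ℂ)⁻¹, τ.im_inv_neg_coe_pos⟩ * (τ : ℂ) ^ (-k) := by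
  rw [SL_slash_apply, modular_S_smul, ModularGroup.denom_apply]
  simp [ModularGroup.S]

lemma etaQuot_slash_T_zpow (m n : ℕ) (k j : ℤ) {A B : ℤ} (hA : a * j = A) (hB : b * j = B) :
    etaQuot m n a b ∣[k] (ModularGroup.T ^ j) = (zeta24 ^ (A * m - B * n)) • etaQuot m n a b := by
  ext τ
  have hA' : (a : ℂ) * j = A := by exact_mod_cast hA
  have hB' : (b : ℂ) * j = B := by exact_mod_cast hB
  rw [slash_T_zpow_apply, Pi.smul_apply, smul_eq_mul, etaQuot, etaQuot, coe_vadd]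
  push_cast
  rw [mul_add, mul_add, hA', hB', add_comm, add_comm (B : ℂ), eta_add_intCast, eta_add_intCast,
    mul_pow, mul_pow, zpow_sub₀ zeta24_ne_zero, zpow_mul, zpow_mul, zpow_natCast, zpow_natCast]
  ring

/-- The transformation of `η` under `z ↦ -1/z`, at `z = τ/a`. -/
lemma exists_eta_neg_inv (ha : 0 < a) : ∃ c : ℂ, c ≠ 0 ∧ ∀ τ : ℍ,
    ModularForm.eta (a * (-τ : ℂ)⁻¹) = c * Complex.sqrt τ * ModularForm.eta ((1 / a : ℝ) * τ) := by
  have hI : Complex.sqrt Complex.I ≠ 0 := by simp [Complex.sqrt]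
  have hainv : 0 < 1 / a := by positivity
  refine ⟨(Complex.sqrt Complex.I)⁻¹ * Complex.sqrt (1 / a : ℝ), mul_ne_zero (inv_ne_zero hI) ?_,
    fun τ ↦ ?_⟩
  · simp [Complex.sqrt, ha.ne']
  · have h := eta_comp_eq_csqrt_I_inv (pos_mul_mem hainv τ)
    have hτ := τ.ne_zero
    have h1 : (-1 : ℂ) / ((1 / a : ℝ) * τ) = a * (-τ : ℂ)⁻¹ := by
      push_cast
      have : (a : ℂ) ≠ 0 := by exact_mod_cast ha.ne'
      field_simp
    have h2 : Complex.sqrt ((1 / a : ℝ) * τ) = Complex.sqrt (1 / a : ℝ) * Complex.sqrt τ := by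
      have h0 : ((1 / a : ℝ) : ℂ) ≠ 0 := by exact_mod_cast hainv.ne'
      rw [sqrt_eq_exp (mul_ne_zero h0 hτ), sqrt_eq_exp h0,
        sqrt_eq_exp hτ, Complex.log_ofReal_mul hainv hτ, ← Complex.exp_add,
        Complex.ofReal_log hainv.le, add_div]
    simp only [Function.comp_apply, Pi.smul_apply, Pi.mul_apply, smul_eq_mul, h1, h2] at h
    rw [h]
    ring

/-- In weight one (for `n + 2` factors over `n`) the involution `τ ↦ -1/τ` exchanges the
scaling factors `a, b` with `1/a, 1/b`. -/
lemma exists_etaQuot_slash_S (n : ℕ) (ha : 0 < a) (hb : 0 < b) : ∃ c : ℂ,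
    etaQuot (n + 2) n a b ∣[(1 : ℤ)] ModularGroup.S = c • etaQuot (n + 2) n (1 / a) (1 / b) := by
  obtain ⟨c, hc, h⟩ := exists_eta_neg_inv ha
  obtain ⟨d, hd, h'⟩ := exists_eta_neg_inv hb
  refine ⟨c ^ (n + 2) / d ^ n, ?_⟩
  ext τ
  have hτ := τ.ne_zero
  have hs : Complex.sqrt τ ^ 2 = τ := by
    rw [Complex.sqrt, ← Complex.cpow_nat_mul]; simp
  have hs0 : Complex.sqrt τ ≠ 0 := fun h0 ↦ hτ (by rw [← hs, h0]; simp)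
  rw [slash_S_apply, Pi.smul_apply, smul_eq_mul, etaQuot, etaQuot, UpperHalfPlane.coe_mk, h, h',
    zpow_neg_one]
  have he := eta_ne_zero (pos_mul_mem (one_div_pos.mpr hb) τ)
  rw [mul_pow, mul_pow, mul_pow, mul_pow, pow_add (Complex.sqrt τ), hs]
  field_simp

lemma tendsto_tprod_one_sub_pow {r : ℝ} (hr : 0 < r) :
    Tendsto (fun τ : ℍ ↦ ∏' n : ℕ, (1 - ModularForm.eta_q n (r * τ))) atImInfty (𝓝 1) := by
  have h1 : Tendsto (fun τ : ℍ ↦ Function.Periodic.qParam 1 (r * τ)) atImInfty (𝓝 0) := by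
    rw [tendsto_zero_iff_norm_tendsto_zero]
    have h : (fun τ : ℍ ↦ ‖Function.Periodic.qParam 1 (r * τ)‖)
        = fun τ : ℍ ↦ Real.exp (-(2 * Real.pi * r * τ.im)) := by
      funext τ
      rw [Function.Periodic.norm_qParam]
      simp only [Complex.im_ofReal_mul, UpperHalfPlane.coe_im]
      ring_nf
    rw [h]
    refine Real.tendsto_exp_neg_atTop_nhds_zero.comp ?_
    exact Tendsto.const_mul_atTop (by positivity) tendsto_comap
  have h2 : ContinuousAt (fun q : ℂ ↦ ∏' n : ℕ, (1 - q ^ (n + 1))) 0 :=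
    (differentiableOn_tprod_one_sub_pow.differentiableAt
      (Metric.isOpen_ball.mem_nhds (by simp))).continuousAt
  have h3 := h2.tendsto.comp h1
  simp only [ne_eq, Nat.add_eq_zero_iff, one_ne_zero, and_false, not_false_eq_true, zero_pow,
    sub_zero, tprod_one] at h3
  exact h3

/-- The hypothesis says that the leading exponent `(a m - b n) / 24` of the expansion at `i∞` is
nonnegative. -/
lemma isBoundedAtImInfty_etaQuot (ha : 0 < a) (hb : 0 < b) (h : b * n ≤ a * m) :
    IsBoundedAtImInfty (etaQuot m n a b) := by
  have h1 := ((tendsto_tprod_one_sub_pow ha).pow m).div ((tendsto_tprod_one_sub_pow hb).pow n)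
    (by simp)
  have h2 : (fun τ : ℍ ↦ Complex.exp (2 * Real.pi * Complex.I * ((a * m - b * n : ℝ) / 24) * τ))
      =O[atImInfty] (1 : ℍ → ℝ) := by
    refine Asymptotics.IsBigO.of_bound 1 (Eventually.of_forall fun τ ↦ ?_)
    have he : (2 * Real.pi * Complex.I * ((a * m - b * n : ℝ) / 24) * τ : ℂ).re
        = -(2 * Real.pi * ((a * m - b * n) / 24) * τ.im) := by
      have : (2 * Real.pi * Complex.I * ((a * m - b * n : ℝ) / 24) * τ : ℂ)
          = ((2 * Real.pi * ((a * m - b * n) / 24) : ℝ) : ℂ) * (Complex.I * τ) := by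
        push_cast; ring
      rw [this, Complex.re_ofReal_mul]
      simp
    rw [Complex.norm_exp, he]
    have : 0 ≤ 2 * Real.pi * ((a * m - b * n) / 24) * τ.im := by
      have := τ.im_pos
      have := sub_nonneg.mpr h
      positivity
    simpa using this
  have h3 := h2.mul (h1.isBigO_one ℝ)
  refine (h3.congr_left fun τ ↦ ?_).trans (by simpa using! Asymptotics.isBigO_refl _ _)
  have he (r : ℝ) (k : ℕ) : Function.Periodic.qParam 24 (r * τ) ^ k
      = Complex.exp (2 * Real.pi * Complex.I * (r * k / 24) * τ) := by
    rw [Function.Periodic.qParam, ← Complex.exp_nat_mul]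
    congr 1
    push_cast
    ring
  rw [etaQuot, ModularForm.eta, ModularForm.eta, mul_pow, mul_pow, he, he, mul_div_mul_comm,
    ← Complex.exp_sub]
  congr 2
  push_cast
  ring

end EtaQuotients

/-! ### Generators of `Γ₀(N)` for `N ≤ 4` -/

section Generators

/-- The matrix `(1 0; N 1)`, written as a conjugate of a translation. -/
def lowerV (N : ℕ) : SL(2, ℤ) := ModularGroup.S * ModularGroup.T ^ (-(N : ℤ)) * ModularGroup.S⁻¹

lemma coe_lowerV_zpow (N : ℕ) (j : ℤ) :
    ((lowerV N ^ j : SL(2, ℤ)) : Matrix (Fin 2) (Fin 2) ℤ) = !![1, 0; N * j, 1] := by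
  rw [lowerV, conj_zpow, ← zpow_mul, Matrix.SpecialLinearGroup.coe_mul,
    Matrix.SpecialLinearGroup.coe_mul, ModularGroup.coe_T_zpow, Matrix.SpecialLinearGroup.coe_inv,
    ModularGroup.coe_S, Matrix.adjugate_fin_two_of]
  simp

lemma mem_Gamma0_iff_dvd {N : ℕ} {γ : SL(2, ℤ)} :
    γ ∈ CongruenceSubgroup.Gamma0 N ↔ (N : ℤ) ∣ γ.1 1 0 := by
  rw [CongruenceSubgroup.Gamma0_mem]
  exact ZMod.intCast_zmod_eq_zero_iff_dvd _ _

lemma mul_T_zpow_apply (γ : SL(2, ℤ)) (j : ℤ) :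
    ((γ * ModularGroup.T ^ j : SL(2, ℤ)) : Matrix (Fin 2) (Fin 2) ℤ)
      = !![γ.1 0 0, γ.1 0 0 * j + γ.1 0 1; γ.1 1 0, γ.1 1 0 * j + γ.1 1 1] := by
  rw [Matrix.SpecialLinearGroup.coe_mul, ModularGroup.coe_T_zpow, Matrix.eta_fin_two γ.1]
  simp

lemma mul_lowerV_zpow_apply (N : ℕ) (γ : SL(2, ℤ)) (j : ℤ) :
    ((γ * lowerV N ^ j : SL(2, ℤ)) : Matrix (Fin 2) (Fin 2) ℤ)
      = !![γ.1 0 0 + γ.1 0 1 * (N * j), γ.1 0 1; γ.1 1 0 + γ.1 1 1 * (N * j), γ.1 1 1] := by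
  rw [Matrix.SpecialLinearGroup.coe_mul, coe_lowerV_zpow, Matrix.eta_fin_two γ.1]
  simp

lemma det_eq_one (γ : SL(2, ℤ)) : γ.1 0 0 * γ.1 1 1 - γ.1 0 1 * γ.1 1 0 = 1 := by
  have := γ.2
  rwa [Matrix.det_fin_two] at this

/-- Every integer has a representative of absolute value at most `c / 2` modulo `c`. -/
lemma exists_two_mul_abs_add_mul_le (d : ℤ) {c : ℤ} (hc : c ≠ 0) :
    ∃ j : ℤ, 2 * |c * j + d| ≤ |c| := by
  refine ⟨-(round ((d : ℚ) / c)), ?_⟩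
  have h := abs_sub_round ((d : ℚ) / c)
  have hc' : (0 : ℚ) < |(c : ℚ)| := abs_pos.mpr (by exact_mod_cast hc)
  have h2 : |(c : ℚ) * (-(round ((d : ℚ) / c))) + d| = |(c : ℚ)| * |(d : ℚ) / c - round ((d : ℚ) / c)| := by
    rw [← abs_mul]
    congr 1
    field_simp
    ring
  have h3 : 2 * |(c : ℚ) * (-(round ((d : ℚ) / c))) + d| ≤ |(c : ℚ)| := by
    rw [h2]
    nlinarith
  exact_mod_cast h3

/-- For `N ≤ 4`, the group `Γ₀(N)` is generated by `T`, `(1 0; N 1)` and `-1`: alternately reducing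
`d` modulo `c` and `c` modulo `N d` is a terminating descent, since `N / 4 ≤ 1`. -/
lemma mem_closure_of_mem_Gamma0 {N : ℕ} (hN2 : 2 ≤ N) (hN4 : N ≤ 4) {γ : SL(2, ℤ)}
    (hγ : γ ∈ CongruenceSubgroup.Gamma0 N) :
    γ ∈ Subgroup.closure {ModularGroup.T, lowerV N, -1} := by
  set G := Subgroup.closure ({ModularGroup.T, lowerV N, -1} : Set SL(2, ℤ)) with hG
  have hT : ModularGroup.T ∈ G := Subgroup.subset_closure (by simp)
  have hV : lowerV N ∈ G := Subgroup.subset_closure (by simp)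
  have hneg : (-1 : SL(2, ℤ)) ∈ G := Subgroup.subset_closure (by simp)
  induction hn : (γ.1 1 0).natAbs using Nat.strong_induction_on generalizing γ with
  | _ n ih =>
    have hdet := det_eq_one γ
    have hdvd := mem_Gamma0_iff_dvd.mp hγ
    by_cases hc : γ.1 1 0 = 0
    · rw [hc, mul_zero, sub_zero] at hdet
      have key (δ : SL(2, ℤ)) (h1 : δ.1 0 0 = 1) (h2 : δ.1 1 0 = 0) (h3 : δ.1 1 1 = 1) : δ ∈ G := by
        have : δ = ModularGroup.T ^ (δ.1 0 1) := by
          ext i j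
          rw [ModularGroup.coe_T_zpow]
          fin_cases i <;> fin_cases j <;> simp [h1, h2, h3]
        rw [this]
        exact zpow_mem hT _
      rcases Int.eq_one_or_neg_one_of_mul_eq_one' hdet with ⟨h1, h2⟩ | ⟨h1, h2⟩
      · exact key γ h1 hc h2
      · have := key (-γ) (by simp [h1]) (by simp [hc]) (by simp [h2])
        rw [← neg_neg γ, ← neg_one_mul (-γ)]
        exact mul_mem hneg this
    · obtain ⟨j, hj⟩ := exists_two_mul_abs_add_mul_le (γ.1 1 1) hc
      set d := γ.1 1 0 * j + γ.1 1 1 with hd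
      have hd0 : d ≠ 0 := by
        intro h0
        have h1 : γ.1 1 0 ∣ γ.1 0 0 * γ.1 1 1 - γ.1 0 1 * γ.1 1 0 :=
          dvd_sub (Dvd.dvd.mul_left ⟨-j, by linear_combination h0⟩ _) (dvd_mul_left _ _)
        rw [hdet] at h1
        have h2 := Int.le_of_dvd one_pos (hdvd.trans h1)
        omega
      have hNd : (N : ℤ) * d ≠ 0 := mul_ne_zero (by omega) hd0
      obtain ⟨i, hi⟩ := exists_two_mul_abs_add_mul_le (γ.1 1 0) hNd
      have hmem : γ * ModularGroup.T ^ j * lowerV N ^ i ∈ G := by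
        have e1 : (γ * ModularGroup.T ^ j * lowerV N ^ i).1 1 0 = N * d * i + γ.1 1 0 := by
          rw [mul_lowerV_zpow_apply, mul_T_zpow_apply]
          simp [hd]
          ring
        refine ih _ ?_ ?_ rfl
        · rw [e1, ← hn]
          have hle : 2 * |(N : ℤ) * d * i + γ.1 1 0| ≤ 4 * |d| := by
            refine hi.trans ?_
            rw [abs_mul, abs_of_nonneg (by positivity : (0 : ℤ) ≤ N)]
            have : (N : ℤ) ≤ 4 := by exact_mod_cast hN4
            nlinarith [abs_nonneg d]
          have hlt : |(N : ℤ) * d * i + γ.1 1 0| < |γ.1 1 0| := by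
            refine lt_of_le_of_ne (by linarith) fun heq ↦ ?_
            -- equality forces `N = 4` and `|c| = 2 |d|` with `gcd(c, d) = 1`, so `|c| = 2`, whereas
            -- `N ∣ c`
            have h2 : |γ.1 1 0| = 2 * |d| := by linarith
            have hdc : d ∣ γ.1 1 0 := by
              rw [← abs_dvd_abs, h2]
              exact dvd_mul_left _ _
            have hd1 : d ∣ γ.1 0 0 * γ.1 1 1 - γ.1 0 1 * γ.1 1 0 := by
              refine dvd_sub (Dvd.dvd.mul_left ?_ _) (hdc.mul_left _)
              have : γ.1 1 1 = d - γ.1 1 0 * j := by rw [hd]; ring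
              rw [this]
              exact dvd_sub dvd_rfl (hdc.mul_right _)
            rw [hdet] at hd1
            have hdabs : |d| = 1 := Int.isUnit_iff_abs_eq.mp (isUnit_of_dvd_one hd1)
            rw [heq, abs_mul, hdabs, h2, hdabs] at hi
            rw [hdabs] at h2
            have hN : |(N : ℤ)| = N := abs_of_nonneg (by positivity)
            obtain rfl : N = 4 := by omega
            obtain ⟨e, he⟩ := hdvd
            rw [he] at h2
            rcases (abs_eq (by norm_num)).mp h2 with h5 | h5 <;> push_cast at h5 <;> omega
          rwa [Int.abs_eq_natAbs, Int.abs_eq_natAbs, Nat.cast_lt] at hlt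
        · rw [mem_Gamma0_iff_dvd, e1]
          exact dvd_add ((dvd_mul_right _ _).mul_right _) hdvd
      have : γ = γ * ModularGroup.T ^ j * lowerV N ^ i * (lowerV N ^ i)⁻¹ * (ModularGroup.T ^ j)⁻¹ := by
        group
      rw [this]
      exact mul_mem (mul_mem hmem (inv_mem (zpow_mem hV _))) (inv_mem (zpow_mem hT _))

end Generators

/-! ### Multipliers from generators -/

section Multipliers

open ModularForm

variable {f : ℍ → ℂ} {k : ℤ} {γ δ : SL(2, ℤ)} {c d : ℂ}

lemma slash_mul_of_slash (h : f ∣[k] γ = c • f) (h' : f ∣[k] δ = d • f) :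
    f ∣[k] (γ * δ) = (c * d) • f := by
  rw [SlashAction.slash_mul, h, SL_smul_slash, h', smul_smul]

lemma slash_inv_of_slash (hc : c ≠ 0) (h : f ∣[k] γ = c • f) : f ∣[k] γ⁻¹ = c⁻¹ • f := by
  have h1 : (f ∣[k] γ) ∣[k] γ⁻¹ = f := by rw [← SlashAction.slash_mul, mul_inv_cancel,
    SlashAction.slash_one]
  rw [h, SL_smul_slash] at h1
  rw [eq_inv_smul_iff₀ hc, h1]

lemma slash_neg_one (f : ℍ → ℂ) (k : ℤ) : f ∣[k] (-1 : SL(2, ℤ)) = ((-1 : ℂ) ^ k) • f := by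
  ext τ
  rw [SL_slash_apply, ModularGroup.denom_apply, Pi.smul_apply, smul_eq_mul,
    ModularGroup.SL_neg_smul, one_smul]
  rw [mul_comm]
  congr 1
  simp [← inv_zpow]

lemma T_mem_Gamma0 (N : ℕ) : ModularGroup.T ∈ CongruenceSubgroup.Gamma0 N := by
  rw [mem_Gamma0_iff_dvd]
  simp [ModularGroup.T]

lemma neg_one_mem_Gamma0 (N : ℕ) : (-1 : SL(2, ℤ)) ∈ CongruenceSubgroup.Gamma0 N := by
  rw [mem_Gamma0_iff_dvd]
  simp

lemma coe_lowerV (N : ℕ) :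
    ((lowerV N : SL(2, ℤ)) : Matrix (Fin 2) (Fin 2) ℤ) = !![1, 0; (N : ℤ), 1] := by
  simpa using coe_lowerV_zpow N 1

lemma lowerV_mem_Gamma0 (N : ℕ) : lowerV N ∈ CongruenceSubgroup.Gamma0 N := by
  rw [mem_Gamma0_iff_dvd, coe_lowerV]
  simp

lemma exists_slash_eq_smul {N : ℕ} (hN2 : 2 ≤ N) (hN4 : N ≤ 4) {cT cV : ℂ} (hcT : cT ≠ 0)
    (hcV : cV ≠ 0) (hT : f ∣[k] ModularGroup.T = cT • f) (hV : f ∣[k] lowerV N = cV • f)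
    (hγ : γ ∈ CongruenceSubgroup.Gamma0 N) : ∃ c : ℂˣ, f ∣[k] γ = (c : ℂ) • f := by
  refine Subgroup.closure_induction (p := fun γ _ ↦ ∃ c : ℂˣ, f ∣[k] γ = (c : ℂ) • f) ?_ ?_ ?_ ?_
    (mem_closure_of_mem_Gamma0 hN2 hN4 hγ)
  · rintro x (rfl | rfl | rfl)
    · exact ⟨Units.mk0 cT hcT, hT⟩
    · exact ⟨Units.mk0 cV hcV, hV⟩
    · exact ⟨Units.mk0 ((-1) ^ k) (zpow_ne_zero _ (by norm_num)), slash_neg_one f k⟩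
  · exact ⟨1, by simp⟩
  · rintro x y _ _ ⟨c, hc⟩ ⟨d, hd⟩
    exact ⟨c * d, by simpa using slash_mul_of_slash hc hd⟩
  · rintro x _ ⟨c, hc⟩
    exact ⟨c⁻¹, by simpa using slash_inv_of_slash c.ne_zero hc⟩

/-- A multiplier on `Γ₀(N)` is determined by its values on generators: `ε` is only required to be
multiplicative with respect to right multiplication by the generators. -/
lemma slash_eq_of_generators {N : ℕ} (hN2 : 2 ≤ N) (hN4 : N ≤ 4) {cT cV : ℂ} (hcT : cT ≠ 0)
    (hcV : cV ≠ 0) (hT : f ∣[k] ModularGroup.T = cT • f) (hV : f ∣[k] lowerV N = cV • f)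
    (ε : SL(2, ℤ) → ℂ) (hε1 : ε 1 = 1)
    (hεT : ∀ γ ∈ CongruenceSubgroup.Gamma0 N, ε (γ * ModularGroup.T) = ε γ * cT)
    (hεV : ∀ γ ∈ CongruenceSubgroup.Gamma0 N, ε (γ * lowerV N) = ε γ * cV)
    (hεn : ∀ γ ∈ CongruenceSubgroup.Gamma0 N, ε (γ * -1) = ε γ * (-1) ^ k)
    (hγ : γ ∈ CongruenceSubgroup.Gamma0 N) : f ∣[k] γ = ε γ • f := by
  have key : ∀ y ∈ ({ModularGroup.T, lowerV N, -1} : Set SL(2, ℤ)),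
      y ∈ CongruenceSubgroup.Gamma0 N ∧ ∃ c : ℂ, c ≠ 0 ∧ f ∣[k] y = c • f ∧
        ∀ γ ∈ CongruenceSubgroup.Gamma0 N, ε (γ * y) = ε γ * c := by
    rintro y (rfl | rfl | rfl)
    · exact ⟨T_mem_Gamma0 N, cT, hcT, hT, hεT⟩
    · exact ⟨lowerV_mem_Gamma0 N, cV, hcV, hV, hεV⟩
    · exact ⟨neg_one_mem_Gamma0 N, _, zpow_ne_zero _ (by norm_num), slash_neg_one f k, hεn⟩
  refine (Subgroup.closure_induction_right
    (p := fun γ _ ↦ γ ∈ CongruenceSubgroup.Gamma0 N ∧ f ∣[k] γ = ε γ • f) ?_ ?_ ?_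
    (mem_closure_of_mem_Gamma0 hN2 hN4 hγ)).2
  · exact ⟨one_mem _, by simp [hε1]⟩
  · rintro x _ y hy ⟨hx, hxf⟩
    obtain ⟨hyG, c, -, hyf, hyε⟩ := key y hy
    exact ⟨mul_mem hx hyG, by rw [slash_mul_of_slash hxf hyf, hyε x hx]⟩
  · rintro x _ y hy ⟨hx, hxf⟩
    obtain ⟨hyG, c, hc, hyf, hyε⟩ := key y hy
    have hxy := mul_mem hx (inv_mem hyG)
    refine ⟨hxy, ?_⟩
    have h := hyε _ hxy
    rw [inv_mul_cancel_right] at h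
    rw [slash_mul_of_slash hxf (slash_inv_of_slash hc hyf), h, mul_inv_cancel_right₀ hc]

lemma apply_smul_of_slash {k : ℕ} (h : f ∣[(k : ℤ)] γ = c • f) (τ : ℍ) :
    f (γ • τ) = c * (((γ.1 1 0 : ℤ) : ℂ) * (τ : ℂ) + ((γ.1 1 1 : ℤ) : ℂ)) ^ k * f τ := by
  have h1 := congrFun h τ
  have h2 := denom_ne_zero γ τ
  rw [SL_slash_apply, Pi.smul_apply, smul_eq_mul, zpow_neg, zpow_natCast,
    ← div_eq_mul_inv, div_eq_iff (pow_ne_zero _ h2)] at h1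
  rw [h1, ModularGroup.denom_apply]
  ring

end Multipliers

/-! ### Modular forms with multiplier -/

namespace IsModularForm

variable {Γ : Subgroup SL(2, ℤ)} {k : ℕ} {v w : SL(2, ℤ) → ℂ} {f : ℍ → ℂ}

lemma congr (hf : IsModularForm Γ k v f) (h : ∀ γ ∈ Γ, v γ = w γ) : IsModularForm Γ k w f where
  holo := hf.holo
  transform γ hγ τ := by rw [← h γ hγ]; exact hf.transform γ hγ τ
  bounded := hf.bounded

lemma pow (hf : IsModularForm Γ k v f) (n : ℕ) :
    IsModularForm Γ (k * n) (fun γ ↦ v γ ^ n) (fun τ ↦ f τ ^ n) where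
  holo := by
    have h := hf.holo
    rw [UpperHalfPlane.mdifferentiable_iff] at h ⊢
    exact h.pow n
  transform γ hγ τ := by rw [hf.transform γ hγ τ]; ring
  bounded A := by
    have h : ((fun τ ↦ f τ ^ n) ∣[((k * n : ℕ) : ℤ)] A) = fun τ ↦ ((f ∣[(k : ℤ)] A) τ) ^ n := by
      ext τ
      rw [ModularForm.SL_slash_apply, ModularForm.SL_slash_apply, mul_pow]
      push_cast
      rw [← zpow_natCast (_ ^ (-(k : ℤ))), ← zpow_mul, neg_mul]
    rw [h]
    exact (Asymptotics.IsBigO.pow (hf.bounded A) n).congr_right fun τ ↦ one_pow n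

end IsModularForm

lemma hasNonDirichletMultiplier_of_slash {N k : ℕ} {f : ℍ → ℂ} {v : SL(2, ℤ) → ℂˣ}
    (hf : IsModularForm (CongruenceSubgroup.Gamma0 N) k (fun γ ↦ (v γ : ℂ)) f)
    {γ : SL(2, ℤ)} (hγ : γ ∈ CongruenceSubgroup.Gamma0 N) (hd : ((γ.1 1 1 : ℤ) : ZMod N) = 1)
    (hne : (v γ : ℂ) ≠ 1) : HasNonDirichletMultiplier N k f :=
  ⟨v, hf, fun χ ↦ ⟨γ, hγ, by rwa [hd, map_one]⟩⟩

/-! ### Boundedness at all cusps -/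

section Bounded

open ModularForm

variable {f : ℍ → ℂ} {k : ℤ}

lemma isBoundedAtImInfty_smul {f : ℍ → ℂ} (hf : IsBoundedAtImInfty f) (c : ℂ) :
    IsBoundedAtImInfty (c • f) :=
  Filter.BoundedAtFilter.smul c hf

lemma isBoundedAtImInfty_slash_T_zpow (hf : IsBoundedAtImInfty f) (j : ℤ) :
    IsBoundedAtImInfty (f ∣[k] (ModularGroup.T ^ j)) := by
  refine IsBoundedAtImInfty.slash k ?_ hf
  change (((ModularGroup.T ^ j : SL(2, ℤ)).1 1 0 : ℤ) : ℝ) = 0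
  rw [ModularGroup.coe_T_zpow]
  simp

/-- For `p` prime every coset of `Γ₀(p)` is represented by `1` or by some `S T^j`, so that
boundedness of `f` and of `f ∣ S` suffices. -/
lemma bounded_of_slash_S {p : ℕ} (hp : p.Prime)
    (hf : ∀ γ ∈ CongruenceSubgroup.Gamma0 p, ∃ c : ℂˣ, f ∣[k] γ = (c : ℂ) • f)
    (h1 : IsBoundedAtImInfty f) (hS : IsBoundedAtImInfty (f ∣[k] ModularGroup.S))
    (A : SL(2, ℤ)) : IsBoundedAtImInfty (f ∣[k] A) := by
  by_cases hc : (p : ℤ) ∣ A.1 1 0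
  · obtain ⟨c, hc⟩ := hf A (mem_Gamma0_iff_dvd.mpr hc)
    rw [hc]
    exact isBoundedAtImInfty_smul h1 _
  · obtain ⟨j, hj⟩ : ∃ j : ℤ, (p : ℤ) ∣ A.1 1 1 - A.1 1 0 * j := by
      have hco : IsCoprime (p : ℤ) (A.1 1 0) :=
        (Prime.coprime_iff_not_dvd (Nat.prime_iff_prime_int.mp hp)).mpr hc
      obtain ⟨u, v, huv⟩ := hco
      exact ⟨v * A.1 1 1, u * A.1 1 1, by linear_combination A.1 1 1 * (-huv)⟩
    set γ : SL(2, ℤ) := A * ModularGroup.T ^ (-j) * ModularGroup.S⁻¹ with hγ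
    have hmem : γ ∈ CongruenceSubgroup.Gamma0 p := by
      rw [mem_Gamma0_iff_dvd]
      have : γ.1 1 0 = -(A.1 1 1 - A.1 1 0 * j) := by
        rw [hγ, Matrix.SpecialLinearGroup.coe_mul, mul_T_zpow_apply,
          Matrix.SpecialLinearGroup.coe_inv, ModularGroup.coe_S, Matrix.adjugate_fin_two_of]
        simp
        ring
      rw [this]
      exact hj.neg_right
    obtain ⟨c, hc⟩ := hf γ hmem
    have hA : A = γ * (ModularGroup.S * ModularGroup.T ^ j) := by rw [hγ]; group
    rw [hA, SlashAction.slash_mul, hc, SL_smul_slash, SlashAction.slash_mul]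
    exact isBoundedAtImInfty_smul (isBoundedAtImInfty_slash_T_zpow hS j) _

/-- Boundedness at all cusps is inherited by `τ ↦ f(lτ)`: one has
`diag(l, 1) A = A' U` with `A'` in `SL(2, ℤ)` and `U` upper triangular. -/
lemma bounded_scale (hf : ∀ A : SL(2, ℤ), IsBoundedAtImInfty (f ∣[k] A)) (l : ℕ+)
    (A : SL(2, ℤ)) : IsBoundedAtImInfty ((fun τ ↦ f (scale l τ)) ∣[k] A) := by
  have hl : (0 : ℝ) < (l : ℕ) := by exact_mod_cast l.pos
  let D : GL (Fin 2) ℝ := Matrix.GeneralLinearGroup.mkOfDetNeZero !![((l : ℕ) : ℝ), 0; 0, 1]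
    (by simp [Matrix.det_fin_two_of, hl.ne'])
  have hDdet : D.det.val = (l : ℕ) := by
    simp [D, Matrix.GeneralLinearGroup.mkOfDetNeZero, Matrix.det_fin_two_of]
  have hD : f ∣[k] D = (((l : ℕ) : ℂ) ^ (k - 1)) • fun τ ↦ f (scale l τ) := by
    ext τ
    have h1 : D • τ = scale l τ := by
      ext
      rw [coe_smul_of_det_pos (by rw [hDdet]; exact hl)]
      simp [D, num, denom, scale, Matrix.GeneralLinearGroup.mkOfDetNeZero]
    have h2 : denom D τ = 1 := by simp [D, denom, Matrix.GeneralLinearGroup.mkOfDetNeZero]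
    rw [slash_apply, h1, h2, hDdet, Pi.smul_apply, smul_eq_mul, σ, if_pos (by rw [hDdet]; exact hl)]
    simp [mul_comm]
  have hl0 : ((l : ℕ) : ℂ) ^ (k - 1) ≠ 0 := zpow_ne_zero _ (by exact_mod_cast hl.ne')
  have hfs : (fun τ ↦ f (scale l τ)) = (((l : ℕ) : ℂ) ^ (k - 1))⁻¹ • (f ∣[k] D) := by
    rw [hD, smul_smul, inv_mul_cancel₀ hl0, one_smul]
  rw [hfs, SL_smul_slash]
  refine isBoundedAtImInfty_smul ?_ _
  obtain ⟨A', hA'⟩ : ∃ A' : SL(2, ℤ), A'.1 0 0 * A.1 1 0 = A'.1 1 0 * (l * A.1 0 0) := by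
    have hg : Int.gcd (l * A.1 0 0) (A.1 1 0) ≠ 0 := by
      intro h0
      obtain ⟨h1, h2⟩ := Int.gcd_eq_zero_iff.mp h0
      have h3 : A.1 0 0 = 0 := (mul_eq_zero.mp h1).resolve_left (by exact_mod_cast l.ne_zero)
      have := det_eq_one A
      rw [h2, h3] at this
      simp at this
    obtain ⟨p, r, hpr, hp, hr⟩ := Int.exists_gcd_one (Nat.pos_of_ne_zero hg)
    obtain ⟨A', h1, h2⟩ := (Int.isCoprime_iff_gcd_eq_one.mpr hpr).exists_SL2_col 0
    refine ⟨A', ?_⟩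
    rw [h1, h2]
    linear_combination p * hr - r * hp
  have hU : D * (A : GL (Fin 2) ℝ)
      = (A' : GL (Fin 2) ℝ) * (((A'⁻¹ : SL(2, ℤ)) : GL (Fin 2) ℝ) * (D * A)) := by
    rw [← mul_assoc, ← map_mul, ← map_mul, mul_inv_cancel, map_one, map_one, one_mul]
  rw [SL_slash, ← SlashAction.slash_mul, hU, SlashAction.slash_mul]
  refine IsBoundedAtImInfty.slash k ?_ (hf A')
  have hA'' : ((A'.1 0 0 : ℤ) : ℝ) * (A.1 1 0 : ℤ) = (A'.1 1 0 : ℤ) * ((l : ℕ) * (A.1 0 0 : ℤ)) := by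
    exact_mod_cast hA'
  simp only [Matrix.GeneralLinearGroup.coe_mul, Matrix.mul_apply, Fin.sum_univ_two]
  simp [D, Matrix.GeneralLinearGroup.mkOfDetNeZero, Matrix.SpecialLinearGroup.coe_inv,
    Matrix.adjugate_fin_two, -map_inv]
  linear_combination hA''

end Bounded

/-! ### Weight one forms on `Γ₀(N)` for `N ≤ 4` -/

section WeightOne

open ModularForm

/-- Conjugation by `S` turns `(1 0; N 1)` into `T ^ (-N)`, which acts on the transformed eta
quotient by a root of unity. -/
lemma etaQuot_slash_lowerV (n N : ℕ) {a b : ℝ} (ha : 0 < a) (hb : 0 < b) {A B : ℤ}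
    (hA : 1 / a * N = A) (hB : 1 / b * N = B) :
    etaQuot (n + 2) n a b ∣[(1 : ℤ)] lowerV N
      = (zeta24 ^ (B * n - A * (n + 2 : ℕ))) • etaQuot (n + 2) n a b := by
  obtain ⟨c, hc⟩ := exists_etaQuot_slash_S n ha hb
  have hT := etaQuot_slash_T_zpow (a := 1 / a) (b := 1 / b) (n + 2) n 1 (-(N : ℤ)) (A := -A)
    (B := -B) (by push_cast; linarith) (by push_cast; linarith)
  rw [lowerV, SlashAction.slash_mul, SlashAction.slash_mul, hc, SL_smul_slash, hT, smul_comm,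
    SL_smul_slash, ← hc, ← SlashAction.slash_mul, mul_inv_cancel, SlashAction.slash_one]
  congr 2
  ring

/-- A nowhere vanishing holomorphic function that is bounded at all cusps in weight one and is
multiplied by `cT` and `cV` under the weight one action of `T` and of `(1 0; N 1)`. -/
structure IsWeightOneForm (N : ℕ) (cT cV : ℂ) (f : ℍ → ℂ) : Prop where
  holo : MDiff f
  ne_zero : ∀ τ, f τ ≠ 0
  slash_T : f ∣[(1 : ℤ)] ModularGroup.T = cT • f
  slash_V : f ∣[(1 : ℤ)] lowerV N = cV • f
  bounded : ∀ A : SL(2, ℤ), IsBoundedAtImInfty (f ∣[(1 : ℤ)] A)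

lemma mdifferentiable_smul {f : ℍ → ℂ} (hf : MDiff f) (c : ℂ) : MDiff (c • f) := by
  rw [UpperHalfPlane.mdifferentiable_iff] at hf ⊢
  exact hf.const_smul c

lemma isWeightOneForm_etaQuot (N n : ℕ) {a b : ℝ} {κ : ℂ} (hκ : κ ≠ 0) (ha : 0 < a) (hb : 0 < b)
    {A B A' B' : ℤ} (hA : a = A) (hB : b = B) (hA' : 1 / a * N = A') (hB' : 1 / b * N = B')
    (hbd : ∀ A : SL(2, ℤ), IsBoundedAtImInfty ((κ • etaQuot (n + 2) n a b) ∣[(1 : ℤ)] A)) :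
    IsWeightOneForm N (zeta24 ^ (A * (n + 2 : ℕ) - B * n)) (zeta24 ^ (B' * n - A' * (n + 2 : ℕ)))
      (κ • etaQuot (n + 2) n a b) where
  holo := mdifferentiable_smul (mdifferentiable_etaQuot _ _ ha hb) κ
  ne_zero τ := mul_ne_zero hκ (etaQuot_ne_zero ha hb τ)
  slash_T := by
    have h := etaQuot_slash_T_zpow (a := a) (b := b) (n + 2) n 1 1 (A := A) (B := B)
      (by simpa) (by simpa)
    rw [zpow_one] at h
    rw [SL_smul_slash, h, smul_comm]
  slash_V := by
    rw [SL_smul_slash, etaQuot_slash_lowerV n N ha hb hA' hB', smul_comm]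
  bounded := hbd

/-- The two inequalities say that the orders at the cusps `∞` and `0`, the only cusps of `Γ₀(p)`,
are nonnegative. -/
lemma bounded_etaQuot {p : ℕ} (hp : p.Prime) (hp4 : p ≤ 4) (n : ℕ) {a b : ℝ} (κ : ℂ) (ha : 0 < a)
    (hb : 0 < b) {A B A' B' : ℤ} (hA : a = A) (hB : b = B) (hA' : 1 / a * p = A')
    (hB' : 1 / b * p = B') (h1 : b * n ≤ a * (n + 2 : ℕ)) (h2 : 1 / b * n ≤ 1 / a * (n + 2 : ℕ))
    (A : SL(2, ℤ)) : IsBoundedAtImInfty ((κ • etaQuot (n + 2) n a b) ∣[(1 : ℤ)] A) := by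
  rw [SL_smul_slash]
  refine isBoundedAtImInfty_smul (bounded_of_slash_S hp (fun γ hγ ↦ ?_)
    (isBoundedAtImInfty_etaQuot ha hb h1) ?_ A) κ
  · have h := etaQuot_slash_T_zpow (a := a) (b := b) (n + 2) n 1 1 (by simpa) (by simpa)
    rw [zpow_one] at h
    exact exists_slash_eq_smul hp.two_le hp4 (zpow_ne_zero _ zeta24_ne_zero)
      (zpow_ne_zero _ zeta24_ne_zero) h (etaQuot_slash_lowerV n p ha hb hA' hB') hγ
  · obtain ⟨c, hc⟩ := exists_etaQuot_slash_S n ha hb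
    rw [hc]
    exact isBoundedAtImInfty_smul (isBoundedAtImInfty_etaQuot (by positivity) (by positivity) h2) c

namespace IsWeightOneForm

variable {N : ℕ} {cT cV : ℂ} {f : ℍ → ℂ}

lemma slash_coeff_ne_zero (hf : IsWeightOneForm N cT cV f) {γ : SL(2, ℤ)} {c : ℂ}
    (h : f ∣[(1 : ℤ)] γ = c • f) : c ≠ 0 := by
  rintro rfl
  rw [zero_smul, SlashAction.slash_eq_zero_iff] at h
  exact hf.ne_zero UpperHalfPlane.I (by rw [h]; rfl)

lemma exists_multiplier (hf : IsWeightOneForm N cT cV f) (hN2 : 2 ≤ N) (hN4 : N ≤ 4) :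
    ∃ v : SL(2, ℤ) → ℂˣ, IsModularForm (CongruenceSubgroup.Gamma0 N) 1 (fun γ ↦ (v γ : ℂ)) f ∧
      ∀ γ ∈ CongruenceSubgroup.Gamma0 N, f ∣[(1 : ℤ)] γ = (v γ : ℂ) • f := by
  have h (γ : SL(2, ℤ)) : ∃ c : ℂˣ, γ ∈ CongruenceSubgroup.Gamma0 N →
      f ∣[(1 : ℤ)] γ = (c : ℂ) • f := by
    by_cases hγ : γ ∈ CongruenceSubgroup.Gamma0 N
    · obtain ⟨c, hc⟩ := exists_slash_eq_smul hN2 hN4 (hf.slash_coeff_ne_zero hf.slash_T)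
        (hf.slash_coeff_ne_zero hf.slash_V) hf.slash_T hf.slash_V hγ
      exact ⟨c, fun _ ↦ hc⟩
    · exact ⟨1, fun h ↦ absurd h hγ⟩
  choose v hv using h
  exact ⟨v, ⟨hf.holo, fun γ hγ τ ↦ apply_smul_of_slash (k := 1) (hv γ hγ) τ, hf.bounded⟩, hv⟩

/-- A power of `f` has a multiplier that is not a Dirichlet character of `d` as soon as the
multiplier differs from `1` on one matrix with `d ≡ 1`. -/
lemma hasNonDirichletMultiplier_pow (hf : IsWeightOneForm N cT cV f) (hN2 : 2 ≤ N) (hN4 : N ≤ 4)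
    (n : ℕ) {γ : SL(2, ℤ)} {c : ℂ} (hγ : γ ∈ CongruenceSubgroup.Gamma0 N)
    (hd : ((γ.1 1 1 : ℤ) : ZMod N) = 1) (hc : f ∣[(1 : ℤ)] γ = c • f) (hne : c ^ n ≠ 1) :
    HasNonDirichletMultiplier N n (fun τ ↦ f τ ^ n) := by
  obtain ⟨v, hv, hslash⟩ := hf.exists_multiplier hN2 hN4
  have h := hv.pow n
  rw [one_mul] at h
  have hvc : (v γ : ℂ) = c := by
    have h1 := congrFun ((hslash γ hγ).symm.trans hc) UpperHalfPlane.I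
    exact mul_right_cancel₀ (hf.ne_zero _) h1
  refine hasNonDirichletMultiplier_of_slash (v := fun γ ↦ v γ ^ n) (by simpa using h) hγ hd ?_
  simpa [hvc] using hne

lemma hasNonDirichletMultiplier_pow_T (hf : IsWeightOneForm N cT cV f) (hN2 : 2 ≤ N) (hN4 : N ≤ 4)
    (n : ℕ) (hne : cT ^ n ≠ 1) : HasNonDirichletMultiplier N n (fun τ ↦ f τ ^ n) :=
  hf.hasNonDirichletMultiplier_pow hN2 hN4 n (T_mem_Gamma0 N) (by simp [ModularGroup.T])
    hf.slash_T hne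

lemma hasNonDirichletMultiplier_pow_V (hf : IsWeightOneForm N cT cV f) (hN2 : 2 ≤ N) (hN4 : N ≤ 4)
    (n : ℕ) (hne : cV ^ n ≠ 1) : HasNonDirichletMultiplier N n (fun τ ↦ f τ ^ n) :=
  hf.hasNonDirichletMultiplier_pow hN2 hN4 n (lowerV_mem_Gamma0 N) (by simp [coe_lowerV])
    hf.slash_V hne

/-- On `Γ₀(2)` the matrix `-1` excludes Dirichlet characters in weight one. -/
lemma hasNonDirichletMultiplier_two (hf : IsWeightOneForm 2 cT cV f) :
    HasNonDirichletMultiplier 2 1 f := by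
  have h := hf.hasNonDirichletMultiplier_pow le_rfl (by norm_num) 1 (neg_one_mem_Gamma0 2)
    (by simp) (slash_neg_one f 1) (by norm_num)
  simpa using h

/-- `f` has the multiplier `ε` as soon as `ε` behaves correctly under the generators of `Γ₀(N)`. -/
lemma isModularForm (hf : IsWeightOneForm N cT cV f) (hN2 : 2 ≤ N) (hN4 : N ≤ 4)
    (ε : SL(2, ℤ) → ℂ) (hε1 : ε 1 = 1)
    (hεT : ∀ γ ∈ CongruenceSubgroup.Gamma0 N, ε (γ * ModularGroup.T) = ε γ * cT)
    (hεV : ∀ γ ∈ CongruenceSubgroup.Gamma0 N, ε (γ * lowerV N) = ε γ * cV)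
    (hεn : ∀ γ ∈ CongruenceSubgroup.Gamma0 N, ε (γ * -1) = -ε γ) :
    IsModularForm (CongruenceSubgroup.Gamma0 N) 1 ε f where
  holo := hf.holo
  transform γ hγ τ := apply_smul_of_slash (k := 1)
    (slash_eq_of_generators hN2 hN4 (hf.slash_coeff_ne_zero hf.slash_T)
      (hf.slash_coeff_ne_zero hf.slash_V) hf.slash_T hf.slash_V ε hε1 hεT hεV
      (fun γ hγ ↦ by rw [hεn γ hγ]; norm_num) hγ) τ
  bounded := hf.bounded

end IsWeightOneForm

/-- Replacing `f(τ)` by `f(lτ)` raises the level by the factor `l`. -/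
lemma IsModularForm.scale {N k : ℕ} {v w : SL(2, ℤ) → ℂ} {f : ℍ → ℂ} (l : ℕ+)
    (hf : IsModularForm (CongruenceSubgroup.Gamma0 N) k v f)
    (hholo : MDiff (fun τ ↦ f (scale l τ)))
    (hw : ∀ γ γ' : SL(2, ℤ), γ ∈ CongruenceSubgroup.Gamma0 (l * N) →
      γ' ∈ CongruenceSubgroup.Gamma0 N →
      γ'.1 0 1 = l * γ.1 0 1 → γ'.1 1 1 = γ.1 1 1 → v γ' = w γ) :
    IsModularForm (CongruenceSubgroup.Gamma0 (l * N)) k w (fun τ ↦ f (_root_.scale l τ)) where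
  holo := hholo
  transform γ hγ τ := by
    obtain ⟨e, he⟩ := mem_Gamma0_iff_dvd.mp hγ
    push_cast at he
    have hdet := det_eq_one γ
    let γ' : SL(2, ℤ) := ⟨!![γ.1 0 0, l * γ.1 0 1; N * e, γ.1 1 1], by
      rw [he] at hdet
      rw [Matrix.det_fin_two_of]
      linear_combination hdet⟩
    have hγ' : γ' ∈ CongruenceSubgroup.Gamma0 N := by
      rw [mem_Gamma0_iff_dvd]
      exact dvd_mul_right _ _
    have h1 : _root_.scale l (γ • τ) = γ' • _root_.scale l τ := by
      ext
      have hd := denom_ne_zero γ τ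
      rw [ModularGroup.denom_apply] at hd
      simp only [_root_.scale, UpperHalfPlane.coe_mk, coe_specialLinearGroup_apply]
      simp [γ', he]
      ring
    rw [h1, hf.transform γ' hγ', hw γ γ' hγ hγ' rfl rfl]
    congr 3
    simp [γ', he, _root_.scale]
    ring
  bounded := bounded_scale hf.bounded l

end WeightOne

/-! ### The eta quotients on `Γ₀(2)`, `Γ₀(3)` and `Γ₀(4)` -/

section Forms

lemma B4_eq_etaQuot : B4 = (1 : ℂ) • etaQuot (2 + 2) 2 1 2 := by
  ext τ
  simp [B4, etaAt, etaQuot]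

lemma C4_eq_etaQuot : C4 = (((2 : ℝ) ^ (3 / 2 : ℝ) : ℝ) : ℂ) • etaQuot (2 + 2) 2 2 1 := by
  ext τ
  simp [C4, etaAt, etaQuot, mul_div_assoc]

lemma B3_eq_etaQuot : B3 = (1 : ℂ) • etaQuot (1 + 2) 1 1 3 := by
  ext τ
  simp [B3, etaAt, etaQuot]

lemma C3_eq_etaQuot : C3 = (3 : ℂ) • etaQuot (1 + 2) 1 3 1 := by
  ext τ
  simp [C3, etaAt, etaQuot, mul_div_assoc]

lemma C2_eq_etaQuot : C2 = (4 : ℂ) • etaQuot (2 + 2) 2 4 2 := by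
  ext τ
  simp [C2, etaAt, etaQuot, mul_div_assoc]
  norm_num

lemma C4_const_ne_zero : (((2 : ℝ) ^ (3 / 2 : ℝ) : ℝ) : ℂ) ≠ 0 := by
  rw [Complex.ofReal_ne_zero]
  positivity

lemma etaQuot_scale (m n : ℕ) (a b : ℝ) (l : ℕ+) (τ : ℍ) :
    etaQuot m n a b (scale l τ) = etaQuot m n (l * a) (l * b) τ := by
  simp only [etaQuot, scale, UpperHalfPlane.coe_mk]
  push_cast
  congr 3 <;> ring_nf

lemma isWeightOneForm_B4 : IsWeightOneForm 2 1 (Complex.I⁻¹) B4 := by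
  have hb := bounded_etaQuot Nat.prime_two (by norm_num) 2 (a := 1) (b := 2) (1 : ℂ) (by norm_num)
    (by norm_num) (A := 1) (B := 2) (A' := 2) (B' := 1) (by simp) (by simp) (by simp) (by simp)
    (by norm_num) (by norm_num)
  have h := isWeightOneForm_etaQuot 2 2 (a := 1) (b := 2) one_ne_zero (by norm_num)
    (by norm_num) (A := 1) (B := 2) (A' := 2) (B' := 1) (by simp) (by simp) (by simp) (by simp) hb
  rw [← B4_eq_etaQuot] at h
  convert h using 1
  · norm_num
  · rw [← zeta24_pow_six]; norm_num [zpow_neg]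

lemma isWeightOneForm_C4 : IsWeightOneForm 2 Complex.I 1 C4 := by
  have hb := bounded_etaQuot Nat.prime_two (by norm_num) 2 (a := 2) (b := 1)
    (((2 : ℝ) ^ (3 / 2 : ℝ) : ℝ) : ℂ) (by norm_num)
    (by norm_num) (A := 2) (B := 1) (A' := 1) (B' := 2) (by simp) (by simp) (by simp) (by simp)
    (by norm_num) (by norm_num)
  have h := isWeightOneForm_etaQuot 2 2 (a := 2) (b := 1) C4_const_ne_zero (by norm_num)
    (by norm_num) (A := 2) (B := 1) (A' := 1) (B' := 2) (by simp) (by simp) (by simp) (by simp) hb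
  rw [← C4_eq_etaQuot] at h
  convert h using 1
  · rw [← zeta24_pow_six]; norm_num
  · norm_num

lemma isWeightOneForm_B3 : IsWeightOneForm 3 1 (cubeRoot⁻¹) B3 := by
  have hb := bounded_etaQuot Nat.prime_three (by norm_num) 1 (a := 1) (b := 3) (1 : ℂ)
    (by norm_num) (by norm_num) (A := 1) (B := 3) (A' := 3) (B' := 1) (by simp) (by simp)
    (by simp) (by simp) (by norm_num) (by norm_num)
  have h := isWeightOneForm_etaQuot 3 1 (a := 1) (b := 3) one_ne_zero (by norm_num)
    (by norm_num) (A := 1) (B := 3) (A' := 3) (B' := 1) (by simp) (by simp) (by simp) (by simp) hb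
  rw [← B3_eq_etaQuot] at h
  convert h using 1
  · norm_num
  · rw [← zeta24_pow_eight]; norm_num [zpow_neg]

lemma isWeightOneForm_C3 : IsWeightOneForm 3 cubeRoot 1 C3 := by
  have hb := bounded_etaQuot Nat.prime_three (by norm_num) 1 (a := 3) (b := 1) (3 : ℂ)
    (by norm_num) (by norm_num) (A := 3) (B := 1) (A' := 1) (B' := 3) (by simp) (by simp)
    (by simp) (by simp) (by norm_num) (by norm_num)
  have h := isWeightOneForm_etaQuot 3 1 (a := 3) (b := 1) three_ne_zero (by norm_num)
    (by norm_num) (A := 3) (B := 1) (A' := 1) (B' := 3) (by simp) (by simp) (by simp) (by simp) hb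
  rw [← C3_eq_etaQuot] at h
  convert h using 1
  · rw [← zeta24_pow_eight]; norm_num
  · norm_num

lemma zeta24_pow_twelve : zeta24 ^ 12 = -1 := by
  rw [show (12 : ℕ) = 6 * 2 by norm_num, pow_mul, zeta24_pow_six, Complex.I_sq]

lemma isWeightOneForm_B2 : IsWeightOneForm 4 1 (-1) B2 := by
  have h := isWeightOneForm_etaQuot 4 2 (a := 1) (b := 2) one_ne_zero (by norm_num)
    (by norm_num) (A := 1) (B := 2) (A' := 4) (B' := 2) (by simp) (by simp) (by simp)
    (by norm_num) (by rw [← B4_eq_etaQuot]; exact isWeightOneForm_B4.bounded)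
  rw [← B4_eq_etaQuot] at h
  change IsWeightOneForm 4 1 (-1) B4
  convert h using 1
  · norm_num
  · rw [← inv_neg_one, ← zeta24_pow_twelve]; norm_num [zpow_neg]

lemma isWeightOneForm_C2 : IsWeightOneForm 4 (-1) 1 C2 := by
  -- `Γ₀(4)` has three cusps; boundedness is inherited from `𝒞₄`, as `𝒞₂(τ)` is a
  -- multiple of `𝒞₄(2τ)`.
  have hC : C2 = ((4 : ℂ) / (((2 : ℝ) ^ (3 / 2 : ℝ) : ℝ) : ℂ)) • fun τ ↦ C4 (scale 2 τ) := by
    rw [C2_eq_etaQuot, C4_eq_etaQuot]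
    ext τ
    simp only [Pi.smul_apply, smul_eq_mul, etaQuot_scale]
    rw [← mul_assoc, div_mul_cancel₀ _ C4_const_ne_zero]
    norm_num
  have hb (A : SL(2, ℤ)) : IsBoundedAtImInfty (C2 ∣[(1 : ℤ)] A) := by
    rw [hC, ModularForm.SL_smul_slash]
    exact isBoundedAtImInfty_smul (bounded_scale isWeightOneForm_C4.bounded 2 A) _
  rw [C2_eq_etaQuot] at hb
  have h := isWeightOneForm_etaQuot 4 2 (a := 4) (b := 2) (κ := 4) (by norm_num) (by norm_num)
    (by norm_num) (A := 4) (B := 2) (A' := 1) (B' := 2) (by simp) (by simp) (by simp)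
    (by norm_num) hb
  rw [← C2_eq_etaQuot] at h
  convert h using 1
  · rw [← zeta24_pow_twelve]; norm_num
  · norm_num

/-- On `Γ₀(2)` in weight one `-1` rules out Dirichlet characters; in the other cases one of the
unipotent generators, for which `d = 1`, has a multiplier different from `1`. -/
theorem nonDirichletMultipliers : HasNonDirichletMultiplier 2 1 B4 ∧
      HasNonDirichletMultiplier 2 1 C4 ∧
      HasNonDirichletMultiplier 2 2 (fun τ => B4 τ ^ 2) ∧
      HasNonDirichletMultiplier 2 2 (fun τ => C4 τ ^ 2) ∧
      HasNonDirichletMultiplier 3 1 B3 ∧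
      HasNonDirichletMultiplier 3 1 C3 ∧
      HasNonDirichletMultiplier 4 1 B2 ∧
      HasNonDirichletMultiplier 4 1 C2 ∧
      HasNonDirichletMultiplier 4 3 (fun τ => B2 τ ^ 3) ∧
      HasNonDirichletMultiplier 4 3 (fun τ => C2 τ ^ 3) := by
  refine ⟨isWeightOneForm_B4.hasNonDirichletMultiplier_two,
    isWeightOneForm_C4.hasNonDirichletMultiplier_two,
    isWeightOneForm_B4.hasNonDirichletMultiplier_pow_V le_rfl (by norm_num) 2 (by norm_num),
    isWeightOneForm_C4.hasNonDirichletMultiplier_pow_T le_rfl (by norm_num) 2 (by norm_num),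
    ?_, ?_, ?_, ?_,
    isWeightOneForm_B2.hasNonDirichletMultiplier_pow_V (by norm_num) le_rfl 3 (by norm_num),
    isWeightOneForm_C2.hasNonDirichletMultiplier_pow_T (by norm_num) le_rfl 3 (by norm_num)⟩
  · simpa using isWeightOneForm_B3.hasNonDirichletMultiplier_pow_V (by norm_num) (by norm_num) 1
      (by simpa using cubeRoot_ne_one)
  · simpa using isWeightOneForm_C3.hasNonDirichletMultiplier_pow_T (by norm_num) (by norm_num) 1
      (by simpa using cubeRoot_ne_one)
  · simpa using isWeightOneForm_B2.hasNonDirichletMultiplier_pow_V (by norm_num) le_rfl 1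
      (by norm_num)
  · simpa using isWeightOneForm_C2.hasNonDirichletMultiplier_pow_T (by norm_num) le_rfl 1
      (by norm_num)

end Forms

/-! ### Dirichlet characters as multipliers on `Γ₀(8)` and `Γ₀(9)` -/

section Nebentypus

open CongruenceSubgroup

lemma zpow_congr_of_dvd_sub {z : ℂ} {m : ℕ} (hm : m ≠ 0) (hz : z ^ m = 1) {x y : ℤ}
    (h : (m : ℤ) ∣ x - y) : z ^ x = z ^ y := by
  obtain ⟨k, hk⟩ := h
  have hz0 : z ≠ 0 := by
    rintro rfl
    simp [hm] at hz
  rw [show x = y + m * k by linarith, zpow_add₀ hz0, zpow_mul, zpow_natCast, hz, one_zpow, mul_one]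

/-- The multiplier has the form `χ(d) z^(E γ)` with `χ` odd and `z` an `m`-th root of unity as soon
as the exponent `E` has, modulo `m`, the right increments along the generators of `Γ₀(N)`. -/
lemma IsWeightOneForm.isModularForm_of_exponent {N m : ℕ} {cT cV z : ℂ} {f : ℍ → ℂ}
    (hf : IsWeightOneForm N cT cV f) (hN2 : 2 ≤ N) (hN4 : N ≤ 4) {χ : DirichletCharacter ℂ N}
    (hχ : χ (-1) = -1) (hm : m ≠ 0) (hz : z ^ m = 1) {s t : ℤ} (hs : cT = z ^ s) (ht : cV = z ^ t)
    (E : SL(2, ℤ) → ℤ) (h1 : (m : ℤ) ∣ E 1)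
    (hT : ∀ γ ∈ Gamma0 N, (m : ℤ) ∣ E (γ * ModularGroup.T) - (E γ + s))
    (hV : ∀ γ ∈ Gamma0 N, (m : ℤ) ∣ E (γ * lowerV N) - (E γ + t))
    (hn : ∀ γ ∈ Gamma0 N, (m : ℤ) ∣ E (γ * -1) - E γ) :
    IsModularForm (Gamma0 N) 1 (fun γ ↦ χ ((γ.1 1 1 : ℤ) : ZMod N) * z ^ E γ) f := by
  have hz0 : z ≠ 0 := by
    rintro rfl
    simp [hm] at hz
  refine hf.isModularForm hN2 hN4 _ ?_ (fun γ hγ ↦ ?_) (fun γ hγ ↦ ?_) (fun γ hγ ↦ ?_)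
  · rw [zpow_congr_of_dvd_sub hm hz (y := 0) (by simpa using h1)]
    simp
  · obtain ⟨c, hc⟩ := mem_Gamma0_iff_dvd.mp hγ
    have h := mul_T_zpow_apply γ 1
    rw [zpow_one] at h
    rw [zpow_congr_of_dvd_sub hm hz (hT γ hγ), zpow_add₀ hz0, ← hs, h]
    simp [hc, mul_assoc]
  · have h := mul_lowerV_zpow_apply N γ 1
    rw [zpow_one] at h
    rw [zpow_congr_of_dvd_sub hm hz (hV γ hγ), zpow_add₀ hz0, ← ht, h]
    simp [mul_assoc]
  · rw [zpow_congr_of_dvd_sub hm hz (hn γ hγ)]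
    simp only [mul_neg, mul_one, Matrix.SpecialLinearGroup.coe_neg, Matrix.neg_apply, Int.cast_neg]
    rw [← neg_one_mul ((γ.1 1 1 : ℤ) : ZMod N), map_mul, hχ]
    ring

lemma IsModularForm.mono {Γ Γ' : Subgroup SL(2, ℤ)} {k : ℕ} {v : SL(2, ℤ) → ℂ} {f : ℍ → ℂ}
    (hf : IsModularForm Γ k v f) (h : Γ' ≤ Γ) : IsModularForm Γ' k v f where
  holo := hf.holo
  transform γ hγ := hf.transform γ (h hγ)
  bounded := hf.bounded

lemma Gamma0_le_Gamma0 {M N : ℕ} (h : N ∣ M) : Gamma0 M ≤ Gamma0 N := fun γ hγ ↦ by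
  rw [mem_Gamma0_iff_dvd] at hγ ⊢
  exact (Int.natCast_dvd_natCast.mpr h).trans hγ

/-- The lower right entry of a matrix in `Γ₀(M)` is prime to `M`, so that a character of lower level
takes there the same value as the character it induces. -/
lemma changeLevel_apply_of_mem_Gamma0 {M N : ℕ} (h : N ∣ M) (χ : DirichletCharacter ℂ N)
    {γ : SL(2, ℤ)} (hγ : γ ∈ Gamma0 M) :
    DirichletCharacter.changeLevel h χ ((γ.1 1 1 : ℤ) : ZMod M) = χ ((γ.1 1 1 : ℤ) : ZMod N) := by
  refine DirichletCharacter.changeLevel_eq_cast_of_dvd' χ h ?_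
  obtain ⟨c, hc⟩ := mem_Gamma0_iff_dvd.mp hγ
  have hdet := det_eq_one γ
  rw [hc] at hdet
  exact ⟨γ.1 0 0, -(γ.1 0 1 * c), by linear_combination hdet⟩

lemma chi3_neg_one : chi3 (-1) = -1 := by
  have : quadraticChar (ZMod 3) (-1) = -1 := by decide
  rw [chi3_apply, this]
  simp

lemma chi4_neg_one : chi4 (-1) = -1 := by
  have : ZMod.χ₄ (-1) = -1 := by decide
  rw [chi4_apply, this]
  simp

lemma three_dvd_sq_sub_one {d x : ℤ} (h : (3 : ℤ) ∣ x * d - 1) : (3 : ℤ) ∣ d * d - 1 := by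
  have hd : ¬ (3 : ℤ) ∣ d := fun h' ↦ by
    have := dvd_sub (h'.mul_left x) h
    omega
  rcases (by omega : d % 3 = 1 ∨ d % 3 = 2) with h' | h' <;>
    simp [Int.dvd_iff_emod_eq_zero, Int.sub_emod, Int.mul_emod, h']

/-- `ℬ₃` on `Γ₀(3)` has the multiplier `χ₋₃(d) ω^(-cd/3)` with `ω = exp(2πi/3)`. -/
lemma isModularForm_B3 : IsModularForm (Gamma0 3) 1 (fun γ ↦ chi3 ((γ.1 1 1 : ℤ) : ZMod 3)
    * cubeRoot ^ (-(γ.1 1 0 / 3 * γ.1 1 1))) B3 := by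
  refine isWeightOneForm_B3.isModularForm_of_exponent (by norm_num) (by norm_num) chi3_neg_one
    three_ne_zero cubeRoot_pow_three (s := 0) (t := -1) (by simp) (by simp) _ (by simp)
    (fun γ hγ ↦ ?_) (fun γ hγ ↦ ?_) (fun γ hγ ↦ ?_) <;>
  obtain ⟨c, hc⟩ := mem_Gamma0_iff_dvd.mp hγ <;> push_cast at hc
  · have h := mul_T_zpow_apply γ 1
    rw [zpow_one] at h
    rw [h]
    simp [hc]
    exact ⟨-(c * c), by ring⟩
  · have h := mul_lowerV_zpow_apply 3 γ 1
    rw [zpow_one] at h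
    have h2 : (3 : ℤ) ∣ γ.1 1 1 * γ.1 1 1 - 1 := three_dvd_sq_sub_one (x := γ.1 0 0) (by
      have := det_eq_one γ
      rw [hc] at this
      exact ⟨γ.1 0 1 * c, by linear_combination this⟩)
    rw [h]
    have h3 : (3 * c + γ.1 1 1 * 3) / 3 = c + γ.1 1 1 := by omega
    simp [hc, h3]
    obtain ⟨e, he⟩ := h2
    exact ⟨-e, by linear_combination -he⟩
  · simp [hc]
    have h3 : -(3 * c) / 3 = -c := by omega
    rw [h3]
    exact ⟨0, by ring⟩

/-- `𝒞₃` on `Γ₀(3)` has the multiplier `χ₋₃(d) ω^(bd)` with `ω = exp(2πi/3)`. -/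
lemma isModularForm_C3 : IsModularForm (Gamma0 3) 1 (fun γ ↦ chi3 ((γ.1 1 1 : ℤ) : ZMod 3)
    * cubeRoot ^ (γ.1 0 1 * γ.1 1 1)) C3 := by
  refine isWeightOneForm_C3.isModularForm_of_exponent (by norm_num) (by norm_num) chi3_neg_one
    three_ne_zero cubeRoot_pow_three (s := 1) (t := 0) (by simp) (by simp) _ (by simp)
    (fun γ hγ ↦ ?_) (fun γ hγ ↦ ?_) (fun γ hγ ↦ by simp) <;>
  obtain ⟨c, hc⟩ := mem_Gamma0_iff_dvd.mp hγ <;> push_cast at hc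
  · have h := mul_T_zpow_apply γ 1
    rw [zpow_one] at h
    have := det_eq_one γ
    rw [hc] at this
    rw [h]
    simp [hc]
    exact ⟨γ.1 0 0 * c + 2 * γ.1 0 1 * c, by linear_combination this⟩
  · have h := mul_lowerV_zpow_apply 3 γ 1
    rw [zpow_one] at h
    rw [h]
    simp

/-- `ℬ₂` on `Γ₀(4)` has the multiplier `χ₋₄(d) (-1)^(c/4)`. -/
lemma isModularForm_B2 : IsModularForm (Gamma0 4) 1 (fun γ ↦ chi4 ((γ.1 1 1 : ℤ) : ZMod 4)
    * (-1) ^ (γ.1 1 0 / 4)) B2 := by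
  refine isWeightOneForm_B2.isModularForm_of_exponent (by norm_num) le_rfl chi4_neg_one
    two_ne_zero (by norm_num) (s := 0) (t := 1) (by simp) (by simp) _ (by simp)
    (fun γ hγ ↦ ?_) (fun γ hγ ↦ ?_) (fun γ hγ ↦ ?_) <;>
  obtain ⟨c, hc⟩ := mem_Gamma0_iff_dvd.mp hγ <;> push_cast at hc
  · have h := mul_T_zpow_apply γ 1
    rw [zpow_one] at h
    rw [h]
    simp
  · have h := mul_lowerV_zpow_apply 4 γ 1
    rw [zpow_one] at h
    have hd : γ.1 1 1 % 2 = 1 := by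
      have := det_eq_one γ
      rw [hc] at this
      by_contra h'
      have h2 : (2 : ℤ) ∣ γ.1 1 1 := by omega
      obtain ⟨e, he⟩ := h2
      rw [he] at this
      have : (2 : ℤ) ∣ 1 := ⟨γ.1 0 0 * e - 2 * γ.1 0 1 * c, by linear_combination -this⟩
      omega
    rw [h]
    have h3 : (4 * c + γ.1 1 1 * 4) / 4 = c + γ.1 1 1 := by omega
    simp [hc, h3]
    omega
  · simp [hc]
    omega

/-- `𝒞₂` on `Γ₀(4)` has the multiplier `χ₋₄(d) (-1)^b`. -/
lemma isModularForm_C2 : IsModularForm (Gamma0 4) 1 (fun γ ↦ chi4 ((γ.1 1 1 : ℤ) : ZMod 4)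
    * (-1) ^ γ.1 0 1) C2 := by
  refine isWeightOneForm_C2.isModularForm_of_exponent (by norm_num) le_rfl chi4_neg_one
    two_ne_zero (by norm_num) (s := 1) (t := 0) (by simp) (by simp) _ (by simp)
    (fun γ hγ ↦ ?_) (fun γ hγ ↦ ?_) (fun γ hγ ↦ ?_) <;>
  obtain ⟨c, hc⟩ := mem_Gamma0_iff_dvd.mp hγ <;> push_cast at hc
  · have h := mul_T_zpow_apply γ 1
    rw [zpow_one] at h
    have hd : γ.1 0 0 % 2 = 1 := by
      have := det_eq_one γ
      rw [hc] at this
      by_contra h'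
      have h2 : (2 : ℤ) ∣ γ.1 0 0 := by omega
      obtain ⟨e, he⟩ := h2
      rw [he] at this
      have : (2 : ℤ) ∣ 1 := ⟨e * γ.1 1 1 - 2 * γ.1 0 1 * c, by linear_combination -this⟩
      omega
    rw [h]
    simp
    omega
  · have h := mul_lowerV_zpow_apply 4 γ 1
    rw [zpow_one] at h
    rw [h]
    simp
  · simp
    omega

lemma memM_B3 : MemM 1 9 chi3mod9 B3 := by
  refine (isModularForm_B3.mono (Gamma0_le_Gamma0 (by norm_num))).congr fun γ hγ ↦ ?_
  rw [chi3mod9, changeLevel_apply_of_mem_Gamma0 _ _ hγ]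
  obtain ⟨c, hc⟩ := mem_Gamma0_iff_dvd.mp hγ
  push_cast at hc
  have h : γ.1 1 0 / 3 = 3 * c := by omega
  rw [h, zpow_congr_of_dvd_sub (m := 3) (by norm_num) cubeRoot_pow_three (y := 0)
    ⟨-(c * γ.1 1 1), by push_cast; ring⟩, zpow_zero, mul_one]

lemma memM_B2 : MemM 1 8 chi4mod8 B2 := by
  refine (isModularForm_B2.mono (Gamma0_le_Gamma0 (by norm_num))).congr fun γ hγ ↦ ?_
  rw [chi4mod8, changeLevel_apply_of_mem_Gamma0 _ _ hγ]
  obtain ⟨c, hc⟩ := mem_Gamma0_iff_dvd.mp hγ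
  push_cast at hc
  have h : γ.1 1 0 / 4 = 2 * c := by omega
  rw [h, zpow_congr_of_dvd_sub (m := 2) (by norm_num) (by norm_num) (y := 0)
    ⟨c, by push_cast; ring⟩, zpow_zero, mul_one]

lemma memM_C3_scale : MemM 1 9 chi3mod9 (fun τ ↦ C3 (scale 3 τ)) := by
  refine isModularForm_C3.scale 3 ?_ fun γ γ' hγ _ hb hd ↦ ?_
  · rw [C3_eq_etaQuot]
    simp only [Pi.smul_apply, etaQuot_scale]
    exact mdifferentiable_smul
      (mdifferentiable_etaQuot _ _ (by norm_num) (by norm_num)) _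
  · replace hγ : γ ∈ Gamma0 9 := hγ
    rw [chi3mod9, changeLevel_apply_of_mem_Gamma0 _ _ hγ, hb, hd,
      zpow_congr_of_dvd_sub (m := 3) (by norm_num) cubeRoot_pow_three (y := 0)
      ⟨γ.1 0 1 * γ.1 1 1, by push_cast; ring⟩, zpow_zero, mul_one]

lemma memM_C2_scale : MemM 1 8 chi4mod8 (fun τ ↦ C2 (scale 2 τ)) := by
  refine isModularForm_C2.scale 2 ?_ fun γ γ' hγ _ hb hd ↦ ?_
  · rw [C2_eq_etaQuot]
    simp only [Pi.smul_apply, etaQuot_scale]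
    exact mdifferentiable_smul
      (mdifferentiable_etaQuot _ _ (by norm_num) (by norm_num)) _
  · replace hγ : γ ∈ Gamma0 8 := hγ
    rw [chi4mod8, changeLevel_apply_of_mem_Gamma0 _ _ hγ, hb, hd,
      zpow_congr_of_dvd_sub (m := 2) (by norm_num) (by norm_num) (y := 0)
      ⟨γ.1 0 1, by push_cast; ring⟩, zpow_zero, mul_one]

lemma chi4_pow_three (j : ZMod 4) : chi4 j ^ 3 = chi4 j := by
  have : ∀ j, ZMod.χ₄ j ^ 3 = ZMod.χ₄ j := by decide
  rw [chi4_apply]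
  exact_mod_cast this j

lemma MemM.pow_three {f : ℍ → ℂ} (hf : MemM 1 8 chi4mod8 f) :
    MemM 3 8 chi4mod8 (fun τ ↦ f τ ^ 3) := by
  refine (IsModularForm.pow hf 3).congr fun γ hγ ↦ ?_
  rw [chi4mod8, changeLevel_apply_of_mem_Gamma0 _ _ hγ, chi4_pow_three]

/-- On the subgroups `9 ∣ c` and `8 ∣ c` the extra root of unity in the multipliers of `ℬ₃` and `ℬ₂`
disappears; for `𝒞₃(3τ)` and `𝒞₂(2τ)` it does since the entry `b` gets multiplied by `3` and `2`. -/
theorem dirichletMultipliers : MemM 1 9 chi3mod9 B3 ∧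
      MemM 1 9 chi3mod9 (fun τ => C3 (scale 3 τ)) ∧
      MemM 1 8 chi4mod8 B2 ∧
      MemM 1 8 chi4mod8 (fun τ => C2 (scale 2 τ)) ∧
      MemM 3 8 chi4mod8 (fun τ => B2 τ ^ 3) ∧
      MemM 3 8 chi4mod8 (fun τ => C2 (scale 2 τ) ^ 3) :=
  ⟨memM_B3, memM_C3_scale, memM_B2, memM_C2_scale, memM_B2.pow_three, memM_C2_scale.pow_three⟩

end Nebentypus

theorem mainTheorem11 :
    -- the `q`-expansions on `Γ₀(2)`, `Γ₀(3)`, `Γ₀(4)`; all series converge (absolutely)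
    (∀ τ : ℍ,
      (∃ S : ℂ, HasSum (fun n : ℕ+ =>
          sigmaW 0 n ![0, 1, -2, -1, 0, 1, 2, -1] * qpow (n : ℕ) τ) S ∧
        B4 τ = 1 - 4 * S) ∧
      (∃ S : ℂ, HasSum (fun n : ℕ+ =>
          sigmaW 0 n ![0, 1, -1, -1, 0, 1, 1, -1] * qpow ((n : ℕ) / 4) τ) S ∧
        C4 τ = (((2 : ℝ) ^ (3 / 2 : ℝ) : ℝ) : ℂ) * S) ∧
      (∃ S : ℂ, HasSum (fun n : ℕ+ =>
          sigmaW 1 n ![0, 1, -2, 1] * qpow (n : ℕ) τ) S ∧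
        B4 τ ^ 2 = 1 - 8 * S) ∧
      (∃ S : ℂ, HasSum (fun n : ℕ+ =>
          sigmaW 1 n ![0, 2, -1, 2] * qpow ((n : ℕ) / 2) τ) S ∧
        C4 τ ^ 2 = 4 * S) ∧
      (∃ S : ℂ, HasSum (fun n : ℕ+ =>
          sigmaW 0 n ![0, 1, -1, -3, 1, -1, 3, 1, -1] * qpow (n : ℕ) τ) S ∧
        B3 τ = 1 - 3 * S) ∧
      (∃ S : ℂ, HasSum (fun n : ℕ+ =>
          sigmaW 0 n ![0, 1, -1, -1, 1, -1, 1, 1, -1] * qpow ((n : ℕ) / 3) τ) S ∧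
        C3 τ = 3 * S) ∧
      (∃ S : ℂ, HasSum (fun n : ℕ+ =>
          sigmaW 0 n ![0, 1, -2, -1, 0, 1, 2, -1] * qpow (n : ℕ) τ) S ∧
        B2 τ = 1 - 4 * S) ∧
      (∃ S : ℂ, HasSum (fun n : ℕ+ =>
          sigmaW 0 n ![0, 1, -1, -1, 0, 1, 1, -1] * qpow ((n : ℕ) / 2) τ) S ∧
        C2 τ = 4 * S) ∧
      (∃ S T : ℂ,
        HasSum (fun n : ℕ+ =>
          sigmaW 2 n ![0, 2, -1, -2, 0, 2, 1, -2] * qpow (n : ℕ) τ) S ∧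
        HasSum (fun n : ℕ+ =>
          sigmaC 2 n ![0, 1, -8, -1, 0, 1, 8, -1] * qpow (n : ℕ) τ) T ∧
        B2 τ ^ 3 = 1 + 2 * S - 16 * T) ∧
      (∃ S T : ℂ,
        HasSum (fun n : ℕ+ =>
          sigmaW 2 n ![0, -4, 1, 4, 0, -4, -1, 4] * qpow ((n : ℕ) / 2) τ) S ∧
        HasSum (fun n : ℕ+ =>
          sigmaC 2 n ![0, 1, -4, -1, 0, 1, 4, -1] * qpow ((n : ℕ) / 2) τ) T ∧
        C2 τ ^ 3 = S + 4 * T)) ∧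
    -- the multiplier systems are not of Dirichlet-character type
    (HasNonDirichletMultiplier 2 1 B4 ∧
      HasNonDirichletMultiplier 2 1 C4 ∧
      HasNonDirichletMultiplier 2 2 (fun τ => B4 τ ^ 2) ∧
      HasNonDirichletMultiplier 2 2 (fun τ => C4 τ ^ 2) ∧
      HasNonDirichletMultiplier 3 1 B3 ∧
      HasNonDirichletMultiplier 3 1 C3 ∧
      HasNonDirichletMultiplier 4 1 B2 ∧
      HasNonDirichletMultiplier 4 1 C2 ∧
      HasNonDirichletMultiplier 4 3 (fun τ => B2 τ ^ 3) ∧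
      HasNonDirichletMultiplier 4 3 (fun τ => C2 τ ^ 3)) ∧
    -- the spaces in which the forms, in suitable powers of `q`, lie
    (MemM 1 9 chi3mod9 B3 ∧
      MemM 1 9 chi3mod9 (fun τ => C3 (scale 3 τ)) ∧
      MemM 1 8 chi4mod8 B2 ∧
      MemM 1 8 chi4mod8 (fun τ => C2 (scale 2 τ)) ∧
      MemM 3 8 chi4mod8 (fun τ => B2 τ ^ 3) ∧
      MemM 3 8 chi4mod8 (fun τ => C2 (scale 2 τ) ^ 3)) ∧
    -- the Eisenstein representations
    (∀ τ : ℍ,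
      B3 τ = -(1 / 2) * Eis 1 triv chi3 τ + 3 / 2 * Eis 1 triv chi3 (scale 3 τ) ∧
      C3 (scale 3 τ) = 1 / 2 * Eis 1 triv chi3 τ - 1 / 2 * Eis 1 triv chi3 (scale 3 τ) ∧
      B2 τ = -Eis 1 triv chi4 τ + 2 * Eis 1 triv chi4 (scale 2 τ) ∧
      C2 (scale 2 τ) = Eis 1 triv chi4 τ - Eis 1 triv chi4 (scale 2 τ) ∧
      B2 τ ^ 3 = -Eis 3 triv chi4 τ + 2 * Eis 3 triv chi4 (scale 2 τ)
        - 8 * Eis 3 chi4 triv τ + 64 * Eis 3 chi4 triv (scale 2 τ) ∧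
      C2 (scale 2 τ) ^ 3 = Eis 3 triv chi4 τ - Eis 3 triv chi4 (scale 2 τ)
        + 2 * Eis 3 chi4 triv τ - 8 * Eis 3 chi4 triv (scale 2 τ)) := by
  exact ⟨qExpansions, nonDirichletMultipliers, dirichletMultipliers, eisensteinRepresentations⟩
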